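/- Let $d\in\mathbb N=\{0,1,2,\dots\}$ and $s>1$. For $V\subset\mathbb R^d$, $A,C>0$ and a complex-valued function $u$ that is smooth near $V$, write $u\in B_s(A,C;V)$ if $|\partial^\alpha u(x)|\le A\,C^{|\alpha|}\alpha!^{\,s}$ for all $\alpha\in\mathbb N^d$ and $x\in V$. For $W\subset\mathbb R^d$ open, the Gevrey class $\mathcal G^s(W)$ is the set of $u\in C^\infty(W;\mathbb C)$ such that for every compact $K\subset W$ there are $A,C>0$ with $u\in B_s(A,C;K)$. Let $W\subset\mathbb R^d$ be open, $x_0\in W$, and let $f\in\mathcal G^s(W)$ satisfy $f(x_0)=0$, $f'(x_0)=0$ and $\operatorname{Im}f''(x_0)$ positive definite. Put $$g_{x_0}(x)=f(x)-\tfrac12 f''(x_0)(x-x_0)\cdot(x-x_0),$$ and for $u\in\mathcal G^s(W)$ and $j\in\mathbb N$ $$L_ju=\sum_{\substack{\mu,\nu\ge0,\ \nu-\mu=j\\ 2\nu\ge3\mu}}\frac{i^{\mu+\nu}}{2^\nu\mu!\,\nu!}\,\bigl(f''(x_0)^{-1}\partial\cdot\partial\bigr)^\nu\bigl(g_{x_0}^\mu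 u\bigr)(x_0).$$ (i) There are an open neighborhood $U$ of $x_0$ whose closure is a compact subset of $W$, and $h_0>0$, both independent of $u$, such that for all $u\in\mathcal G^s(W)$, $k\in\mathbb N$ and $0<h<h_0$, $$\biggl|\int_U e^{\frac ihf(x)}u(x)\,dx-\Bigl(\det\frac{f''(x_0)}{2\pi ih}\Bigr)^{-1/2}\sum_{j<k}h^jL_ju\biggr|\le C^{k+1}\,k!^{\,2s-1}\,h^{k+\frac d2}.$$ Here $C$ depends only on $d$, $s$, on constants $A_u,C_u,A_f,C_f>0$ with $u\in B_s(A_u,C_u;U)$, $f\in B_s(A_f,C_f;U)$, and on a constant $c>0$ with $\operatorname{Im}f''(x_0)v\cdot v\ge c|v|^2$ for all $v\in\mathbb R^d$. The matrix $f''(x_0)/(2\pi ih)$ is symmetric with positive definite real part, and $\det^{-1/2}$ is the branch that is continuous on the set of such matrices and positive on the real ones, i.e. the product of the principal values $\lambda^{-1/2}$ over the eigenvalues $\lambda$, counted with multiplicity. (ii) If $u\in\mathcal G^s(W)$, $u\in B_s(A_u,C_u;\{x_0\})$, $f\in B_s(A_f,C_f;\{x_0\})$, and $c_0>0$ bounds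 the absolute values of the entries of $f''(x_0)^{-1}$, then $$|L_ju|\le A\,C^j\,j!^{\,2s-1}\quad(j\in\mathbb N),\qquad A=2A_u,$$ where $C$ depends only on $d,s,C_u,A_f,C_f,c_0$. -/

import Mathlib

open MeasureTheory
open scoped ContDiff

noncomputable section

namespace GevreyPhase

variable {d : ℕ}

/-- The partial derivative `∂ᵢ u` of a complex-valued function on `ℝᵈ`. -/
def pderiv (i : Fin d) (u : EuclideanSpace ℝ (Fin d) → ℂ) : EuclideanSpace ℝ (Fin d) → ℂ :=
  fun x => fderiv ℝ u x (EuclideanSpace.single i 1)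

/-- The iterated partial derivative `∂^α u = ∂₀^(α 0) ∂₁^(α 1) ⋯ u`, for a multi-index `α ∈ ℕᵈ`. -/
def mderiv (α : Fin d → ℕ) (u : EuclideanSpace ℝ (Fin d) → ℂ) : EuclideanSpace ℝ (Fin d) → ℂ :=
  (List.finRange d).foldr (fun i v => (pderiv i)^[α i] v) u

/-- The bounds `|∂^α u(x)| ≤ A C^|α| α!^s` for all multi-indices `α` and all `x ∈ V`. -/
def GevreyBoundOn (s A C : ℝ) (V : Set (EuclideanSpace ℝ (Fin d)))
    (u : EuclideanSpace ℝ (Fin d) → ℂ) : Prop :=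
  ∀ α : Fin d → ℕ, ∀ x ∈ V,
    ‖mderiv α u x‖ ≤ A * C ^ (∑ i, α i) * ((∏ i, (α i).factorial : ℕ) : ℝ) ^ s

/-- The Gevrey class `G^s(W)` of an open set `W ⊆ ℝᵈ`: smooth functions on `W` that satisfy
Gevrey bounds on every compact subset of `W`. Values outside `W` play no role. -/
def IsGevrey (s : ℝ) (W : Set (EuclideanSpace ℝ (Fin d)))
    (u : EuclideanSpace ℝ (Fin d) → ℂ) : Prop :=
  ContDiffOn ℝ ∞ u W ∧
    ∀ K : Set (EuclideanSpace ℝ (Fin d)), IsCompact K → K ⊆ W →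
      ∃ A > 0, ∃ C > 0, GevreyBoundOn s A C K u

/-- The Hessian matrix `f''(x)`. -/
def hess (f : EuclideanSpace ℝ (Fin d) → ℂ) (x : EuclideanSpace ℝ (Fin d)) :
    Matrix (Fin d) (Fin d) ℂ :=
  Matrix.of fun i j => pderiv i (pderiv j f) x

/-- `g_{x₀}(x) = f(x) - ½ f''(x₀)(x - x₀)·(x - x₀)`. -/
def gRem (f : EuclideanSpace ℝ (Fin d) → ℂ) (x₀ : EuclideanSpace ℝ (Fin d)) :
    EuclideanSpace ℝ (Fin d) → ℂ :=
  fun x => f x - (1 / 2) * ∑ i, ∑ j, hess f x₀ i j * ((x i - x₀ i : ℝ) : ℂ) * ((x j - x₀ j : ℝ) : ℂ)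

/-- The constant-coefficient second order operator `B∂·∂ = ∑ B_{ij} ∂ᵢ ∂ⱼ`. -/
def quadOp (B : Matrix (Fin d) (Fin d) ℂ) (v : EuclideanSpace ℝ (Fin d) → ℂ) :
    EuclideanSpace ℝ (Fin d) → ℂ :=
  fun x => ∑ i, ∑ j, B i j * pderiv i (pderiv j v) x

/-- The coefficients
`L_j u = ∑_{ν-μ=j} ∑_{2ν≥3μ} i^(μ+ν) / (2^ν μ! ν!) (f''(x₀)⁻¹∂·∂)^ν (g_{x₀}^μ u)(x₀)`.
For `ν = j + μ` the condition `2ν ≥ 3μ` says `μ ≤ 2j`, so the sum runs over `0 ≤ μ ≤ 2j`. -/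
def Lop (f : EuclideanSpace ℝ (Fin d) → ℂ) (x₀ : EuclideanSpace ℝ (Fin d)) (j : ℕ)
    (u : EuclideanSpace ℝ (Fin d) → ℂ) : ℂ :=
  ∑ μ ∈ Finset.range (2 * j + 1),
    Complex.I ^ (μ + (j + μ)) /
        ((2 : ℂ) ^ (j + μ) * (μ.factorial : ℂ) * ((j + μ).factorial : ℂ)) *
      (quadOp (hess f x₀)⁻¹)^[j + μ] (fun x => gRem f x₀ x ^ μ * u x) x₀

/-- `(det B)^(-1/2)` for a complex symmetric matrix `B` whose real part is positive definite: the
product of `λ^(-1/2)`, principal branch, over the eigenvalues `λ` of `B` with multiplicity. All of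
these have positive real part, so this is the branch which is continuous on the (convex) set of such
matrices and positive on the real ones; it is in general not the principal power of `det B`. -/
def detInvSqrt (B : Matrix (Fin d) (Fin d) ℂ) : ℂ :=
  (B.charpoly.roots.map fun z => z ^ (-(1 / 2) : ℂ)).prod

end GevreyPhase

end

/-!
Put `y = x - x₀` and split `f = ½ f''(x₀)y·y + g`, where `g` vanishes to third order at `x₀`. The
integrand is then the Gaussian `exp (i f''(x₀)y·y / (2h))` times `exp (ig/h) u`, and the second
factor is replaced by `∑ (ig/h)^μ / μ! · u` over `μ < 2k`, each `g^μ u` being Taylor expanded at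
`x₀` to order `2(k + μ)`. Integrating the Gaussian against a polynomial `p` that is homogeneous of
degree `2ν` gives, by parts, its plain integral times `(ih/2)^ν / ν! (f''(x₀)⁻¹∂·∂)^ν p`, while odd
degrees give zero; this produces the `L_j u`. The plain integral is `det^(-1/2)`: along the segment
from the identity to the given matrix, its square times the determinant has derivative zero, and
continuity fixes the sign.

Near `x₀` the form `Im f''(x₀)` dominates `g`. A Taylor remainder of degree `n` of a function of
Gevrey class `s` costs `n!^(s-1)`, and `T^n` against `exp (-cT²/h)` costs `n!^(1/2) h^(n/2)`; with
`n` about `2k` this is `(2k)!^(s-1/2) h^k`, which is where `k!^(2s-1)` comes from. Away from `x₀`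
there is a factor `exp (-δ/h)`, which for `s > 1` is at most `p!^(s-1/2) h^(p/2)` for all `p` at
once as soon as `h` is small, so that `h₀` absorbs all dependence on the neighbourhood.
-/

noncomputable section

namespace GevreyPhase

variable {d : ℕ}

local notation "𝔼" => EuclideanSpace ℝ (Fin d)

section Calculus

theorem contDiff_pderiv {F : 𝔼 → ℂ} (hF : ContDiff ℝ ∞ F) (i : Fin d) :
    ContDiff ℝ ∞ (pderiv i F) :=
  (hF.fderiv_right (m := ∞) (by simp)).clm_apply contDiff_const

theorem contDiff_pderiv_iterate {F : 𝔼 → ℂ} (hF : ContDiff ℝ ∞ F) (i : Fin d) (n : ℕ) :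
    ContDiff ℝ ∞ ((pderiv i)^[n] F) :=
  Function.Iterate.rec (ContDiff ℝ ∞ ·) hF (fun _ h => contDiff_pderiv h i) n

theorem contDiff_quadOp {F : 𝔼 → ℂ} (hF : ContDiff ℝ ∞ F) (B : Matrix (Fin d) (Fin d) ℂ) :
    ContDiff ℝ ∞ (quadOp B F) :=
  ContDiff.sum fun i _ => ContDiff.sum fun j _ =>
    contDiff_const.mul (contDiff_pderiv (contDiff_pderiv hF j) i)

theorem contDiff_quadOp_iterate {F : 𝔼 → ℂ} (hF : ContDiff ℝ ∞ F) (B : Matrix (Fin d) (Fin d) ℂ)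
    (n : ℕ) : ContDiff ℝ ∞ ((quadOp B)^[n] F) :=
  Function.Iterate.rec (ContDiff ℝ ∞ ·) hF (fun _ h => contDiff_quadOp h B) n

theorem contDiff_coord (i : Fin d) : ContDiff ℝ ∞ fun x : 𝔼 => (x i : ℂ) :=
  Complex.ofRealCLM.contDiff.comp (EuclideanSpace.proj i : 𝔼 →L[ℝ] ℝ).contDiff

theorem pderiv_add {F G : 𝔼 → ℂ} (hF : Differentiable ℝ F) (hG : Differentiable ℝ G) (i : Fin d) :
    pderiv i (fun x => F x + G x) = fun x => pderiv i F x + pderiv i G x := by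
  funext x
  simp [pderiv, fderiv_fun_add (hF x) (hG x)]

theorem pderiv_mul {F G : 𝔼 → ℂ} (hF : Differentiable ℝ F) (hG : Differentiable ℝ G) (i : Fin d) :
    pderiv i (fun x => F x * G x) = fun x => pderiv i F x * G x + F x * pderiv i G x := by
  funext x
  simp only [pderiv, fderiv_fun_mul (hF x) (hG x), add_apply, smul_apply,
    smul_eq_mul]
  ring

theorem pderiv_const (a : ℂ) (i : Fin d) : pderiv i (fun _ : 𝔼 => a) = fun _ => 0 := by
  funext x
  simp [pderiv]

theorem pderiv_const_mul {F : 𝔼 → ℂ} (hF : Differentiable ℝ F) (a : ℂ) (i : Fin d) :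
    pderiv i (fun x => a * F x) = fun x => a * pderiv i F x := by
  rw [pderiv_mul (differentiable_const a) hF, pderiv_const]
  simp

theorem pderiv_sum {ι : Type*} (S : Finset ι) {F : ι → 𝔼 → ℂ} (hF : ∀ j, Differentiable ℝ (F j))
    (i : Fin d) :
    pderiv i (fun x => ∑ j ∈ S, F j x) = fun x => ∑ j ∈ S, pderiv i (F j) x := by
  funext x
  simp [pderiv, fderiv_fun_sum fun j _ => hF j x]

theorem pderiv_coord_sub (i j : Fin d) (a : ℝ) :
    pderiv i (fun x : 𝔼 => ((x j - a : ℝ) : ℂ)) = fun _ => if i = j then 1 else 0 := by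
  funext x
  have h : HasFDerivAt (fun x : 𝔼 => ((x j - a : ℝ) : ℂ))
      (Complex.ofRealCLM.comp (EuclideanSpace.proj j : 𝔼 →L[ℝ] ℝ)) x :=
    Complex.ofRealCLM.hasFDerivAt.comp x
      (((EuclideanSpace.proj j : 𝔼 →L[ℝ] ℝ).hasFDerivAt).sub_const a)
  rw [pderiv, h.fderiv]
  by_cases hij : i = j <;> simp [hij, Ne.symm]

theorem pderiv_coord (i j : Fin d) :
    pderiv i (fun x : 𝔼 => (x j : ℂ)) = fun _ => if i = j then 1 else 0 := by
  simpa using pderiv_coord_sub i j 0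

theorem pderiv_comm {F : 𝔼 → ℂ} (hF : ContDiff ℝ 2 F) (i j : Fin d) :
    pderiv i (pderiv j F) = pderiv j (pderiv i F) := by
  have pderiv_pderiv_eq (a b : Fin d) (x : 𝔼) : pderiv a (pderiv b F) x =
      fderiv ℝ (fderiv ℝ F) x (EuclideanSpace.single a 1) (EuclideanSpace.single b 1) := by
    have hdiff : DifferentiableAt ℝ (fderiv ℝ F) x :=
      (hF.fderiv_right (m := 1) (by norm_num)).differentiable (by simp) x
    unfold pderiv
    rw [fderiv_clm_apply hdiff (differentiableAt_const _)]
    simp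
  funext x
  rw [pderiv_pderiv_eq, pderiv_pderiv_eq]
  exact (hF.contDiffAt.isSymmSndFDerivAt (by simp)).eq _ _

theorem isSymm_hess {f : 𝔼 → ℂ} (hf : ContDiff ℝ 2 f) (x : 𝔼) : (hess f x).IsSymm :=
  Matrix.IsSymm.ext fun i j => congrFun (pderiv_comm hf j i) x

theorem pderiv_iterate_comm {F : 𝔼 → ℂ} (hF : ContDiff ℝ ∞ F) (i j : Fin d) (n : ℕ) :
    (pderiv i)^[n] (pderiv j F) = pderiv j ((pderiv i)^[n] F) := by
  induction n with
  | zero => rfl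
  | succ n ih =>
    rw [Function.iterate_succ_apply', Function.iterate_succ_apply', ih,
      pderiv_comm (contDiff_infty.1 (contDiff_pderiv_iterate hF i n) 2)]

end Calculus

section Locality

theorem eventuallyEq_iterate {X Y : Type*} {l : Filter X} {T : (X → Y) → X → Y}
    (hT : ∀ ⦃F G : X → Y⦄, F =ᶠ[l] G → T F =ᶠ[l] T G) {F G : X → Y} (h : F =ᶠ[l] G) (n : ℕ) :
    T^[n] F =ᶠ[l] T^[n] G := by
  induction n with
  | zero => exact h
  | succ n ih => simpa only [Function.iterate_succ_apply'] using hT ih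

variable {F G : EuclideanSpace ℝ (Fin d) → ℂ} {x : EuclideanSpace ℝ (Fin d)}

theorem pderiv_congr (h : F =ᶠ[nhds x] G) (i : Fin d) : pderiv i F =ᶠ[nhds x] pderiv i G :=
  (h.fderiv (𝕜 := ℝ)).mono fun y hy => by simp only [pderiv, hy]

theorem mderiv_congr (h : F =ᶠ[nhds x] G) (α : Fin d → ℕ) :
    mderiv α F =ᶠ[nhds x] mderiv α G := by
  unfold mderiv
  induction List.finRange d with
  | nil => exact h
  | cons i l ih => exact eventuallyEq_iterate (fun _ _ h' => pderiv_congr h' i) ih _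

theorem hess_congr (h : F =ᶠ[nhds x] G) : hess F x = hess G x := by
  ext i j
  exact (pderiv_congr (pderiv_congr h j) i).eq_of_nhds

theorem gRem_congr (h : F =ᶠ[nhds x] G) : gRem F x =ᶠ[nhds x] gRem G x :=
  h.mono fun y hy => by simp only [gRem, hess_congr h, hy]

theorem quadOp_congr (h : F =ᶠ[nhds x] G) (B : Matrix (Fin d) (Fin d) ℂ) :
    quadOp B F =ᶠ[nhds x] quadOp B G := by
  have hpderiv : ∀ᶠ y in nhds x, ∀ i j, pderiv i (pderiv j F) y = pderiv i (pderiv j G) y :=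
    Filter.eventually_all.2 fun i => Filter.eventually_all.2 fun j =>
      pderiv_congr (pderiv_congr h j) i
  exact hpderiv.mono fun y hy => by simp only [quadOp, hy]

theorem Lop_congr {f f' u u' : 𝔼 → ℂ} {x₀ : 𝔼} (hf : f =ᶠ[nhds x₀] f') (hu : u =ᶠ[nhds x₀] u')
    (j : ℕ) : Lop f x₀ j u = Lop f' x₀ j u' := by
  unfold Lop
  refine Finset.sum_congr rfl fun μ _ => ?_
  rw [hess_congr hf]
  congr 1
  refine (eventuallyEq_iterate (fun _ _ h => quadOp_congr h _) ?_ _).eq_of_nhds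
  filter_upwards [gRem_congr hf, hu] with y hy hy'
  rw [hy, hy']

theorem GevreyBoundOn.congr {s A C : ℝ} {V : Set 𝔼} (h : GevreyBoundOn s A C V F)
    (hFG : ∀ x ∈ V, F =ᶠ[nhds x] G) : GevreyBoundOn s A C V G := fun α x hx => by
  rw [← (mderiv_congr (hFG x hx) α).eq_of_nhds]
  exact h α x hx

end Locality

section IteratedDerivatives

variable {F : EuclideanSpace ℝ (Fin d) → ℂ}

/-- The iterated partial derivative along a word of coordinate directions, the first letter being
applied first. For smooth functions it only depends on the number of occurrences of each letter,
but unlike `mderiv` it can be computed by recursion on the word. -/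
def wordDeriv (w : List (Fin d)) (F : 𝔼 → ℂ) : 𝔼 → ℂ :=
  w.foldl (fun G i => pderiv i G) F

@[simp] theorem wordDeriv_nil (F : 𝔼 → ℂ) : wordDeriv [] F = F := rfl

@[simp] theorem wordDeriv_cons (i : Fin d) (w : List (Fin d)) (F : 𝔼 → ℂ) :
    wordDeriv (i :: w) F = wordDeriv w (pderiv i F) := rfl

theorem wordDeriv_add {G : 𝔼 → ℂ} (hF : ContDiff ℝ ∞ F) (hG : ContDiff ℝ ∞ G) (w : List (Fin d)) :
    wordDeriv w (fun x => F x + G x) = fun x => wordDeriv w F x + wordDeriv w G x := by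
  induction w generalizing F G with
  | nil => rfl
  | cons i w ih =>
    simp only [wordDeriv_cons]
    rw [pderiv_add (hF.differentiable (by simp)) (hG.differentiable (by simp)),
      ih (contDiff_pderiv hF i) (contDiff_pderiv hG i)]

theorem wordDeriv_const_mul (hF : ContDiff ℝ ∞ F) (a : ℂ) (w : List (Fin d)) :
    wordDeriv w (fun x => a * F x) = fun x => a * wordDeriv w F x := by
  induction w generalizing F with
  | nil => rfl
  | cons i w ih =>
    rw [wordDeriv_cons, pderiv_const_mul (hF.differentiable (by simp)), ih (contDiff_pderiv hF i)]
    rfl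

theorem wordDeriv_sum {ι : Type*} (S : Finset ι) {F : ι → 𝔼 → ℂ} (hF : ∀ j, ContDiff ℝ ∞ (F j))
    (w : List (Fin d)) :
    wordDeriv w (fun x => ∑ j ∈ S, F j x) = fun x => ∑ j ∈ S, wordDeriv w (F j) x := by
  induction w generalizing F with
  | nil => rfl
  | cons i w ih =>
    rw [wordDeriv_cons, pderiv_sum S (fun j => (hF j).differentiable (by simp)),
      ih fun j => contDiff_pderiv (hF j) i]
    rfl

theorem contDiff_foldr_pderiv_iterate (hF : ContDiff ℝ ∞ F) (α : Fin d → ℕ) (l : List (Fin d)) :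
    ContDiff ℝ ∞ (l.foldr (fun i v => (pderiv i)^[α i] v) F) := by
  induction l with
  | nil => exact hF
  | cons i l ih => exact contDiff_pderiv_iterate ih i _

theorem foldr_pderiv_iterate_comm (hF : ContDiff ℝ ∞ F) (α : Fin d → ℕ) (j : Fin d)
    (l : List (Fin d)) :
    l.foldr (fun i v => (pderiv i)^[α i] v) (pderiv j F) =
      pderiv j (l.foldr (fun i v => (pderiv i)^[α i] v) F) := by
  induction l with
  | nil => rfl
  | cons i l ih =>
    rw [List.foldr_cons, ih, List.foldr_cons,
      pderiv_iterate_comm (contDiff_foldr_pderiv_iterate hF α l)]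

theorem foldr_pderiv_iterate_add_single (hF : ContDiff ℝ ∞ F) (α : Fin d → ℕ) (j : Fin d)
    {l : List (Fin d)} (hl : l.Nodup) :
    l.foldr (fun i v => (pderiv i)^[(α + Pi.single j 1 : Fin d → ℕ) i] v) F =
      if j ∈ l then pderiv j (l.foldr (fun i v => (pderiv i)^[α i] v) F)
      else l.foldr (fun i v => (pderiv i)^[α i] v) F := by
  induction l with
  | nil => rfl
  | cons i l ih =>
    obtain ⟨hil, hl'⟩ := List.nodup_cons.1 hl
    simp only [List.foldr_cons, ih hl', List.mem_cons]
    rcases eq_or_ne j i with rfl | hji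
    · simp [hil, Function.iterate_succ_apply']
    · have hsingle : (Pi.single j 1 : Fin d → ℕ) i = 0 := by simp [hji.symm]
      simp only [Pi.add_apply, hsingle, add_zero, hji, false_or]
      split_ifs
      · exact pderiv_iterate_comm (contDiff_foldr_pderiv_iterate hF α l) i j _
      · rfl

theorem mderiv_pderiv (hF : ContDiff ℝ ∞ F) (α : Fin d → ℕ) (j : Fin d) :
    mderiv α (pderiv j F) = mderiv (α + (Pi.single j 1 : Fin d → ℕ)) F := by
  unfold mderiv
  rw [foldr_pderiv_iterate_add_single hF α j (List.nodup_finRange d),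
    foldr_pderiv_iterate_comm hF α j]
  simp

theorem mderiv_zero (F : 𝔼 → ℂ) : mderiv 0 F = F := by
  unfold mderiv
  induction List.finRange d with
  | nil => rfl
  | cons _ _ ih => exact ih

theorem exists_wordDeriv_eq_mderiv (hF : ContDiff ℝ ∞ F) (w : List (Fin d)) :
    ∃ α : Fin d → ℕ, ∑ i, α i = w.length ∧ wordDeriv w F = mderiv α F := by
  induction w generalizing F with
  | nil => exact ⟨0, by simp, (mderiv_zero F).symm⟩
  | cons i w ih =>
    obtain ⟨α, hα, hwα⟩ := ih (contDiff_pderiv hF i)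
    refine ⟨α + Pi.single i 1, ?_, ?_⟩
    · simp [Finset.sum_add_distrib, hα]
    · rw [wordDeriv_cons, hwα, mderiv_pderiv hF]

theorem GevreyBoundOn.norm_wordDeriv_le {s A C : ℝ} {V : Set 𝔼} (hs : 0 ≤ s) (hA : 0 ≤ A)
    (hC : 0 ≤ C) (h : GevreyBoundOn s A C V F) (hF : ContDiff ℝ ∞ F) (w : List (Fin d)) {x : 𝔼}
    (hx : x ∈ V) : ‖wordDeriv w F x‖ ≤ A * C ^ w.length * (w.length.factorial : ℝ) ^ s := by
  obtain ⟨α, hα, hwα⟩ := exists_wordDeriv_eq_mderiv hF w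
  rw [hwα, ← hα]
  refine (h α x hx).trans ?_
  gcongr
  exact Nat.le_of_dvd (Nat.factorial_pos _) (Nat.prod_factorial_dvd_factorial_sum _ _)

end IteratedDerivatives

section Taylor

open PowerSeries

variable (x₀ : EuclideanSpace ℝ (Fin d))

/-- The homogeneous component of degree `n` of the Taylor expansion of `F` at `x₀`, evaluated at the
increment `x`. Euler's identity `n Tₙ F = ∑ xᵢ Tₙ₋₁ (∂ᵢ F)` serves as the definition. -/
def taylorTerm : ℕ → (𝔼 → ℂ) → 𝔼 → ℂ
  | 0, F, _ => F x₀
  | n + 1, F, x => ((n : ℂ) + 1)⁻¹ * ∑ i, (x i : ℂ) * taylorTerm n (pderiv i F) x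

theorem succ_mul_taylorTerm_succ (n : ℕ) (F : 𝔼 → ℂ) (x : 𝔼) :
    ((n : ℂ) + 1) * taylorTerm x₀ (n + 1) F x =
      ∑ i, (x i : ℂ) * taylorTerm x₀ n (pderiv i F) x := by
  rw [taylorTerm, mul_inv_cancel_left₀ (Nat.cast_add_one_ne_zero n)]

theorem taylorTerm_add {F G : 𝔼 → ℂ} (hF : ContDiff ℝ ∞ F) (hG : ContDiff ℝ ∞ G) (n : ℕ) (x : 𝔼) :
    taylorTerm x₀ n (fun y => F y + G y) x = taylorTerm x₀ n F x + taylorTerm x₀ n G x := by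
  induction n generalizing F G with
  | zero => rfl
  | succ n ih =>
    simp only [taylorTerm, ← mul_add, ← Finset.sum_add_distrib]
    congr! 2 with i
    rw [pderiv_add (hF.differentiable (by simp)) (hG.differentiable (by simp)),
      ih (contDiff_pderiv hF i) (contDiff_pderiv hG i), mul_add]

theorem taylorTerm_const_mul {F : 𝔼 → ℂ} (hF : ContDiff ℝ ∞ F) (a : ℂ) (n : ℕ) (x : 𝔼) :
    taylorTerm x₀ n (fun y => a * F y) x = a * taylorTerm x₀ n F x := by
  induction n generalizing F with
  | zero => rfl
  | succ n ih =>
    simp only [taylorTerm]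
    rw [mul_left_comm]
    congr 1
    rw [Finset.mul_sum]
    refine Finset.sum_congr rfl fun i _ => ?_
    rw [pderiv_const_mul (hF.differentiable (by simp)), ih (contDiff_pderiv hF i), mul_left_comm]

theorem taylorTerm_zero_fun (n : ℕ) (x : 𝔼) : taylorTerm x₀ n (fun _ => 0) x = 0 := by
  simpa using taylorTerm_const_mul x₀ (contDiff_const (c := (0 : ℂ))) 0 n x

theorem taylorTerm_sum {ι : Type*} (S : Finset ι) {F : ι → 𝔼 → ℂ} (hF : ∀ j, ContDiff ℝ ∞ (F j))
    (n : ℕ) (x : 𝔼) :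
    taylorTerm x₀ n (fun y => ∑ j ∈ S, F j y) x = ∑ j ∈ S, taylorTerm x₀ n (F j) x := by
  classical
  induction S using Finset.induction_on with
  | empty => simpa using taylorTerm_zero_fun x₀ n x
  | insert a S ha ih =>
    simp only [Finset.sum_insert ha]
    rw [taylorTerm_add x₀ (hF a) (ContDiff.sum fun j _ => hF j), ih]

theorem taylorTerm_quadOp {F : 𝔼 → ℂ} (hF : ContDiff ℝ ∞ F) (B : Matrix (Fin d) (Fin d) ℂ) (n : ℕ)
    (x : 𝔼) : taylorTerm x₀ n (quadOp B F) x =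
      ∑ i, ∑ j, B i j * taylorTerm x₀ n (pderiv i (pderiv j F)) x := by
  have hsmooth (i j : Fin d) : ContDiff ℝ ∞ (pderiv i (pderiv j F)) :=
    contDiff_pderiv (contDiff_pderiv hF j) i
  have hterm (i j : Fin d) : ContDiff ℝ ∞ fun x => B i j * pderiv i (pderiv j F) x :=
    contDiff_const.mul (hsmooth i j)
  unfold quadOp
  rw [taylorTerm_sum x₀ _ fun i => ContDiff.sum fun j _ => hterm i j]
  simp only [taylorTerm_sum x₀ _ (hterm _), taylorTerm_const_mul x₀ (hsmooth _ _)]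

/-- The Taylor expansion of `F` at `x₀` along the ray with direction `x`, as a formal power
series in the ray parameter. -/
def taylorSeries (F : 𝔼 → ℂ) (x : 𝔼) : ℂ⟦X⟧ := PowerSeries.mk fun n => taylorTerm x₀ n F x

theorem coeff_taylorSeries (F : 𝔼 → ℂ) (x : 𝔼) (n : ℕ) :
    coeff n (taylorSeries x₀ F x) = taylorTerm x₀ n F x := coeff_mk _ _

theorem derivative_taylorSeries (F : 𝔼 → ℂ) (x : 𝔼) :
    d⁄dX ℂ (taylorSeries x₀ F x) = ∑ i, C (x i : ℂ) * taylorSeries x₀ (pderiv i F) x := by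
  ext n
  rw [coeff_derivative, coeff_taylorSeries, mul_comm, succ_mul_taylorTerm_succ, map_sum]
  simp [coeff_C_mul, coeff_taylorSeries]

theorem taylorSeries_mul {F G : 𝔼 → ℂ} (hF : ContDiff ℝ ∞ F) (hG : ContDiff ℝ ∞ G) (x : 𝔼) :
    taylorSeries x₀ (fun y => F y * G y) x = taylorSeries x₀ F x * taylorSeries x₀ G x := by
  ext n
  induction n generalizing F G with
  | zero => simp [taylorSeries, taylorTerm, coeff_mul]
  | succ n ih =>
    refine mul_right_cancel₀ (Nat.cast_add_one_ne_zero n) ?_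
    rw [← coeff_derivative, ← coeff_derivative, Derivation.leibniz, derivative_taylorSeries,
      derivative_taylorSeries, derivative_taylorSeries, smul_eq_mul, smul_eq_mul, Finset.mul_sum,
      Finset.mul_sum, ← Finset.sum_add_distrib, map_sum, map_sum]
    refine Finset.sum_congr rfl fun i _ => ?_
    have hFi := contDiff_pderiv hF i
    have hGi := contDiff_pderiv hG i
    rw [pderiv_mul (hF.differentiable (by simp)) (hG.differentiable (by simp)), coeff_C_mul,
      coeff_taylorSeries, taylorTerm_add x₀ (hFi.mul hG) (hF.mul hGi), ← coeff_taylorSeries,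
      ← coeff_taylorSeries, ih hFi hG, ih hF hGi, ← map_add, ← coeff_C_mul]
    congr 1
    ring

theorem taylorSeries_pow_mul {F G : 𝔼 → ℂ} (hF : ContDiff ℝ ∞ F) (hG : ContDiff ℝ ∞ G) (μ : ℕ)
    (x : 𝔼) :
    taylorSeries x₀ (fun y => F y ^ μ * G y) x =
      taylorSeries x₀ F x ^ μ * taylorSeries x₀ G x := by
  induction μ with
  | zero => simp
  | succ μ ih =>
    simp only [pow_succ', mul_assoc]
    rw [taylorSeries_mul x₀ hF ((hF.pow μ).mul hG), ih]

theorem contDiff_taylorTerm (n : ℕ) (F : 𝔼 → ℂ) : ContDiff ℝ ∞ (taylorTerm x₀ n F) := by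
  induction n generalizing F with
  | zero => exact contDiff_const
  | succ n ih =>
    exact contDiff_const.mul (ContDiff.sum fun i _ => (contDiff_coord i).mul (ih _))

theorem taylorTerm_smul (n : ℕ) (F : 𝔼 → ℂ) (t : ℝ) (x : 𝔼) :
    taylorTerm x₀ n F (t • x) = (t : ℂ) ^ n * taylorTerm x₀ n F x := by
  induction n generalizing F with
  | zero => simp [taylorTerm]
  | succ n ih =>
    simp only [taylorTerm, ih, PiLp.smul_apply, smul_eq_mul, Complex.ofReal_mul]
    rw [mul_left_comm]
    congr 1
    rw [Finset.mul_sum]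
    exact Finset.sum_congr rfl fun i _ => by ring

theorem pderiv_taylorTerm_zero (i : Fin d) (F : 𝔼 → ℂ) :
    pderiv i (taylorTerm x₀ 0 F) = fun _ => 0 :=
  pderiv_const _ i

theorem succ_mul_pderiv_taylorTerm_succ (n : ℕ) (F : 𝔼 → ℂ) (i : Fin d) (x : 𝔼) :
    ((n : ℂ) + 1) * pderiv i (taylorTerm x₀ (n + 1) F) x =
      taylorTerm x₀ n (pderiv i F) x +
        ∑ j, (x j : ℂ) * pderiv i (taylorTerm x₀ n (pderiv j F)) x := by
  have hsmooth (j : Fin d) :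
      ContDiff ℝ ∞ fun x : 𝔼 => (x j : ℂ) * taylorTerm x₀ n (pderiv j F) x :=
    (contDiff_coord j).mul (contDiff_taylorTerm x₀ n _)
  have hdef : taylorTerm x₀ (n + 1) F =
      fun x => ((n : ℂ) + 1)⁻¹ * ∑ j, (x j : ℂ) * taylorTerm x₀ n (pderiv j F) x := rfl
  rw [hdef, pderiv_const_mul ((ContDiff.sum fun j _ => hsmooth j).differentiable (by simp)),
    pderiv_sum _ fun j => (hsmooth j).differentiable (by simp),
    mul_inv_cancel_left₀ (Nat.cast_add_one_ne_zero n)]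
  simp only [pderiv_mul ((contDiff_coord _).differentiable (by simp))
    ((contDiff_taylorTerm x₀ n _).differentiable (by simp)), pderiv_coord, Finset.sum_add_distrib]
  simp

theorem pderiv_taylorTerm_succ {F : 𝔼 → ℂ} (hF : ContDiff ℝ ∞ F) (n : ℕ) (i : Fin d) :
    pderiv i (taylorTerm x₀ (n + 1) F) = taylorTerm x₀ n (pderiv i F) := by
  induction n generalizing F with
  | zero =>
    funext x
    simpa [pderiv_taylorTerm_zero] using succ_mul_pderiv_taylorTerm_succ x₀ 0 F i x
  | succ n ih =>
    funext x
    refine mul_left_cancel₀ (Nat.cast_add_one_ne_zero (n + 1) : (((n + 1 : ℕ) : ℂ) + 1) ≠ 0) ?_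
    rw [succ_mul_pderiv_taylorTerm_succ]
    simp only [fun j => ih (contDiff_pderiv hF j), pderiv_comm (contDiff_infty.1 hF 2) i,
      ← succ_mul_taylorTerm_succ]
    push_cast
    ring

end Taylor

section TaylorRemainder

variable (x₀ : EuclideanSpace ℝ (Fin d))

theorem fderiv_apply_eq_sum_pderiv (F : 𝔼 → ℂ) (y x : 𝔼) :
    fderiv ℝ F y x = ∑ i, (x i : ℂ) * pderiv i F y := by
  conv_lhs => rw [← (EuclideanSpace.basisFun (Fin d) ℝ).sum_repr x]
  simp [pderiv]

theorem hasDerivAt_comp_add_smul {F : 𝔼 → ℂ} (hF : Differentiable ℝ F) (x : 𝔼) (t : ℝ) :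
    HasDerivAt (fun t : ℝ => F (x₀ + t • x)) (∑ i, (x i : ℂ) * pderiv i F (x₀ + t • x)) t := by
  have hray : HasDerivAt (fun t : ℝ => x₀ + t • x) x t := by
    simpa using ((hasDerivAt_id t).smul_const x).const_add x₀
  rw [← fderiv_apply_eq_sum_pderiv]
  exact (hF _).hasFDerivAt.comp_hasDerivAt t hray

theorem hasDerivAt_taylorTerm_succ_smul (n : ℕ) (F : 𝔼 → ℂ) (x : 𝔼) (t : ℝ) :
    HasDerivAt (fun t : ℝ => taylorTerm x₀ (n + 1) F (t • x))
      (∑ i, (x i : ℂ) * taylorTerm x₀ n (pderiv i F) (t • x)) t := by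
  simp only [taylorTerm_smul]
  have hpow : HasDerivAt (fun t : ℝ => (t : ℂ) ^ (n + 1)) (((n + 1 : ℕ) : ℂ) * (t : ℂ) ^ n) t := by
    simpa using (hasDerivAt_pow (n + 1) (t : ℂ)).comp_ofReal
  refine (hpow.mul_const (taylorTerm x₀ (n + 1) F x)).congr_deriv ?_
  push_cast
  rw [mul_right_comm, succ_mul_taylorTerm_succ x₀ n F x, Finset.sum_mul]
  exact Finset.sum_congr rfl fun i _ => by ring

theorem hasDerivAt_sub_sum_taylorTerm_smul (N : ℕ) {F : 𝔼 → ℂ} (hF : Differentiable ℝ F) (x : 𝔼)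
    (t : ℝ) :
    HasDerivAt
      (fun t : ℝ => F (x₀ + t • x) - ∑ n ∈ Finset.range (N + 1), taylorTerm x₀ n F (t • x))
      (∑ i, (x i : ℂ) * (pderiv i F (x₀ + t • x) -
        ∑ n ∈ Finset.range N, taylorTerm x₀ n (pderiv i F) (t • x))) t := by
  have hsum : HasDerivAt (fun t : ℝ => ∑ n ∈ Finset.range (N + 1), taylorTerm x₀ n F (t • x))
      (∑ n ∈ Finset.range N, ∑ i, (x i : ℂ) * taylorTerm x₀ n (pderiv i F) (t • x)) t := by
    simp only [Finset.sum_range_succ']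
    exact (HasDerivAt.fun_sum fun n _ =>
      hasDerivAt_taylorTerm_succ_smul x₀ n F x t).add_const _
  refine ((hasDerivAt_comp_add_smul x₀ hF x t).sub hsum).congr_deriv ?_
  simp only [mul_sub, Finset.sum_sub_distrib, Finset.mul_sum]
  rw [Finset.sum_comm]

theorem sum_abs_coord_le (x : 𝔼) : ∑ i, |x i| ≤ d * ‖x‖ := by
  calc ∑ i, |x i| ≤ ∑ _i : Fin d, ‖x‖ := Finset.sum_le_sum fun i _ => by
        simpa using PiLp.norm_apply_le x i
    _ = d * ‖x‖ := by simp

theorem norm_sum_coord_mul_le (x : 𝔼) {z : Fin d → ℂ} {M : ℝ} (hz : ∀ i, ‖z i‖ ≤ M) (hM : 0 ≤ M) :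
    ‖∑ i, (x i : ℂ) * z i‖ ≤ d * ‖x‖ * M := by
  calc ‖∑ i, (x i : ℂ) * z i‖ ≤ ∑ i, |x i| * M := norm_sum_le_of_le _ fun i _ => by
        rw [norm_mul, Complex.norm_real, Real.norm_eq_abs]
        exact mul_le_mul_of_nonneg_left (hz i) (abs_nonneg _)
    _ = (∑ i, |x i|) * M := by rw [Finset.sum_mul]
    _ ≤ _ := mul_le_mul_of_nonneg_right (sum_abs_coord_le x) hM

theorem norm_taylorTerm_le (n : ℕ) (F : 𝔼 → ℂ) {M : ℝ} (hM : 0 ≤ M)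
    (hF : ∀ w : List (Fin d), w.length = n → ‖wordDeriv w F x₀‖ ≤ M) (x : 𝔼) :
    ‖taylorTerm x₀ n F x‖ ≤ M * (d * ‖x‖) ^ n / n.factorial := by
  induction n generalizing F with
  | zero => simpa [taylorTerm] using hF [] rfl
  | succ n ih =>
    have hpderiv (i : Fin d) :
        ‖taylorTerm x₀ n (pderiv i F) x‖ ≤ M * (d * ‖x‖) ^ n / n.factorial :=
      ih _ fun w hw => hF (i :: w) (by simp [hw])
    rw [taylorTerm, norm_mul, norm_inv, ← Nat.cast_succ, Complex.norm_natCast, Nat.factorial_succ,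
      inv_mul_le_iff₀ (by positivity)]
    refine (norm_sum_coord_mul_le x hpderiv (by positivity)).trans (le_of_eq ?_)
    push_cast
    field_simp
    ring

theorem norm_sub_sum_taylorTerm_le (N : ℕ) {F : 𝔼 → ℂ} (hF : ContDiff ℝ ∞ F) {M : ℝ} (hM : 0 ≤ M)
    (x : 𝔼) (hFM : ∀ w : List (Fin d), w.length = N → ∀ t ∈ Set.Icc (0 : ℝ) 1,
      ‖wordDeriv w F (x₀ + t • x)‖ ≤ M) {t : ℝ} (ht : t ∈ Set.Icc (0 : ℝ) 1) :
    ‖F (x₀ + t • x) - ∑ n ∈ Finset.range N, taylorTerm x₀ n F (t • x)‖ ≤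
      M * (d * ‖x‖) ^ N * t ^ N / N.factorial := by
  induction N generalizing F t with
  | zero => simpa using hFM [] rfl t ht
  | succ N ih =>
    have hderiv := hasDerivAt_sub_sum_taylorTerm_smul x₀ N (hF.differentiable (by simp)) x
    have hbound (t : ℝ) : HasDerivAt
        (fun t : ℝ => M * (d * ‖x‖) ^ (N + 1) * t ^ (N + 1) / (N + 1).factorial)
        (d * ‖x‖ * (M * (d * ‖x‖) ^ N * t ^ N / N.factorial)) t := by
      refine (((hasDerivAt_pow (N + 1) t).const_mul (M * (d * ‖x‖) ^ (N + 1))).div_const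
        ((N + 1).factorial : ℝ)).congr_deriv ?_
      rw [Nat.factorial_succ]
      push_cast
      field_simp
      ring
    refine image_norm_le_of_norm_deriv_right_le_deriv_boundary (a := 0) (b := 1)
      (fun t _ => (hderiv t).continuousAt.continuousWithinAt)
      (fun t _ => (hderiv t).hasDerivWithinAt) ?_ hbound (fun t ht => ?_) ht
    · simp [Finset.sum_range_succ', taylorTerm]
    · have ht₀ : 0 ≤ t := ht.1
      exact norm_sum_coord_mul_le x (fun i => ih (contDiff_pderiv hF i)
        (fun w hw => hFM (i :: w) (by simp [hw])) ⟨ht.1, ht.2.le⟩) (by positivity)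

end TaylorRemainder

section TemperateGrowth

theorem hasTemperateGrowth_coord (i : Fin d) :
    Function.HasTemperateGrowth fun x : 𝔼 => (x i : ℂ) :=
  (Complex.ofRealCLM.comp (EuclideanSpace.proj i : 𝔼 →L[ℝ] ℝ)).hasTemperateGrowth

theorem hasTemperateGrowth_taylorTerm (x₀ : 𝔼) (n : ℕ) (F : 𝔼 → ℂ) :
    (taylorTerm x₀ n F).HasTemperateGrowth := by
  induction n generalizing F with
  | zero => exact .const _
  | succ n ih =>
    exact .fun_mul (.const _) (.sum fun i _ => .fun_mul (hasTemperateGrowth_coord i) (ih _))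

theorem hasTemperateGrowth_pderiv_taylorTerm (x₀ : 𝔼) (n : ℕ) {F : 𝔼 → ℂ} (hF : ContDiff ℝ ∞ F)
    (l : Fin d) : (pderiv l (taylorTerm x₀ n F)).HasTemperateGrowth := by
  cases n with
  | zero => rw [pderiv_taylorTerm_zero]; exact .const 0
  | succ n => rw [pderiv_taylorTerm_succ x₀ hF]; exact hasTemperateGrowth_taylorTerm x₀ n _

theorem integrable_exp_neg_mul_sq_norm {b : ℝ} (hb : 0 < b) :
    Integrable fun x : 𝔼 => Real.exp (-b * ‖x‖ ^ 2) := by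
  have hcexp := (GaussianFourier.integrable_cexp_neg_mul_sq_norm_add (V := 𝔼) (b := (b : ℂ))
    (by simpa using hb) 0 0).norm
  refine hcexp.congr (.of_forall fun x => ?_)
  simp [Complex.norm_exp, ← Complex.ofReal_pow]

theorem integrable_pow_mul_exp_neg_mul_sq_norm {b : ℝ} (hb : 0 < b) (n : ℕ) :
    Integrable fun x : 𝔼 => (1 + ‖x‖) ^ n * Real.exp (-b * ‖x‖ ^ 2) := by
  refine Integrable.mono' ((integrable_exp_neg_mul_sq_norm (d := d) (half_pos hb)).const_mul
    (n.factorial * Real.exp (1 + 1 / (2 * b)))) (by fun_prop) (.of_forall fun x => ?_)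
  have hpow : (1 + ‖x‖) ^ n ≤ n.factorial * Real.exp (1 + ‖x‖) :=
    (div_le_iff₀' (by positivity)).1 (Real.pow_div_factorial_le_exp _ (by positivity) n)
  have hyoung : ‖x‖ ≤ b / 2 * ‖x‖ ^ 2 + 1 / (2 * b) := by
    have hsq : (b * ‖x‖ - 1) ^ 2 / (2 * b) = b / 2 * ‖x‖ ^ 2 + 1 / (2 * b) - ‖x‖ := by
      field_simp
      ring
    linarith [div_nonneg (sq_nonneg (b * ‖x‖ - 1)) (by positivity : 0 ≤ 2 * b)]
  rw [Real.norm_of_nonneg (by positivity), mul_assoc, ← Real.exp_add]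
  calc (1 + ‖x‖) ^ n * Real.exp (-b * ‖x‖ ^ 2)
      ≤ n.factorial * Real.exp (1 + ‖x‖) * Real.exp (-b * ‖x‖ ^ 2) := by gcongr
    _ = n.factorial * Real.exp (1 + ‖x‖ + -b * ‖x‖ ^ 2) := by rw [mul_assoc, ← Real.exp_add]
    _ ≤ _ := mul_le_mul_of_nonneg_left (Real.exp_le_exp.2 (by linarith)) (by positivity)

end TemperateGrowth

section Gaussian

/-- The quadratic form `Ax·x` of a complex matrix on `ℝᵈ`. -/
def quadForm (A : Matrix (Fin d) (Fin d) ℂ) (x : 𝔼) : ℂ :=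
  ∑ i, ∑ j, A i j * (x i : ℂ) * (x j : ℂ)

/-- The complex Gaussian `exp(-½ Ax·x)`. -/
def gaussian (A : Matrix (Fin d) (Fin d) ℂ) (x : 𝔼) : ℂ :=
  Complex.exp (-(1 / 2) * quadForm A x)

/-- Coercivity of the real part of `Ax·x` on `ℝᵈ`, with constant `a`. -/
def ReCoercive (a : ℝ) (A : Matrix (Fin d) (Fin d) ℂ) : Prop :=
  ∀ x : 𝔼, a * ‖x‖ ^ 2 ≤ (quadForm A x).re

theorem contDiff_quadForm (A : Matrix (Fin d) (Fin d) ℂ) : ContDiff ℝ ∞ (quadForm A) :=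
  ContDiff.sum fun i _ => ContDiff.sum fun j _ =>
    (contDiff_const.mul (contDiff_coord i)).mul (contDiff_coord j)

theorem contDiff_gaussian (A : Matrix (Fin d) (Fin d) ℂ) : ContDiff ℝ ∞ (gaussian A) :=
  (contDiff_const.mul (contDiff_quadForm A)).cexp

theorem norm_gaussian (A : Matrix (Fin d) (Fin d) ℂ) (x : 𝔼) :
    ‖gaussian A x‖ = Real.exp (-(1 / 2) * (quadForm A x).re) := by
  simp [gaussian, Complex.norm_exp]

variable {A : Matrix (Fin d) (Fin d) ℂ} {a : ℝ}

theorem norm_gaussian_le (hA : ReCoercive a A) (x : 𝔼) :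
    ‖gaussian A x‖ ≤ Real.exp (-(a / 2) * ‖x‖ ^ 2) := by
  rw [norm_gaussian, Real.exp_le_exp]
  linarith [hA x]

theorem integrable_gaussian_mul (ha : 0 < a) (hA : ReCoercive a A) {R : 𝔼 → ℂ}
    (hR : R.HasTemperateGrowth) : Integrable fun x => gaussian A x * R x := by
  obtain ⟨n, C, hRC⟩ := hR.2 0
  refine Integrable.mono'
    ((integrable_pow_mul_exp_neg_mul_sq_norm (d := d) (half_pos ha) n).const_mul C)
    ((contDiff_gaussian A).continuous.mul hR.1.continuous).aestronglyMeasurable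
    (.of_forall fun x => ?_)
  have hRx : ‖R x‖ ≤ C * (1 + ‖x‖) ^ n := by simpa using hRC x
  rw [norm_mul, mul_comm, ← mul_assoc]
  exact mul_le_mul hRx (norm_gaussian_le hA x) (norm_nonneg _) ((norm_nonneg _).trans hRx)

theorem pderiv_quadForm (hA_symm : A.IsSymm) (l : Fin d) :
    pderiv l (quadForm A) = fun x => 2 * ∑ i, A l i * (x i : ℂ) := by
  have hmul (i j : Fin d) : Differentiable ℝ fun x : 𝔼 => (x i : ℂ) * (x j : ℂ) :=
    ((contDiff_coord i).mul (contDiff_coord j)).differentiable (by simp)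
  have hrow (i : Fin d) : pderiv l (fun x : 𝔼 => ∑ j, A i j * ((x i : ℂ) * (x j : ℂ))) =
      fun x => ∑ j, A i j *
        ((if l = i then 1 else 0) * (x j : ℂ) + (x i : ℂ) * (if l = j then 1 else 0)) := by
    rw [pderiv_sum _ fun j => (hmul i j).const_mul _]
    simp only [pderiv_const_mul (hmul i _), pderiv_coord,
      pderiv_mul ((contDiff_coord _).differentiable (by simp))
        ((contDiff_coord _).differentiable (by simp))]
  have hquad : quadForm A = fun x : 𝔼 => ∑ i, ∑ j, A i j * ((x i : ℂ) * (x j : ℂ)) := by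
    simp only [funext_iff, quadForm, mul_assoc, implies_true]
  have hrow_diff (i : Fin d) :
      Differentiable ℝ fun x : 𝔼 => ∑ j, A i j * ((x i : ℂ) * (x j : ℂ)) :=
    Differentiable.fun_sum fun j _ => (hmul i j).const_mul _
  rw [hquad, pderiv_sum _ hrow_diff]
  simp only [hrow, mul_add, Finset.sum_add_distrib, two_mul]
  funext x
  congr 1
  · simp
  · simp [hA_symm.apply l]

theorem pderiv_gaussian (hA_symm : A.IsSymm) (l : Fin d) :
    pderiv l (gaussian A) = fun x => -(∑ i, A l i * (x i : ℂ)) * gaussian A x := by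
  have hdiff : Differentiable ℝ (quadForm A) := (contDiff_quadForm A).differentiable (by simp)
  have hchain : pderiv l (gaussian A) =
      fun x => gaussian A x * pderiv l (fun x => -(1 / 2) * quadForm A x) x := by
    funext x
    have hderiv := ((hdiff.const_mul (-(1 / 2) : ℂ)) x).hasFDerivAt.cexp
    exact congrArg (· (EuclideanSpace.single l 1)) hderiv.fderiv
  rw [hchain, pderiv_const_mul hdiff, pderiv_quadForm hA_symm]
  funext x
  ring

theorem integral_gaussian_mul_pderiv (ha : 0 < a) (hA : ReCoercive a A) (hA_symm : A.IsSymm)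
    {R : 𝔼 → ℂ} (hR : R.HasTemperateGrowth) (l : Fin d) (hRl : (pderiv l R).HasTemperateGrowth) :
    ∫ x, gaussian A x * pderiv l R x = ∑ i, A l i * ∫ x, gaussian A x * ((x i : ℂ) * R x) := by
  have hint (i : Fin d) : Integrable fun x : 𝔼 => A l i * (gaussian A x * ((x i : ℂ) * R x)) :=
    (integrable_gaussian_mul ha hA (.fun_mul (hasTemperateGrowth_coord i) hR)).const_mul _
  have hderiv : (fun x => pderiv l (gaussian A) x * R x) =
      fun x => -∑ i, A l i * (gaussian A x * ((x i : ℂ) * R x)) := by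
    funext x
    rw [pderiv_gaussian hA_symm]
    simp only [neg_mul, Finset.sum_mul]
    congr! 2 with i
    ring
  have hderiv_int : Integrable fun x => pderiv l (gaussian A) x * R x := by
    rw [hderiv]
    exact (integrable_finsetSum _ fun i _ => hint i).neg
  calc ∫ x, gaussian A x * pderiv l R x = -∫ x, pderiv l (gaussian A) x * R x :=
        integral_mul_fderiv_eq_neg_fderiv_mul_of_integrable hderiv_int
          (integrable_gaussian_mul ha hA hRl) (integrable_gaussian_mul ha hA hR)
          (fun x _ => (contDiff_gaussian A).differentiable (by simp) x)
          (fun x _ => hR.1.differentiable (by simp) x)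
    _ = _ := by
        rw [hderiv, integral_neg, neg_neg, integral_finsetSum _ fun i _ => hint i]
        simp only [integral_const_mul]

variable {B : Matrix (Fin d) (Fin d) ℂ}

theorem integral_gaussian_mul_coord_mul (ha : 0 < a) (hA : ReCoercive a A) (hA_symm : A.IsSymm)
    (hBA : B * A = 1) {R : 𝔼 → ℂ} (hR : R.HasTemperateGrowth)
    (hR' : ∀ l, (pderiv l R).HasTemperateGrowth) (i : Fin d) :
    ∫ x, gaussian A x * ((x i : ℂ) * R x) = ∑ l, B i l * ∫ x, gaussian A x * pderiv l R x := by
  simp only [fun l => integral_gaussian_mul_pderiv ha hA hA_symm hR l (hR' l), Finset.mul_sum,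
    ← mul_assoc]
  rw [Finset.sum_comm]
  simp only [← Finset.sum_mul, ← Matrix.mul_apply, hBA, Matrix.one_apply]
  simp

theorem integral_gaussian_mul_coord_mul_coord (ha : 0 < a) (hA : ReCoercive a A)
    (hA_symm : A.IsSymm) (hBA : B * A = 1) (i j : Fin d) :
    ∫ x : 𝔼, gaussian A x * ((x i : ℂ) * (x j : ℂ)) = B i j * ∫ x, gaussian A x := by
  rw [integral_gaussian_mul_coord_mul ha hA hA_symm hBA (hasTemperateGrowth_coord j)
    fun l => by rw [pderiv_coord]; exact .const _]
  rw [Finset.sum_eq_single j (fun l _ hlj => by simp [pderiv_coord, hlj]) (by simp)]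
  simp [pderiv_coord]

theorem integral_gaussian_mul_quadForm (ha : 0 < a) (hA : ReCoercive a A) (hA_symm : A.IsSymm)
    (hBA : B * A = 1) (C : Matrix (Fin d) (Fin d) ℂ) :
    ∫ x, gaussian A x * quadForm C x = (B * C).trace * ∫ x, gaussian A x := by
  have hint (i j : Fin d) :
      Integrable fun x : 𝔼 => C i j * (gaussian A x * ((x j : ℂ) * (x i : ℂ))) :=
    (integrable_gaussian_mul ha hA
      (.fun_mul (hasTemperateGrowth_coord j) (hasTemperateGrowth_coord i))).const_mul _
  have hexpand (x : 𝔼) : gaussian A x * quadForm C x =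
      ∑ i, ∑ j, C i j * (gaussian A x * ((x j : ℂ) * (x i : ℂ))) := by
    simp only [quadForm, Finset.mul_sum]
    congr! 2 with i _ j
    ring
  simp only [hexpand]
  rw [integral_finsetSum _ fun i _ => integrable_finsetSum _ fun j _ => hint i j]
  simp only [fun i => integral_finsetSum Finset.univ fun j _ => hint i j, integral_const_mul,
    integral_gaussian_mul_coord_mul_coord ha hA hA_symm hBA]
  rw [Matrix.trace_mul_comm]
  simp only [Matrix.trace, Matrix.diag_apply, Matrix.mul_apply, Finset.sum_mul, mul_assoc]

theorem integrable_gaussian_mul_taylorTerm (ha : 0 < a) (hA : ReCoercive a A) (x₀ : 𝔼) (n : ℕ)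
    (F : 𝔼 → ℂ) : Integrable fun x => gaussian A x * taylorTerm x₀ n F x :=
  integrable_gaussian_mul ha hA (hasTemperateGrowth_taylorTerm x₀ n F)

theorem succ_mul_integral_gaussian_mul_taylorTerm_succ (ha : 0 < a) (hA : ReCoercive a A)
    (hA_symm : A.IsSymm) (hBA : B * A = 1) (x₀ : 𝔼) (n : ℕ) {F : 𝔼 → ℂ} (hF : ContDiff ℝ ∞ F) :
    ((n : ℂ) + 1) * ∫ x, gaussian A x * taylorTerm x₀ (n + 1) F x =
      ∑ i, ∑ l, B i l * ∫ x, gaussian A x * pderiv l (taylorTerm x₀ n (pderiv i F)) x := by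
  rw [← integral_const_mul]
  simp only [mul_left_comm _ (gaussian A _), succ_mul_taylorTerm_succ, Finset.mul_sum]
  rw [integral_finsetSum _ fun i _ => integrable_gaussian_mul ha hA
    (.fun_mul (hasTemperateGrowth_coord i) (hasTemperateGrowth_taylorTerm x₀ n _))]
  exact Finset.sum_congr rfl fun i _ => integral_gaussian_mul_coord_mul ha hA hA_symm hBA
    (hasTemperateGrowth_taylorTerm x₀ n _)
    (hasTemperateGrowth_pderiv_taylorTerm x₀ n (contDiff_pderiv hF i)) i

theorem integral_gaussian_mul_taylorTerm_add_two (ha : 0 < a) (hA : ReCoercive a A)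
    (hA_symm : A.IsSymm) (hBA : B * A = 1) (x₀ : 𝔼) (n : ℕ) {F : 𝔼 → ℂ} (hF : ContDiff ℝ ∞ F) :
    ((n : ℂ) + 2) * ∫ x, gaussian A x * taylorTerm x₀ (n + 2) F x =
      ∫ x, gaussian A x * taylorTerm x₀ n (quadOp B F) x := by
  have hstep := succ_mul_integral_gaussian_mul_taylorTerm_succ ha hA hA_symm hBA x₀ (n + 1) hF
  rw [show ((n : ℂ) + 2) = ((n + 1 : ℕ) : ℂ) + 1 by push_cast; ring, hstep]
  have hint (i j : Fin d) : Integrable fun x =>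
      B i j * (gaussian A x * taylorTerm x₀ n (pderiv i (pderiv j F)) x) :=
    (integrable_gaussian_mul_taylorTerm ha hA x₀ n _).const_mul _
  simp only [taylorTerm_quadOp x₀ hF, Finset.mul_sum, mul_left_comm (gaussian A _),
    fun i => pderiv_taylorTerm_succ x₀ (contDiff_pderiv hF i)]
  rw [integral_finsetSum _ fun i _ => integrable_finsetSum _ fun j _ => hint i j]
  simp only [fun i => integral_finsetSum Finset.univ fun j _ => hint i j, integral_const_mul,
    fun i j => pderiv_comm (contDiff_infty.1 hF 2) i j]

theorem integral_gaussian_mul_taylorTerm_odd (ha : 0 < a) (hA : ReCoercive a A)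
    (hA_symm : A.IsSymm) (hBA : B * A = 1) (x₀ : 𝔼) (ν : ℕ) {F : 𝔼 → ℂ} (hF : ContDiff ℝ ∞ F) :
    ∫ x, gaussian A x * taylorTerm x₀ (2 * ν + 1) F x = 0 := by
  induction ν generalizing F with
  | zero =>
    simpa [pderiv_taylorTerm_zero] using
      succ_mul_integral_gaussian_mul_taylorTerm_succ ha hA hA_symm hBA x₀ 0 hF
  | succ ν ih =>
    have hstep := integral_gaussian_mul_taylorTerm_add_two ha hA hA_symm hBA x₀ (2 * ν + 1) hF
    rw [ih (contDiff_quadOp hF B)] at hstep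
    exact (mul_eq_zero.1 hstep).resolve_left (by exact_mod_cast (by omega : 2 * ν + 1 + 2 ≠ 0))

theorem integral_gaussian_mul_taylorTerm_even (ha : 0 < a) (hA : ReCoercive a A)
    (hA_symm : A.IsSymm) (hBA : B * A = 1) (x₀ : 𝔼) (ν : ℕ) {F : 𝔼 → ℂ} (hF : ContDiff ℝ ∞ F) :
    ∫ x, gaussian A x * taylorTerm x₀ (2 * ν) F x =
      (∫ x, gaussian A x) * ((2 ^ ν * (ν.factorial : ℂ))⁻¹ * (quadOp B)^[ν] F x₀) := by
  induction ν generalizing F with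
  | zero => simp [taylorTerm, integral_mul_const]
  | succ ν ih =>
    have hstep := integral_gaussian_mul_taylorTerm_add_two ha hA hA_symm hBA x₀ (2 * ν) hF
    rw [ih (contDiff_quadOp hF B)] at hstep
    have hne : ((2 * ν : ℕ) : ℂ) + 2 ≠ 0 := by exact_mod_cast (by omega : 2 * ν + 2 ≠ 0)
    refine mul_left_cancel₀ hne (hstep.trans ?_)
    rw [Function.iterate_succ_apply, Nat.factorial_succ, pow_succ]
    have hsucc : (ν : ℂ) + 1 ≠ 0 := Nat.cast_add_one_ne_zero ν
    push_cast
    field_simp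

end Gaussian

section GaussianIntegral

theorem quadForm_add (A B : Matrix (Fin d) (Fin d) ℂ) (x : 𝔼) :
    quadForm (A + B) x = quadForm A x + quadForm B x := by
  simp [quadForm, add_mul, Finset.sum_add_distrib]

theorem quadForm_smul (c : ℂ) (A : Matrix (Fin d) (Fin d) ℂ) (x : 𝔼) :
    quadForm (c • A) x = c * quadForm A x := by
  simp [quadForm, Finset.mul_sum, mul_assoc]

theorem quadForm_one (x : 𝔼) : quadForm 1 x = ((‖x‖ ^ 2 : ℝ) : ℂ) := by
  rw [EuclideanSpace.real_norm_sq_eq]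
  simp [quadForm, Matrix.one_apply, sq]

theorem norm_quadForm_le (A : Matrix (Fin d) (Fin d) ℂ) (x : 𝔼) :
    ‖quadForm A x‖ ≤ (∑ i, ∑ j, ‖A i j‖) * ‖x‖ ^ 2 := by
  simp only [Finset.sum_mul]
  refine norm_sum_le_of_le _ fun i _ => norm_sum_le_of_le _ fun j _ => ?_
  rw [norm_mul, norm_mul, Complex.norm_real, Complex.norm_real, mul_assoc, sq]
  gcongr <;> exact PiLp.norm_apply_le x _

theorem star_dotProduct_mulVec_of_isSymm {B : Matrix (Fin d) (Fin d) ℂ} (hB_symm : B.IsSymm)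
    (v : Fin d → ℂ) :
    star v ⬝ᵥ B.mulVec v = quadForm B (WithLp.toLp 2 fun i => (v i).re) +
      quadForm B (WithLp.toLp 2 fun i => (v i).im) := by
  have hterm (i j : Fin d) : star (v i) * (B i j * v j) =
      (B i j * (v i).re * (v j).re + B i j * (v i).im * (v j).im) +
        Complex.I * (B i j * (v i).re * (v j).im - B i j * (v i).im * (v j).re) := by
    conv_lhs => rw [← Complex.re_add_im (v i), ← Complex.re_add_im (v j)]
    simp only [Complex.star_def, map_add, map_mul, Complex.conj_ofReal, Complex.conj_I]
    linear_combination (-(B i j) * (v i).im * (v j).im) * Complex.I_sq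
  have hcross : ∑ i, ∑ j, B i j * ((v i).im : ℂ) * (v j).re =
      ∑ i, ∑ j, B i j * ((v i).re : ℂ) * (v j).im := by
    rw [Finset.sum_comm]
    congr! 2 with i _ j
    rw [hB_symm.apply i j]
    ring
  simp only [dotProduct, Matrix.mulVec, Pi.star_apply, Finset.mul_sum, hterm,
    Finset.sum_add_distrib]
  simp only [← Finset.mul_sum, Finset.sum_sub_distrib, hcross, sub_self, mul_zero, add_zero,
    quadForm]

variable {B : Matrix (Fin d) (Fin d) ℂ} {b : ℝ}

theorem ReCoercive.mono {b' : ℝ} (hB : ReCoercive b B) (hb : b' ≤ b) : ReCoercive b' B :=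
  fun x => (by gcongr : b' * ‖x‖ ^ 2 ≤ b * ‖x‖ ^ 2).trans (hB x)

theorem ReCoercive.smul {c : ℝ} (hB : ReCoercive b B) (hc : 0 ≤ c) :
    ReCoercive (c * b) ((c : ℂ) • B) := fun x => by
  rw [quadForm_smul, Complex.re_ofReal_mul, mul_assoc]
  exact mul_le_mul_of_nonneg_left (hB x) hc

theorem ReCoercive.one_add_smul_sub_one (hB : ReCoercive b B) (hb : b ≤ 1) {t : ℝ}
    (ht : t ∈ Set.Icc (0 : ℝ) 1) : ReCoercive b (1 + (t : ℂ) • (B - 1)) := fun x => by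
  have hconvex : 1 + (t : ℂ) • (B - 1) = ((1 - t : ℝ) : ℂ) • 1 + (t : ℂ) • B := by
    push_cast
    module
  rw [hconvex, quadForm_add, quadForm_smul, quadForm_smul, quadForm_one, Complex.add_re,
    Complex.re_ofReal_mul, Complex.re_ofReal_mul, Complex.ofReal_re]
  calc b * ‖x‖ ^ 2 = (1 - t) * (b * ‖x‖ ^ 2) + t * (b * ‖x‖ ^ 2) := by ring
    _ ≤ (1 - t) * (1 * ‖x‖ ^ 2) + t * (quadForm B x).re :=
      add_le_add (mul_le_mul_of_nonneg_left (by gcongr) (sub_nonneg.2 ht.2))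
        (mul_le_mul_of_nonneg_left (hB x) ht.1)
    _ = _ := by rw [one_mul]

theorem ReCoercive.add_smul_of_norm_le (hB : ReCoercive b B) {C : Matrix (Fin d) (Fin d) ℂ} {z : ℂ}
    (hz : ‖z‖ * ∑ i, ∑ j, ‖C i j‖ ≤ b / 2) : ReCoercive (b / 2) (B + z • C) := fun x => by
  have hpert : ‖z * quadForm C x‖ ≤ b / 2 * ‖x‖ ^ 2 := by
    rw [norm_mul]
    calc ‖z‖ * ‖quadForm C x‖ ≤ ‖z‖ * ((∑ i, ∑ j, ‖C i j‖) * ‖x‖ ^ 2) := by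
          gcongr
          exact norm_quadForm_le C x
      _ ≤ b / 2 * ‖x‖ ^ 2 := by
          rw [← mul_assoc]
          gcongr
  rw [quadForm_add, quadForm_smul, Complex.add_re]
  linarith [hB x, (abs_le.1 ((Complex.abs_re_le_norm _).trans hpert)).1]

theorem ReCoercive.re_pos_of_mem_roots_charpoly (hB : ReCoercive b B) (hb : 0 < b)
    (hB_symm : B.IsSymm) {z : ℂ} (hz : z ∈ B.charpoly.roots) : 0 < z.re := by
  have hdet := Polynomial.isRoot_of_mem_roots hz
  rw [Polynomial.IsRoot, Matrix.eval_charpoly] at hdet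
  obtain ⟨v, hv0, hv⟩ := Matrix.exists_mulVec_eq_zero_iff.2 hdet
  have hBv : B.mulVec v = z • v := by
    simpa [Matrix.sub_mulVec, sub_eq_zero, eq_comm] using hv
  set p : 𝔼 := WithLp.toLp 2 fun i => (v i).re
  set q : 𝔼 := WithLp.toLp 2 fun i => (v i).im
  have hnorm : star v ⬝ᵥ v = ((‖p‖ ^ 2 + ‖q‖ ^ 2 : ℝ) : ℂ) := by
    have hone := star_dotProduct_mulVec_of_isSymm Matrix.isSymm_one v
    rwa [Matrix.one_mulVec, quadForm_one, quadForm_one, ← Complex.ofReal_add] at hone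
  have hrayleigh : z * ((‖p‖ ^ 2 + ‖q‖ ^ 2 : ℝ) : ℂ) = quadForm B p + quadForm B q := by
    rw [← star_dotProduct_mulVec_of_isSymm hB_symm v, hBv, dotProduct_smul, smul_eq_mul, hnorm]
  have hnorm_pos : 0 < ‖p‖ ^ 2 + ‖q‖ ^ 2 := by
    by_contra! hle
    have hp : p = 0 := by
      rw [← norm_eq_zero, ← sq_eq_zero_iff]
      linarith [sq_nonneg ‖p‖, sq_nonneg ‖q‖]
    have hq : q = 0 := by
      rw [← norm_eq_zero, ← sq_eq_zero_iff]
      linarith [sq_nonneg ‖p‖, sq_nonneg ‖q‖]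
    exact hv0 (funext fun i => Complex.ext (congrArg (· i) hp) (congrArg (· i) hq))
  have hre : z.re * (‖p‖ ^ 2 + ‖q‖ ^ 2) = (quadForm B p).re + (quadForm B q).re := by
    rw [← Complex.add_re, ← hrayleigh, Complex.re_mul_ofReal]
  refine pos_of_mul_pos_left ?_ hnorm_pos.le
  linarith [hB p, hB q, mul_pos hb hnorm_pos]

theorem ReCoercive.det_ne_zero (hB : ReCoercive b B) (hb : 0 < b) (hB_symm : B.IsSymm) :
    B.det ≠ 0 := by
  rw [Matrix.det_eq_prod_roots_charpoly]
  exact Multiset.prod_ne_zero fun h0 =>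
    (hB.re_pos_of_mem_roots_charpoly hb hB_symm h0).ne' Complex.zero_re

theorem hasDerivAt_det_one_add_smul (M : Matrix (Fin d) (Fin d) ℂ) :
    HasDerivAt (fun z : ℂ => (1 + z • M).det) M.trace 0 := by
  rw [funext fun z : ℂ => Matrix.det_one_add_smul z M]
  set P := (Matrix.det (1 + (Polynomial.X : Polynomial ℂ) • M.map Polynomial.C)).divX.divX
  have hlinear := ((hasDerivAt_id (0 : ℂ)).const_mul M.trace).const_add 1
  have hremainder := (P.hasDerivAt 0).mul (hasDerivAt_pow 2 (0 : ℂ))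
  exact (hlinear.add hremainder).congr_deriv (by simp)

theorem hasDerivAt_det_add_smul {A C : Matrix (Fin d) (Fin d) ℂ} {t : ℝ}
    (hdet : (A + (t : ℂ) • C).det ≠ 0) :
    HasDerivAt (fun τ : ℝ => (A + (τ : ℂ) • C).det)
      ((A + (t : ℂ) • C).det * ((A + (t : ℂ) • C)⁻¹ * C).trace) t := by
  set T := A + (t : ℂ) • C with hT
  have hfactor (τ : ℝ) :
      (A + (τ : ℂ) • C).det = T.det * (1 + ((τ - t : ℝ) : ℂ) • (T⁻¹ * C)).det := by
    rw [← Matrix.det_mul, mul_add, mul_one, Matrix.mul_smul,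
      Matrix.mul_nonsing_inv_cancel_left _ _ (isUnit_iff_ne_zero.2 hdet), hT]
    push_cast
    congr 1
    module
  have hshift : HasDerivAt (fun τ : ℝ => ((τ - t : ℝ) : ℂ)) 1 t :=
    ((hasDerivAt_id t).sub_const t).ofReal_comp.congr_deriv Complex.ofReal_one
  have hdet_one : HasDerivAt (fun z : ℂ => (1 + z • (T⁻¹ * C)).det) (T⁻¹ * C).trace
      ((t - t : ℝ) : ℂ) := by
    simpa using hasDerivAt_det_one_add_smul (T⁻¹ * C)
  rw [funext hfactor]
  exact ((hdet_one.comp t hshift).const_mul _).congr_deriv (by rw [mul_one])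

theorem det_one_add_smul_sub_one (B : Matrix (Fin d) (Fin d) ℂ) (t : ℂ) :
    (1 + t • (B - 1)).det = (B.charpoly.roots.map fun z => 1 + t * (z - 1)).prod := by
  have hsplits : B.charpoly.Splits := IsAlgClosed.splits _
  have hcard : B.charpoly.roots.card = d := by
    rw [← hsplits.natDegree_eq_card_roots, Matrix.charpoly_natDegree_eq_dim, Fintype.card_fin]
  rcases eq_or_ne t 0 with rfl | ht
  · simp
  have hscalar : 1 + t • (B - 1) = (-t) • (Matrix.scalar (Fin d) ((t - 1) / t) - B) := by
    rw [Matrix.scalar_apply, ← Matrix.smul_one_eq_diagonal, smul_sub (-t), smul_smul,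
      show -t * ((t - 1) / t) = 1 - t by field_simp; ring]
    module
  have heval : B.charpoly.eval ((t - 1) / t) =
      (B.charpoly.roots.map fun z => (t - 1) / t - z).prod := by
    conv_lhs => rw [hsplits.eq_prod_roots_of_monic (Matrix.charpoly_monic B)]
    rw [Polynomial.eval_multiset_prod, Multiset.map_map]
    simp
  rw [hscalar, Matrix.det_smul, Fintype.card_fin, ← Matrix.eval_charpoly, heval,
    show (-t) ^ d = (B.charpoly.roots.map fun _ => -t).prod by simp [hcard],
    ← Multiset.prod_map_mul]
  congr! 2 with z
  field_simp
  ring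

theorem hasDerivAt_gaussian_add_smul (A C : Matrix (Fin d) (Fin d) ℂ) (x : 𝔼) (t : ℝ) :
    HasDerivAt (fun τ : ℝ => gaussian (A + (τ : ℂ) • C) x)
      (-(1 / 2) * (gaussian (A + (t : ℂ) • C) x * quadForm C x)) t := by
  simp only [gaussian, quadForm_add, quadForm_smul]
  have hexponent := (((Complex.ofRealCLM.hasDerivAt (x := t)).mul_const (quadForm C x)).const_add
    (quadForm A x)).const_mul (-(1 / 2) : ℂ)
  refine hexponent.cexp.congr_deriv ?_
  simp only [Complex.ofRealCLM_apply, Complex.ofReal_one]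
  ring

theorem hasDerivAt_integral_gaussian_add_smul {A C : Matrix (Fin d) (Fin d) ℂ} {a t : ℝ}
    (ha : 0 < a) (hA : ReCoercive a (A + (t : ℂ) • C)) :
    HasDerivAt (fun τ : ℝ => ∫ x, gaussian (A + (τ : ℂ) • C) x)
      (-(1 / 2) * ∫ x, gaussian (A + (t : ℂ) • C) x * quadForm C x) t := by
  set M : ℝ := ∑ i, ∑ j, ‖C i j‖
  have : 0 ≤ M := by positivity
  set r : ℝ := a / 2 / (M + 1)
  have hr : 0 < r := by positivity
  have hnear (τ : ℝ) (hτ : τ ∈ Metric.ball t r) : ReCoercive (a / 2) (A + (τ : ℂ) • C) := by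
    have hsplit : A + (τ : ℂ) • C = A + (t : ℂ) • C + ((τ - t : ℝ) : ℂ) • C := by
      push_cast
      module
    rw [hsplit]
    refine hA.add_smul_of_norm_le ?_
    rw [Complex.norm_real]
    calc ‖τ - t‖ * M ≤ r * (M + 1) := by
          gcongr
          exacts [(mem_ball_iff_norm.1 hτ).le, le_add_of_nonneg_right zero_le_one]
      _ = a / 2 := div_mul_cancel₀ _ (by positivity)
  have hgauss_int : Integrable fun x => gaussian (A + (t : ℂ) • C) x := by
    simpa using integrable_gaussian_mul ha hA (.const 1)
  rw [← integral_const_mul]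
  refine (hasDerivAt_integral_of_dominated_loc_of_deriv_le (μ := volume)
    (F := fun (τ : ℝ) (x : 𝔼) => gaussian (A + (τ : ℂ) • C) x)
    (bound := fun x : 𝔼 => M * ((1 + ‖x‖) ^ 2 * Real.exp (-(a / 2 / 2) * ‖x‖ ^ 2)))
    (Metric.ball_mem_nhds t hr)
    (.of_forall fun τ => (contDiff_gaussian _).continuous.aestronglyMeasurable) hgauss_int
    (continuous_const.mul ((contDiff_gaussian _).continuous.mul
      (contDiff_quadForm _).continuous)).aestronglyMeasurable
    (.of_forall fun x τ hτ => ?_)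
    ((integrable_pow_mul_exp_neg_mul_sq_norm (by positivity) 2).const_mul _)
    (.of_forall fun x τ _ => hasDerivAt_gaussian_add_smul A C x τ)).2
  have hquad : ‖quadForm C x‖ ≤ M * (1 + ‖x‖) ^ 2 :=
    (norm_quadForm_le C x).trans (by gcongr; linarith [norm_nonneg x])
  rw [norm_mul, norm_mul]
  calc ‖(-(1 / 2) : ℂ)‖ * (‖gaussian (A + (τ : ℂ) • C) x‖ * ‖quadForm C x‖)
      ≤ 1 * (Real.exp (-(a / 2 / 2) * ‖x‖ ^ 2) * (M * (1 + ‖x‖) ^ 2)) := by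
        gcongr
        exacts [by norm_num, norm_gaussian_le (hnear τ hτ) x]
    _ = _ := by ring

theorem hasDerivAt_sq_integral_gaussian_mul_det {A C : Matrix (Fin d) (Fin d) ℂ} {a t : ℝ}
    (ha : 0 < a) (hA : ReCoercive a (A + (t : ℂ) • C)) (hA_symm : (A + (t : ℂ) • C).IsSymm) :
    HasDerivAt (fun τ : ℝ => (∫ x, gaussian (A + (τ : ℂ) • C) x) ^ 2 * (A + (τ : ℂ) • C).det)
      0 t := by
  have hdet := hA.det_ne_zero ha hA_symm
  have hinv := Matrix.nonsing_inv_mul _ (isUnit_iff_ne_zero.2 hdet)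
  refine (((hasDerivAt_integral_gaussian_add_smul ha hA).pow 2).mul
    (hasDerivAt_det_add_smul hdet)).congr_deriv ?_
  rw [integral_gaussian_mul_quadForm ha hA hA_symm hinv]
  simp only [Pi.pow_apply]
  push_cast
  ring

theorem integral_gaussian_smul_one {c : ℝ} (hc : 0 < c) :
    ∫ x : 𝔼, gaussian ((c : ℂ) • 1) x = ((2 * Real.pi / c) ^ (d / 2 : ℝ) : ℝ) := by
  have hexp (x : 𝔼) : gaussian ((c : ℂ) • 1) x = (Real.exp (-(c / 2) * ‖x‖ ^ 2) : ℝ) := by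
    rw [gaussian, quadForm_smul, quadForm_one]
    push_cast
    congr 1
    ring
  simp only [hexp]
  rw [integral_complex_ofReal, GaussianFourier.integral_rexp_neg_mul_sq_norm (half_pos hc),
    finrank_euclideanSpace_fin]
  congr 2
  field_simp

theorem isSymm_one_add_smul_sub_one (hB_symm : B.IsSymm) (z : ℂ) :
    (1 + z • (B - 1)).IsSymm :=
  Matrix.isSymm_one.add ((hB_symm.sub Matrix.isSymm_one).smul z)

theorem sq_integral_gaussian_mul_det (hb : 0 < b) (hB : ReCoercive b B) (hB_symm : B.IsSymm) :
    (∫ x, gaussian B x) ^ 2 * B.det = (2 * Real.pi) ^ d := by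
  wlog hb1 : b ≤ 1 generalizing b
  · exact this one_pos (hB.mono (not_le.1 hb1).le) le_rfl
  have hderiv (t : ℝ) (ht : t ∈ Set.Icc (0 : ℝ) 1) := hasDerivAt_sq_integral_gaussian_mul_det hb
    (hB.one_add_smul_sub_one hb1 ht) (isSymm_one_add_smul_sub_one hB_symm t)
  have hconst := constant_of_has_deriv_right_zero
    (fun t ht => (hderiv t ht).continuousAt.continuousWithinAt)
    (fun t ht => (hderiv t (Set.Ico_subset_Icc_self ht)).hasDerivWithinAt) 1
    (Set.right_mem_Icc.2 zero_le_one)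
  have hone := integral_gaussian_smul_one (d := d) one_pos
  simp only [Complex.ofReal_one, one_smul, div_one] at hone
  simp only [Complex.ofReal_one, one_smul, add_sub_cancel, Complex.ofReal_zero, zero_smul,
    add_zero, Matrix.det_one, mul_one, hone] at hconst
  rw [hconst, ← Complex.ofReal_pow, ← Real.rpow_natCast, ← Real.rpow_mul (by positivity)]
  norm_num

theorem sq_prod_map_cpow_mul_prod {m : Multiset ℂ} (hm : ∀ z ∈ m, z ≠ 0) :
    (m.map fun z => z ^ (-(1 / 2) : ℂ)).prod ^ 2 * m.prod = 1 := by
  rw [← Multiset.prod_map_pow, ← Multiset.map_id' m, Multiset.map_map, ← Multiset.prod_map_mul]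
  refine Multiset.prod_eq_one fun w hw => ?_
  obtain ⟨z, hz, rfl⟩ := Multiset.mem_map.1 hw
  rw [Function.comp_apply, ← Complex.cpow_nat_mul]
  norm_num [Complex.cpow_neg_one, hm z hz]

theorem ReCoercive.one_add_mul_sub_one_mem_slitPlane (hB : ReCoercive b B) (hb : 0 < b)
    (hB_symm : B.IsSymm) {t : ℝ} (ht : t ∈ Set.Icc (0 : ℝ) 1) {z : ℂ}
    (hz : z ∈ B.charpoly.roots) : 1 + (t : ℂ) * (z - 1) ∈ Complex.slitPlane := by
  have hz_re := hB.re_pos_of_mem_roots_charpoly hb hB_symm hz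
  have hre : (1 + (t : ℂ) * (z - 1)).re = (1 - t) * 1 + t * z.re := by
    simp only [Complex.add_re, Complex.one_re, Complex.re_ofReal_mul, Complex.sub_re]
    ring
  refine Or.inl ?_
  rw [hre]
  have hmin : 0 < min 1 z.re := lt_min one_pos hz_re
  nlinarith [min_le_left 1 z.re, min_le_right 1 z.re, ht.1, ht.2]

theorem continuousOn_prod_roots_cpow (hb : 0 < b) (hB : ReCoercive b B) (hB_symm : B.IsSymm) :
    ContinuousOn (fun t : ℝ => ((B.charpoly.roots.map fun z => 1 + (t : ℂ) * (z - 1)).map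
      fun z => z ^ (-(1 / 2) : ℂ)).prod) (Set.Icc 0 1) := fun t ht => by
  simp only [Multiset.map_map]
  refine tendsto_multiset_prod _ fun z hz => ?_
  have hlinear : ContinuousAt (fun τ : ℝ => 1 + (τ : ℂ) * (z - 1)) t := by fun_prop
  exact (hlinear.cpow continuousAt_const
    (hB.one_add_mul_sub_one_mem_slitPlane hb hB_symm ht hz)).continuousWithinAt

theorem continuousOn_integral_gaussian_segment {A C : Matrix (Fin d) (Fin d) ℂ} {a : ℝ}
    (ha : 0 < a) {S : Set ℝ} (hA : ∀ t ∈ S, ReCoercive a (A + (t : ℂ) • C)) :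
    ContinuousOn (fun t : ℝ => ∫ x, gaussian (A + (t : ℂ) • C) x) S := fun t ht =>
  (hasDerivAt_integral_gaussian_add_smul ha (hA t ht)).continuousAt.continuousWithinAt

theorem integral_gaussian_eq_detInvSqrt (hb : 0 < b) (hB : ReCoercive b B) (hB_symm : B.IsSymm) :
    ∫ x, gaussian ((2 * Real.pi : ℂ) • B) x = detInvSqrt B := by
  wlog hb1 : b ≤ 1 generalizing b
  · exact this one_pos (hB.mono (not_le.1 hb1).le) le_rfl
  have hpi : (0 : ℝ) < 2 * Real.pi := by positivity
  set J : ℝ → ℂ := fun t => ∫ x, gaussian ((2 * Real.pi : ℂ) • (1 + (t : ℂ) • (B - 1))) x with hJ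
  set P : ℝ → ℂ := fun t => ((B.charpoly.roots.map fun z => 1 + (t : ℂ) * (z - 1)).map
    fun z => z ^ (-(1 / 2) : ℂ)).prod with hP
  have hcoercive (t : ℝ) (ht : t ∈ Set.Icc (0 : ℝ) 1) :
      ReCoercive (2 * Real.pi * b) ((2 * Real.pi : ℂ) • (1 + (t : ℂ) • (B - 1))) := by
    simpa using (hB.one_add_smul_sub_one hb1 ht).smul hpi.le
  have hP_sq (t : ℝ) (ht : t ∈ Set.Icc (0 : ℝ) 1) :
      P t ^ 2 * (1 + (t : ℂ) • (B - 1)).det = 1 := by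
    rw [det_one_add_smul_sub_one]
    refine sq_prod_map_cpow_mul_prod fun w hw => ?_
    obtain ⟨z, hz, rfl⟩ := Multiset.mem_map.1 hw
    exact Complex.slitPlane_ne_zero (hB.one_add_mul_sub_one_mem_slitPlane hb hB_symm ht hz)
  have hJ_sq (t : ℝ) (ht : t ∈ Set.Icc (0 : ℝ) 1) :
      J t ^ 2 * (1 + (t : ℂ) • (B - 1)).det = 1 := by
    have hsq := sq_integral_gaussian_mul_det (by positivity) (hcoercive t ht)
      ((isSymm_one_add_smul_sub_one hB_symm t).smul _)
    rw [Matrix.det_smul, Fintype.card_fin, mul_left_comm] at hsq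
    exact (mul_eq_left₀ (pow_ne_zero d (by exact_mod_cast hpi.ne'))).1 hsq
  have hJ_cont : ContinuousOn J (Set.Icc 0 1) := by
    simp only [hJ, smul_add, smul_comm (2 * Real.pi : ℂ) (Complex.ofReal _)] at hcoercive ⊢
    exact continuousOn_integral_gaussian_segment (by positivity) hcoercive
  have hJ_zero : J 0 = P 0 := by
    have hone := integral_gaussian_smul_one (d := d) hpi
    simp_all
  have hJP := isPreconnected_Icc.eq_of_sq_eq hJ_cont (continuousOn_prod_roots_cpow hb hB hB_symm)
    (fun t ht => mul_right_cancel₀ (right_ne_zero_of_mul_eq_one (hP_sq t ht))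
      ((hJ_sq t ht).trans (hP_sq t ht).symm))
    (fun ht => (pow_ne_zero_iff two_ne_zero).1 (left_ne_zero_of_mul_eq_one (hP_sq _ ht)))
    (Set.left_mem_Icc.2 zero_le_one) hJ_zero (Set.right_mem_Icc.2 zero_le_one)
  simpa [hJ, detInvSqrt, -smul_add] using hJP

end GaussianIntegral

section Numeric

open PowerSeries

theorem factorial_rpow_mul_factorial_rpow_le {σ : ℝ} (hσ : 0 ≤ σ) (m l : ℕ) :
    (m.factorial : ℝ) ^ σ * (l.factorial : ℝ) ^ σ ≤ ((m + l).factorial : ℝ) ^ σ := by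
  rw [← Real.mul_rpow (by positivity) (by positivity)]
  refine Real.rpow_le_rpow (by positivity) ?_ hσ
  exact_mod_cast
    Nat.le_of_dvd (Nat.factorial_pos _) (Nat.factorial_mul_factorial_dvd_factorial_add m l)

theorem sum_antidiagonal_pow_mul_factorial_rpow_le {σ Y : ℝ} (hσ : 0 ≤ σ) (hY : 0 ≤ Y) (N : ℕ) :
    ∑ ml ∈ Finset.HasAntidiagonal.antidiagonal N, (Y ^ ml.1 * (ml.1.factorial : ℝ) ^ σ) *
      ((2 * Y) ^ ml.2 * (ml.2.factorial : ℝ) ^ σ) ≤ 2 * ((2 * Y) ^ N * (N.factorial : ℝ) ^ σ) := by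
  have hterm : ∀ ml ∈ Finset.HasAntidiagonal.antidiagonal N, (Y ^ ml.1 * (ml.1.factorial : ℝ) ^ σ) *
      ((2 * Y) ^ ml.2 * (ml.2.factorial : ℝ) ^ σ) ≤
      (1 / 2 : ℝ) ^ ml.1 * ((2 * Y) ^ N * (N.factorial : ℝ) ^ σ) := by
    rintro ⟨m, l⟩ hml
    obtain rfl := Finset.HasAntidiagonal.mem_antidiagonal.1 hml
    have hhalf : Y ^ m = (1 / 2 : ℝ) ^ m * (2 * Y) ^ m := by rw [← mul_pow]; congr 1; ring
    calc (Y ^ m * (m.factorial : ℝ) ^ σ) * ((2 * Y) ^ l * (l.factorial : ℝ) ^ σ)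
        = (1 / 2 : ℝ) ^ m * ((2 * Y) ^ (m + l) *
          ((m.factorial : ℝ) ^ σ * (l.factorial : ℝ) ^ σ)) := by rw [hhalf]; ring
      _ ≤ _ := by
          gcongr
          exact factorial_rpow_mul_factorial_rpow_le hσ m l
  refine (Finset.sum_le_sum hterm).trans ?_
  rw [← Finset.sum_mul, Finset.Nat.sum_antidiagonal_eq_sum_range_succ_mk]
  gcongr
  exact sum_geometric_two_le _

theorem sum_antidiagonal_gevrey_le {σ Y A A' : ℝ} (hσ : 0 ≤ σ) (hY : 0 ≤ Y) (hA : 0 ≤ A)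
    (hA' : 0 ≤ A') (N : ℕ) :
    ∑ ml ∈ Finset.HasAntidiagonal.antidiagonal N, (A * (Y ^ ml.1 * (ml.1.factorial : ℝ) ^ σ)) *
      (A' * ((2 * Y) ^ ml.2 * (ml.2.factorial : ℝ) ^ σ)) ≤
      2 * A * A' * ((2 * Y) ^ N * (N.factorial : ℝ) ^ σ) := by
  calc _ = A * A' * ∑ ml ∈ Finset.HasAntidiagonal.antidiagonal N,
        (Y ^ ml.1 * (ml.1.factorial : ℝ) ^ σ) * ((2 * Y) ^ ml.2 * (ml.2.factorial : ℝ) ^ σ) := by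
        rw [Finset.mul_sum]
        congr! 1 with ml
        ring
    _ ≤ A * A' * (2 * ((2 * Y) ^ N * (N.factorial : ℝ) ^ σ)) := by
        gcongr
        exact sum_antidiagonal_pow_mul_factorial_rpow_le hσ hY N
    _ = _ := by ring

/-- The coefficients of the power series `p` are bounded by `A Y^N N!^σ`. -/
def GevreyCoeff {𝕜 : Type*} [NormedField 𝕜] (σ Y A : ℝ) (p : 𝕜⟦X⟧) : Prop :=
  ∀ N : ℕ, ‖coeff N p‖ ≤ A * (Y ^ N * (N.factorial : ℝ) ^ σ)

theorem GevreyCoeff.mul {𝕜 : Type*} [NormedField 𝕜] {σ Y A A' : ℝ} {p q : 𝕜⟦X⟧} (hσ : 0 ≤ σ)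
    (hY : 0 ≤ Y) (hA : 0 ≤ A) (hA' : 0 ≤ A') (hp : GevreyCoeff σ Y A p)
    (hq : GevreyCoeff σ (2 * Y) A' q) : GevreyCoeff σ (2 * Y) (2 * A * A') (p * q) := by
  intro N
  rw [coeff_mul]
  refine le_trans (norm_sum_le_of_le _ fun ml _ => ?_) (sum_antidiagonal_gevrey_le hσ hY hA hA' N)
  rw [norm_mul]
  exact mul_le_mul (hp _) (hq _) (norm_nonneg _) ((norm_nonneg _).trans (hp _))

theorem GevreyCoeff.pow_mul {𝕜 : Type*} [NormedField 𝕜] {σ Y A A' : ℝ} {p q : 𝕜⟦X⟧} (hσ : 0 ≤ σ)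
    (hY : 0 ≤ Y) (hA : 0 ≤ A) (hA' : 0 ≤ A') (hp : GevreyCoeff σ Y A p)
    (hq : GevreyCoeff σ (2 * Y) A' q) (μ : ℕ) :
    GevreyCoeff σ (2 * Y) (A' * (2 * A) ^ μ) (p ^ μ * q) := by
  induction μ with
  | zero => simpa using hq
  | succ μ ih => convert hp.mul hσ hY hA (by positivity) ih using 1 <;> ring

/-- `F` has the formal expansion `∑ pₙ`, with coefficients and remainders bounded by
`A Y^N N!^σ`. The small parameter is absorbed into `Y` and the coefficients. -/
def HasGevreyExpansion (σ Y A : ℝ) (F : ℂ) (p : ℂ⟦X⟧) : Prop :=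
  GevreyCoeff σ Y A p ∧ ∀ N : ℕ,
    ‖F - ∑ n ∈ Finset.range N, coeff n p‖ ≤ A * (Y ^ N * (N.factorial : ℝ) ^ σ)

theorem mul_sub_sum_coeff_mul {R : Type*} [CommRing R] (F G : R) (p q : R⟦X⟧) (N : ℕ) :
    F * G - ∑ n ∈ Finset.range N, coeff n (p * q) =
      (∑ m ∈ Finset.range N, coeff m p * (G - ∑ l ∈ Finset.range (N - m), coeff l q)) +
        (F - ∑ m ∈ Finset.range N, coeff m p) * G := by
  have hcauchy : ∑ n ∈ Finset.range N, coeff n (p * q) =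
      ∑ m ∈ Finset.range N, coeff m p * ∑ l ∈ Finset.range (N - m), coeff l q := by
    simp only [coeff_mul, Finset.Nat.sum_antidiagonal_eq_sum_range_succ_mk, Finset.mul_sum]
    exact Finset.sum_range_diag_flip N fun m l => coeff m p * coeff l q
  rw [hcauchy]
  simp only [mul_sub, Finset.sum_sub_distrib, ← Finset.sum_mul]
  ring

theorem HasGevreyExpansion.mul {σ Y A A' : ℝ} {F G : ℂ} {p q : ℂ⟦X⟧} (hσ : 0 ≤ σ) (hY : 0 ≤ Y)
    (hA : 0 ≤ A) (hA' : 0 ≤ A') (hF : HasGevreyExpansion σ Y A F p)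
    (hG : HasGevreyExpansion σ (2 * Y) A' G q) :
    HasGevreyExpansion σ (2 * Y) (2 * A * A') (F * G) (p * q) := by
  refine ⟨hF.1.mul hσ hY hA hA' hG.1, fun N => ?_⟩
  have hsum := sum_antidiagonal_gevrey_le hσ hY hA hA' N
  rw [Finset.Nat.sum_antidiagonal_eq_sum_range_succ_mk, Finset.sum_range_succ] at hsum
  have hG_norm : ‖G‖ ≤ A' * ((2 * Y) ^ (N - N) * ((N - N).factorial : ℝ) ^ σ) := by
    simpa using hG.2 0
  rw [mul_sub_sum_coeff_mul]
  refine le_trans ((norm_add_le _ _).trans (add_le_add (norm_sum_le_of_le _ fun m _ => ?_) ?_)) hsum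
  · rw [norm_mul]
    exact mul_le_mul (hF.1 _) (hG.2 _) (norm_nonneg _) ((norm_nonneg _).trans (hF.1 _))
  · rw [norm_mul]
    exact mul_le_mul (hF.2 _) hG_norm (norm_nonneg _) ((norm_nonneg _).trans (hF.2 _))

theorem HasGevreyExpansion.pow_mul {σ Y A A' : ℝ} {F G : ℂ} {p q : ℂ⟦X⟧} (hσ : 0 ≤ σ) (hY : 0 ≤ Y)
    (hA : 0 ≤ A) (hA' : 0 ≤ A') (hF : HasGevreyExpansion σ Y A F p)
    (hG : HasGevreyExpansion σ (2 * Y) A' G q) (μ : ℕ) :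
    HasGevreyExpansion σ (2 * Y) (A' * (2 * A) ^ μ) (F ^ μ * G) (p ^ μ * q) := by
  induction μ with
  | zero => simpa using hG
  | succ μ ih => convert hF.mul hσ hY hA (by positivity) ih using 1 <;> ring

theorem factorial_add_le (m l : ℕ) :
    (m + l).factorial ≤ 2 ^ (m + l) * (m.factorial * l.factorial) := by
  rw [← Nat.add_choose_mul_factorial_mul_factorial m l, mul_assoc]
  exact Nat.mul_le_mul_right _ (Nat.choose_le_two_pow _ _)

theorem factorial_three_mul_add_le (μ l : ℕ) :
    (3 * μ + l).factorial ≤ 256 ^ (μ + l) * (μ.factorial ^ 3 * l.factorial) := by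
  have hdouble : (2 * μ).factorial ≤ 2 ^ (2 * μ) * (μ.factorial * μ.factorial) := by
    simpa only [two_mul] using factorial_add_le μ μ
  have htriple : (3 * μ).factorial ≤ 2 ^ (3 * μ) * ((2 * μ).factorial * μ.factorial) := by
    simpa only [show 2 * μ + μ = 3 * μ by ring] using factorial_add_le (2 * μ) μ
  calc (3 * μ + l).factorial ≤ 2 ^ (3 * μ + l) * ((3 * μ).factorial * l.factorial) :=
        factorial_add_le (3 * μ) l
    _ ≤ 2 ^ (3 * μ + l) * ((2 ^ (3 * μ) * ((2 ^ (2 * μ) *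
        (μ.factorial * μ.factorial)) * μ.factorial)) * l.factorial) := by
        gcongr
        exact htriple.trans (by gcongr)
    _ = 2 ^ (8 * μ + l) * (μ.factorial ^ 3 * l.factorial) := by
        rw [show 8 * μ + l = (3 * μ + l) + 3 * μ + 2 * μ by ring, pow_add 2 _ (2 * μ),
          pow_add 2 _ (3 * μ)]
        ring
    _ ≤ 2 ^ (8 * (μ + l)) * (μ.factorial ^ 3 * l.factorial) := by
        gcongr
        · norm_num
        · omega
    _ = _ := by rw [pow_mul]; norm_num

theorem factorial_rpow_mul_sqrt_factorial (n : ℕ) (s : ℝ) :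
    (n.factorial : ℝ) ^ (s - 1) * √n.factorial = (n.factorial : ℝ) ^ (s - 1 / 2) := by
  rw [Real.sqrt_eq_rpow, ← Real.rpow_add (by positivity)]
  ring_nf

theorem sqrt_factorial_three_mul_add_le (μ l : ℕ) :
    √((3 * μ + l).factorial : ℝ) ≤ 16 ^ (μ + l) * (μ.factorial * √μ.factorial * √l.factorial) := by
  refine Real.sqrt_le_iff.2 ⟨by positivity, ?_⟩
  have hfactorial : ((3 * μ + l).factorial : ℝ) ≤
      256 ^ (μ + l) * (μ.factorial ^ 3 * l.factorial) := by
    exact_mod_cast factorial_three_mul_add_le μ l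
  refine hfactorial.trans_eq ?_
  rw [mul_pow, mul_pow, mul_pow, Real.sq_sqrt (by positivity), Real.sq_sqrt (by positivity),
    ← pow_mul, mul_comm (μ + l), pow_mul, show (16 : ℝ) ^ 2 = 256 by norm_num]
  ring

theorem factorial_rpow_mul_sqrt_factorial_div_le {s : ℝ} (hs : 1 ≤ s) (μ l : ℕ) :
    (l.factorial : ℝ) ^ (s - 1) * √((3 * μ + l).factorial) / μ.factorial ≤
      16 ^ (μ + l) * ((μ + l).factorial : ℝ) ^ (s - 1 / 2) := by
  have hsqrt_le : √(μ.factorial : ℝ) ≤ (μ.factorial : ℝ) ^ (s - 1 / 2) := by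
    rw [Real.sqrt_eq_rpow]
    exact Real.rpow_le_rpow_of_exponent_le (by exact_mod_cast Nat.factorial_pos μ) (by linarith)
  rw [div_le_iff₀ (by positivity)]
  calc (l.factorial : ℝ) ^ (s - 1) * √((3 * μ + l).factorial : ℝ)
      ≤ (l.factorial : ℝ) ^ (s - 1) *
        (16 ^ (μ + l) * (μ.factorial * √μ.factorial * √l.factorial)) := by
        gcongr
        exact sqrt_factorial_three_mul_add_le μ l
    _ = 16 ^ (μ + l) * (√μ.factorial * (l.factorial : ℝ) ^ (s - 1 / 2)) * μ.factorial := by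
        rw [← factorial_rpow_mul_sqrt_factorial l]
        ring
    _ ≤ 16 ^ (μ + l) * ((μ.factorial : ℝ) ^ (s - 1 / 2) * (l.factorial : ℝ) ^ (s - 1 / 2)) *
        μ.factorial := by gcongr
    _ ≤ _ := by
        gcongr
        exact factorial_rpow_mul_factorial_rpow_le (by linarith) μ l

theorem factorial_two_mul_rpow_le {s : ℝ} (hs : 1 ≤ s) (k : ℕ) :
    ((2 * k).factorial : ℝ) ^ (s - 1 / 2) ≤ (4 ^ s) ^ k * (k.factorial : ℝ) ^ (2 * s - 1) := by
  have hdouble : ((2 * k).factorial : ℝ) ≤ 4 ^ k * (k.factorial : ℝ) ^ (2 : ℕ) := by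
    have hadd := factorial_add_le k k
    rw [← two_mul, pow_mul, ← sq] at hadd
    exact_mod_cast hadd
  calc ((2 * k).factorial : ℝ) ^ (s - 1 / 2)
      ≤ (4 ^ k * (k.factorial : ℝ) ^ (2 : ℕ)) ^ (s - 1 / 2) :=
        Real.rpow_le_rpow (by positivity) hdouble (by linarith)
    _ = ((4 : ℝ) ^ (s - 1 / 2)) ^ k * (k.factorial : ℝ) ^ (2 * s - 1) := by
        rw [Real.mul_rpow (by positivity) (by positivity), Real.rpow_pow_comm (by norm_num),
          ← Real.rpow_natCast _ 2, ← Real.rpow_mul (by positivity)]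
        push_cast
        ring_nf
    _ ≤ _ := by
        gcongr
        · norm_num
        · linarith

theorem pow_le_exp_mul_factorial_rpow {a ε : ℝ} (ha : 0 ≤ a) (hε : 0 < ε) (n : ℕ) :
    a ^ n ≤ Real.exp (ε * a ^ (1 / ε)) * (n.factorial : ℝ) ^ ε := by
  calc a ^ n = ((a ^ (1 / ε)) ^ n) ^ ε := by
        rw [Real.rpow_pow_comm ha, ← Real.rpow_mul (by positivity), one_div_mul_cancel hε.ne',
          Real.rpow_one]
    _ ≤ (n.factorial * Real.exp (a ^ (1 / ε))) ^ ε := by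
        refine Real.rpow_le_rpow (by positivity) ?_ hε.le
        exact (div_le_iff₀' (by positivity)).1 (Real.pow_div_factorial_le_exp _ (by positivity) n)
    _ = _ := by
        rw [Real.mul_rpow (by positivity) (by positivity), ← Real.exp_mul, mul_comm,
          mul_comm (a ^ _)]

theorem pow_le_sqrt_factorial_mul_exp_half_sq (x : ℝ) (n : ℕ) :
    x ^ n ≤ √n.factorial * Real.exp (x ^ 2 / 2) := by
  refine (abs_le_of_sq_le_sq' ?_ (by positivity)).2
  rw [mul_pow, Real.sq_sqrt (by positivity), ← Real.exp_nat_mul, Nat.cast_two,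
    mul_div_cancel₀ _ two_ne_zero, pow_right_comm]
  exact (div_le_iff₀' (by positivity)).1 (Real.pow_div_factorial_le_exp _ (by positivity) n)

theorem exists_exp_neg_div_le {s : ℝ} (hs : 1 < s) {δ : ℝ} (hδ : 0 < δ) :
    ∃ h₀ > 0, ∀ h : ℝ, 0 < h → h < h₀ → ∀ p : ℕ,
      Real.exp (-δ / h) ≤ (p.factorial : ℝ) ^ (s - 1 / 2) * √h ^ p := by
  set c : ℝ := (s - 1) * √(1 / δ) ^ (1 / (s - 1))
  have : 0 ≤ c := mul_nonneg (by linarith) (by positivity)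
  refine ⟨δ / (2 * (c + 1)), by positivity, fun h hh hh₀ p => ?_⟩
  have hc_le : c ≤ δ / (2 * h) := by
    rw [lt_div_iff₀ (by positivity)] at hh₀
    rw [le_div_iff₀ (by positivity)]
    linarith
  have hgevrey : √(1 / δ) ^ p ≤ Real.exp c * (p.factorial : ℝ) ^ (s - 1) :=
    pow_le_exp_mul_factorial_rpow (by positivity) (by linarith) p
  have hgauss : √(δ / h) ^ p ≤ √p.factorial * Real.exp (δ / (2 * h)) := by
    have hhalf := pow_le_sqrt_factorial_mul_exp_half_sq (√(δ / h)) p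
    rwa [Real.sq_sqrt (by positivity), div_div, mul_comm h 2] at hhalf
  have hone : √(1 / δ) ^ p * √h ^ p * √(δ / h) ^ p = 1 := by
    rw [← mul_pow, ← mul_pow, ← Real.sqrt_mul (by positivity), ← Real.sqrt_mul (by positivity),
      one_div_mul_eq_div, div_mul_div_cancel₀ hδ.ne', div_self hh.ne', Real.sqrt_one, one_pow]
  calc Real.exp (-δ / h)
      = Real.exp (-δ / h) * (√(1 / δ) ^ p * √h ^ p * √(δ / h) ^ p) := by rw [hone, mul_one]
    _ ≤ Real.exp (-δ / h) * (Real.exp (δ / (2 * h)) * (p.factorial : ℝ) ^ (s - 1) * √h ^ p *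
        (√p.factorial * Real.exp (δ / (2 * h)))) := by
        gcongr
        exact hgevrey.trans (by gcongr)
    _ = Real.exp (-δ / h + δ / (2 * h) + δ / (2 * h)) *
        ((p.factorial : ℝ) ^ (s - 1) * √p.factorial) * √h ^ p := by
        rw [Real.exp_add, Real.exp_add]
        ring
    _ = _ := by
        rw [factorial_rpow_mul_sqrt_factorial, show -δ / h + δ / (2 * h) + δ / (2 * h) = 0 by
          field_simp; ring, Real.exp_zero, one_mul]

theorem pow_le_sqrt_factorial_mul_exp {b : ℝ} (hb : 0 < b) (X : ℝ) (n : ℕ) :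
    X ^ n ≤ √n.factorial * (√b)⁻¹ ^ n * Real.exp (b * X ^ 2) := by
  have hhalf := pow_le_sqrt_factorial_mul_exp_half_sq (√b * X) n
  rw [mul_pow, mul_pow, Real.sq_sqrt hb.le] at hhalf
  calc X ^ n = (√b)⁻¹ ^ n * (√b ^ n * X ^ n) := by
        rw [← mul_assoc, ← mul_pow, inv_mul_cancel₀ (by positivity), one_pow, one_mul]
    _ ≤ (√b)⁻¹ ^ n * (√n.factorial * Real.exp (b * X ^ 2)) := by
        refine mul_le_mul_of_nonneg_left (hhalf.trans ?_) (by positivity)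
        gcongr
        exact half_le_self (by positivity)
    _ = _ := by ring

theorem norm_exp_sub_sum_le_pow_div_factorial (z : ℂ) (n : ℕ) :
    ‖Complex.exp z - ∑ m ∈ Finset.range n, z ^ m / m.factorial‖ ≤
      ‖z‖ ^ n / n.factorial * Real.exp ‖z‖ := by
  refine (Complex.norm_exp_sub_sum_le_exp_norm_sub_sum z n).trans ?_
  have hsummable := Real.summable_pow_div_factorial ‖z‖
  have hexp : Real.exp ‖z‖ = ∑' m : ℕ, ‖z‖ ^ m / m.factorial := by
    rw [Real.exp_eq_exp_ℝ, NormedSpace.exp_eq_tsum_div]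
  have htail : Real.exp ‖z‖ - ∑ m ∈ Finset.range n, ‖z‖ ^ m / m.factorial =
      ∑' m : ℕ, ‖z‖ ^ (m + n) / (m + n).factorial := by
    rw [hexp, ← hsummable.sum_add_tsum_nat_add n, add_sub_cancel_left]
  rw [htail, hexp, ← tsum_mul_left]
  refine ((summable_nat_add_iff n).2 hsummable).tsum_le_tsum (fun m => ?_) (hsummable.mul_left _)
  rw [div_mul_div_comm, ← pow_add, add_comm n m]
  gcongr
  exact_mod_cast (mul_comm _ _).trans_le
    (Nat.le_of_dvd (Nat.factorial_pos _) (Nat.factorial_mul_factorial_dvd_factorial_add m n))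

end Numeric

section Remainder

variable {f : EuclideanSpace ℝ (Fin d) → ℂ} {x₀ : EuclideanSpace ℝ (Fin d)}

theorem contDiff_quadForm_sub (A : Matrix (Fin d) (Fin d) ℂ) (x₀ : 𝔼) :
    ContDiff ℝ ∞ fun x => quadForm A (x - x₀) :=
  (contDiff_quadForm A).comp (contDiff_id.sub contDiff_const)

theorem gRem_eq (f : 𝔼 → ℂ) (x₀ x : 𝔼) :
    gRem f x₀ x = f x + -(1 / 2) * quadForm (hess f x₀) (x - x₀) := by
  simp [gRem, quadForm, sub_eq_add_neg]

theorem contDiff_gRem (hf : ContDiff ℝ ∞ f) : ContDiff ℝ ∞ (gRem f x₀) := by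
  rw [funext (gRem_eq f x₀)]
  exact hf.add (contDiff_const.mul (contDiff_quadForm_sub _ _))

theorem pderiv_comp_sub (F : 𝔼 → ℂ) (x₀ : 𝔼) (i : Fin d) :
    pderiv i (fun x => F (x - x₀)) = fun x => pderiv i F (x - x₀) := by
  funext x
  simp only [pderiv, fderiv_comp_sub]

theorem pderiv_gRem (hf : ContDiff ℝ ∞ f) (l : Fin d) :
    pderiv l (gRem f x₀) =
      fun x => pderiv l f x + -1 * ∑ i, hess f x₀ l i * ((x i - x₀ i : ℝ) : ℂ) := by
  have hquad : Differentiable ℝ fun x : 𝔼 => quadForm (hess f x₀) (x - x₀) :=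
    (contDiff_quadForm_sub _ _).differentiable (by simp)
  rw [funext (gRem_eq f x₀), pderiv_add (hf.differentiable (by simp)) (hquad.const_mul _),
    pderiv_const_mul hquad, pderiv_comp_sub,
    pderiv_quadForm (isSymm_hess (contDiff_infty.1 hf 2) x₀)]
  funext x
  simp only [PiLp.sub_apply]
  ring

theorem pderiv_pderiv_gRem (hf : ContDiff ℝ ∞ f) (k l : Fin d) :
    pderiv k (pderiv l (gRem f x₀)) = fun x => pderiv k (pderiv l f) x + -hess f x₀ l k := by
  have hcoord (i : Fin d) : Differentiable ℝ fun x : 𝔼 => ((x i - x₀ i : ℝ) : ℂ) := by fun_prop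
  have hterm (i : Fin d) : Differentiable ℝ fun x : 𝔼 =>
      hess f x₀ l i * ((x i - x₀ i : ℝ) : ℂ) := (hcoord i).const_mul _
  have hsum : Differentiable ℝ fun x : 𝔼 => ∑ i, hess f x₀ l i * ((x i - x₀ i : ℝ) : ℂ) :=
    .fun_sum fun i _ => hterm i
  rw [pderiv_gRem hf, pderiv_add ((contDiff_pderiv hf l).differentiable (by simp))
    (hsum.const_mul _), pderiv_const_mul hsum, pderiv_sum _ hterm]
  simp only [pderiv_const_mul (hcoord _), pderiv_coord_sub]
  simp

theorem wordDeriv_gRem (hf : ContDiff ℝ ∞ f) {w : List (Fin d)} (hw : 3 ≤ w.length) :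
    wordDeriv w (gRem f x₀) = wordDeriv w f := by
  match w, hw with
  | l :: k :: m :: w, _ =>
    have hdiff : Differentiable ℝ (pderiv k (pderiv l f)) :=
      (contDiff_pderiv (contDiff_pderiv hf l) k).differentiable (by simp)
    simp only [wordDeriv_cons]
    rw [pderiv_pderiv_gRem hf, pderiv_add hdiff (differentiable_const _), pderiv_const]
    simp only [add_zero]

theorem wordDeriv_gRem_eq_zero (hf : ContDiff ℝ ∞ f) (hf₀ : f x₀ = 0)
    (hf'₀ : fderiv ℝ f x₀ = 0) {w : List (Fin d)} (hw : w.length < 3) :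
    wordDeriv w (gRem f x₀) x₀ = 0 := by
  match w, hw with
  | [], _ => simp [gRem_eq, hf₀, quadForm]
  | [l], _ =>
    simp only [wordDeriv_cons, wordDeriv_nil, pderiv_gRem hf]
    simp [pderiv, hf'₀]
  | [l, k], _ =>
    simp only [wordDeriv_cons, wordDeriv_nil, pderiv_pderiv_gRem hf]
    rw [(isSymm_hess (contDiff_infty.1 hf 2) x₀).apply k l]
    simp [hess]

theorem taylorTerm_gRem_eq_zero (hf : ContDiff ℝ ∞ f) (hf₀ : f x₀ = 0)
    (hf'₀ : fderiv ℝ f x₀ = 0) {n : ℕ} (hn : n < 3) (x : 𝔼) :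
    taylorTerm x₀ n (gRem f x₀) x = 0 := by
  simpa using norm_taylorTerm_le x₀ n (gRem f x₀) le_rfl
    (fun w hw => by rw [wordDeriv_gRem_eq_zero hf hf₀ hf'₀ (hw ▸ hn), norm_zero]) x

end Remainder

section DerivativeBounds

open PowerSeries

/-- The derivatives of `F` at `x₀` along words of length `n` are bounded by `n! αₙ`. Such bounds
multiply like the majorants `α = ∑ αₙ Xⁿ`, by the Leibniz rule. -/
def WordBound (x₀ : 𝔼) (F : 𝔼 → ℂ) (α : ℝ⟦X⟧) : Prop :=
  ∀ w : List (Fin d), ‖wordDeriv w F x₀‖ ≤ w.length.factorial * coeff w.length α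

variable {x₀ : EuclideanSpace ℝ (Fin d)}

theorem factorial_succ_mul_coeff_succ {R : Type*} [CommSemiring R] (α : R⟦X⟧) (n : ℕ) :
    ((n + 1).factorial : R) * coeff (n + 1) α = n.factorial * coeff n (d⁄dX R α) := by
  rw [coeff_derivative, Nat.factorial_succ]
  push_cast
  ring

theorem WordBound.pderiv {F : 𝔼 → ℂ} {α : ℝ⟦X⟧} (hF : WordBound x₀ F α) (i : Fin d) :
    WordBound x₀ (pderiv i F) (d⁄dX ℝ α) := fun w =>
  (hF (i :: w)).trans_eq (factorial_succ_mul_coeff_succ α w.length)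

theorem WordBound.mul {F G : 𝔼 → ℂ} {α β : ℝ⟦X⟧} (hF : ContDiff ℝ ∞ F) (hG : ContDiff ℝ ∞ G)
    (hFα : WordBound x₀ F α) (hGβ : WordBound x₀ G β) :
    WordBound x₀ (fun x => F x * G x) (α * β) := by
  intro w
  induction w generalizing F G α β with
  | nil =>
    have hF₀ : ‖F x₀‖ ≤ coeff 0 α := by simpa using hFα []
    have hG₀ : ‖G x₀‖ ≤ coeff 0 β := by simpa using hGβ []
    simpa [coeff_mul] using mul_le_mul hF₀ hG₀ (norm_nonneg _) ((norm_nonneg _).trans hF₀)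
  | cons i w ih =>
    have hFi := contDiff_pderiv hF i
    have hGi := contDiff_pderiv hG i
    rw [wordDeriv_cons, pderiv_mul (hF.differentiable (by simp)) (hG.differentiable (by simp)),
      wordDeriv_add (hFi.mul hG) (hF.mul hGi), List.length_cons, factorial_succ_mul_coeff_succ]
    calc _ ≤ w.length.factorial * coeff w.length (d⁄dX ℝ α * β) +
          w.length.factorial * coeff w.length (α * d⁄dX ℝ β) :=
          (norm_add_le _ _).trans
            (add_le_add (ih hFi hG (hFα.pderiv i) hGβ) (ih hF hGi hFα (hGβ.pderiv i)))
      _ = _ := by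
          rw [Derivation.leibniz, smul_eq_mul, smul_eq_mul, ← mul_add, ← map_add, add_comm,
            mul_comm β]

theorem WordBound.pow_mul {F G : 𝔼 → ℂ} {α β : ℝ⟦X⟧} (hF : ContDiff ℝ ∞ F) (hG : ContDiff ℝ ∞ G)
    (hFα : WordBound x₀ F α) (hGβ : WordBound x₀ G β) (μ : ℕ) :
    WordBound x₀ (fun x => F x ^ μ * G x) (α ^ μ * β) := by
  induction μ with
  | zero => simpa using hGβ
  | succ μ ih =>
    simpa only [pow_succ', mul_assoc] using hFα.mul hF ((hF.pow μ).mul hG) ih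

theorem wordDeriv_quadOp {F : 𝔼 → ℂ} (hF : ContDiff ℝ ∞ F) (B : Matrix (Fin d) (Fin d) ℂ)
    (w : List (Fin d)) :
    wordDeriv w (quadOp B F) = fun x => ∑ i, ∑ j, B i j * wordDeriv (j :: i :: w) F x := by
  have hpderiv (i j : Fin d) : ContDiff ℝ ∞ (pderiv i (pderiv j F)) :=
    contDiff_pderiv (contDiff_pderiv hF j) i
  have hterm (i j : Fin d) : ContDiff ℝ ∞ fun x => B i j * pderiv i (pderiv j F) x :=
    contDiff_const.mul (hpderiv i j)
  have hrow (i : Fin d) : ContDiff ℝ ∞ fun x => ∑ j, B i j * pderiv i (pderiv j F) x :=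
    .sum fun j _ => hterm i j
  unfold quadOp
  rw [wordDeriv_sum _ hrow]
  simp only [wordDeriv_sum _ (hterm _), wordDeriv_const_mul (hpderiv _ _), wordDeriv_cons]

theorem norm_quadOp_iterate_le {B : Matrix (Fin d) (Fin d) ℂ} {c₀ M : ℝ} (hc₀ : 0 ≤ c₀)
    (hM : 0 ≤ M) (hB : ∀ i j, ‖B i j‖ ≤ c₀) (ν : ℕ) {F : 𝔼 → ℂ} (hF : ContDiff ℝ ∞ F)
    (hFM : ∀ w : List (Fin d), w.length = 2 * ν → ‖wordDeriv w F x₀‖ ≤ M) :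
    ‖(quadOp B)^[ν] F x₀‖ ≤ (d ^ 2 * c₀) ^ ν * M := by
  induction ν generalizing F M with
  | zero => simpa using hFM [] rfl
  | succ ν ih =>
    rw [Function.iterate_succ_apply, pow_succ, mul_assoc]
    refine ih (by positivity) (contDiff_quadOp hF B) fun w hw => ?_
    rw [wordDeriv_quadOp hF]
    calc _ ≤ ∑ _i : Fin d, ∑ _j : Fin d, c₀ * M :=
          norm_sum_le_of_le _ fun i _ => norm_sum_le_of_le _ fun j _ => by
            rw [norm_mul]
            exact mul_le_mul (hB i j) (hFM _ (by simp [hw]; ring)) (norm_nonneg _) hc₀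
      _ = _ := by simp; ring

end DerivativeBounds

section Coefficients

open PowerSeries

/-- Bounds of the Taylor remainder of `f` of order three in terms of the Gevrey bounds `Af`, `Cf` of
`f`: the coefficients of order `n + 3` of an `(Af, Cf)`-Gevrey series are those of order `n` of a
`(cubicAmp s Af Cf, cubicScale s 0 Cf)`-Gevrey series. -/
def cubicAmp (s Af Cf : ℝ) : ℝ := Af * Cf ^ 3 * 48 ^ (s - 1)

/-- A common Gevrey scale for the amplitude `u` and for the shifted series described at
`cubicAmp`. -/
def cubicScale (s Cu Cf : ℝ) : ℝ := Cu + Cf * 2 ^ (s - 1)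

theorem cubicAmp_nonneg {Af Cf : ℝ} (hAf : 0 ≤ Af) (hCf : 0 ≤ Cf) (s : ℝ) :
    0 ≤ cubicAmp s Af Cf := by
  unfold cubicAmp
  positivity

theorem cubicScale_nonneg {Cu Cf : ℝ} (hCu : 0 ≤ Cu) (hCf : 0 ≤ Cf) (s : ℝ) :
    0 ≤ cubicScale s Cu Cf := by
  unfold cubicScale
  positivity

theorem le_two_mul_cubicScale {Cu Cf : ℝ} (hCu : 0 ≤ Cu) (hCf : 0 ≤ Cf) (s : ℝ) :
    Cu ≤ 2 * cubicScale s Cu Cf := by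
  have : 0 ≤ Cf * 2 ^ (s - 1) := by positivity
  unfold cubicScale
  linarith

theorem mul_rpow_le_cubicScale {Cu : ℝ} (hCu : 0 ≤ Cu) (s Cf : ℝ) :
    Cf * 2 ^ (s - 1) ≤ cubicScale s Cu Cf :=
  le_add_of_nonneg_left hCu

theorem factorial_add_three_rpow_le {σ : ℝ} (hσ : 0 ≤ σ) (n : ℕ) :
    ((n + 3).factorial : ℝ) ^ σ ≤ 48 ^ σ * ((2 ^ σ) ^ n * (n.factorial : ℝ) ^ σ) := by
  have hfactorial : ((n + 3).factorial : ℝ) ≤ 48 * (2 ^ n * n.factorial) := by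
    calc ((n + 3).factorial : ℝ) ≤ 2 ^ (n + 3) * (n.factorial * Nat.factorial 3) := by
          exact_mod_cast factorial_add_le n 3
      _ = 48 * (2 ^ n * n.factorial) := by
          rw [pow_add, show Nat.factorial 3 = 6 from rfl]
          push_cast
          ring
  refine (Real.rpow_le_rpow (by positivity) hfactorial hσ).trans_eq ?_
  rw [Real.mul_rpow (by positivity) (by positivity), Real.mul_rpow (by positivity) (by positivity),
    Real.rpow_pow_comm (by norm_num)]

theorem gevrey_add_three_le {s A C Y : ℝ} (hs : 1 ≤ s) (hA : 0 ≤ A) (hC : 0 ≤ C)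
    (hCY : C * 2 ^ (s - 1) ≤ Y) (n : ℕ) :
    A * C ^ (n + 3) * ((n + 3).factorial : ℝ) ^ (s - 1) ≤
      cubicAmp s A C * (Y ^ n * (n.factorial : ℝ) ^ (s - 1)) := by
  calc A * C ^ (n + 3) * ((n + 3).factorial : ℝ) ^ (s - 1)
      ≤ A * C ^ (n + 3) * (48 ^ (s - 1) * ((2 ^ (s - 1)) ^ n * (n.factorial : ℝ) ^ (s - 1))) := by
        gcongr
        exact factorial_add_three_rpow_le (by linarith) n
    _ = A * C ^ 3 * 48 ^ (s - 1) * ((C * 2 ^ (s - 1)) ^ n * (n.factorial : ℝ) ^ (s - 1)) := by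
        rw [mul_pow]; ring
    _ ≤ A * C ^ 3 * 48 ^ (s - 1) * (Y ^ n * (n.factorial : ℝ) ^ (s - 1)) := by gcongr

theorem factorial_rpow_eq_mul_rpow_sub_one (s : ℝ) (n : ℕ) :
    (n.factorial : ℝ) ^ s = n.factorial * (n.factorial : ℝ) ^ (s - 1) := by
  conv_lhs => rw [← add_sub_cancel 1 s, Real.rpow_add (by positivity), Real.rpow_one]

/-- The standing assumptions at a critical point: the phase `f` and the amplitude `u` are smooth,
`f` vanishes to second order at `x₀`, and `u ∈ B_s(Au, Cu; V)`, `f ∈ B_s(Af, Cf; V)`. -/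
structure CriticalData (s Au Cu Af Cf : ℝ) (V : Set 𝔼) (x₀ : 𝔼) (f u : 𝔼 → ℂ) : Prop where
  one_le_order : 1 ≤ s
  Au_nonneg : 0 ≤ Au
  Cu_nonneg : 0 ≤ Cu
  Af_nonneg : 0 ≤ Af
  Cf_nonneg : 0 ≤ Cf
  contDiff_phase : ContDiff ℝ ∞ f
  contDiff_amplitude : ContDiff ℝ ∞ u
  phase_eq_zero : f x₀ = 0
  fderiv_phase_eq_zero : fderiv ℝ f x₀ = 0
  phase_bound : GevreyBoundOn s Af Cf V f
  amplitude_bound : GevreyBoundOn s Au Cu V u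

variable {s Au Cu Af Cf : ℝ} {f u : EuclideanSpace ℝ (Fin d) → ℂ}
  {V : Set (EuclideanSpace ℝ (Fin d))} {x₀ : EuclideanSpace ℝ (Fin d)}

theorem CriticalData.mono (hD : CriticalData s Au Cu Af Cf V x₀ f u) {V' : Set 𝔼} (hV : V' ⊆ V) :
    CriticalData s Au Cu Af Cf V' x₀ f u :=
  { hD with
    phase_bound := fun α x hx => hD.phase_bound α x (hV hx)
    amplitude_bound := fun α x hx => hD.amplitude_bound α x (hV hx) }

/-- The power series `∑ A Yⁿ n!^σ Xⁿ`, the majorant of Gevrey bounds. -/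
def gevreySeries (σ Y A : ℝ) : ℝ⟦X⟧ := PowerSeries.mk fun n => A * (Y ^ n * (n.factorial : ℝ) ^ σ)

theorem gevreyCoeff_gevreySeries {Y A : ℝ} (hY : 0 ≤ Y) (hA : 0 ≤ A) (σ : ℝ) :
    GevreyCoeff σ Y A (gevreySeries σ Y A) := fun N => by
  rw [gevreySeries, coeff_mk, Real.norm_of_nonneg (by positivity)]

theorem CriticalData.wordBound_amplitude (hD : CriticalData s Au Cu Af Cf {x₀} x₀ f u) {Y : ℝ}
    (hY : Cu ≤ Y) : WordBound x₀ u (gevreySeries (s - 1) Y Au) := fun w => by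
  have hAu := hD.Au_nonneg
  have hCu := hD.Cu_nonneg
  calc ‖wordDeriv w u x₀‖ ≤ Au * Cu ^ w.length * (w.length.factorial : ℝ) ^ s :=
        hD.amplitude_bound.norm_wordDeriv_le (zero_le_one.trans hD.one_le_order) hAu hCu
          hD.contDiff_amplitude w rfl
    _ = w.length.factorial * (Au * (Cu ^ w.length * (w.length.factorial : ℝ) ^ (s - 1))) := by
        rw [factorial_rpow_eq_mul_rpow_sub_one]
        ring
    _ ≤ w.length.factorial * (Au * (Y ^ w.length * (w.length.factorial : ℝ) ^ (s - 1))) := by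
        gcongr
    _ = _ := by rw [gevreySeries, coeff_mk]

theorem CriticalData.wordBound_gRem (hD : CriticalData s Au Cu Af Cf {x₀} x₀ f u) {Y : ℝ}
    (hY : Cf * 2 ^ (s - 1) ≤ Y) :
    WordBound x₀ (gRem f x₀) (X ^ 3 * gevreySeries (s - 1) Y (cubicAmp s Af Cf)) := by
  intro w
  rw [coeff_X_pow_mul']
  split_ifs with hw
  · rw [wordDeriv_gRem hD.contDiff_phase hw]
    refine (hD.phase_bound.norm_wordDeriv_le (zero_le_one.trans hD.one_le_order) hD.Af_nonneg
      hD.Cf_nonneg hD.contDiff_phase w rfl).trans ?_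
    obtain ⟨n, hn⟩ := Nat.exists_eq_add_of_le' hw
    rw [hn, gevreySeries, coeff_mk, factorial_rpow_eq_mul_rpow_sub_one, Nat.add_sub_cancel]
    calc _ = ((n + 3).factorial : ℝ) *
          (Af * Cf ^ (n + 3) * ((n + 3).factorial : ℝ) ^ (s - 1)) := by ring
      _ ≤ _ := mul_le_mul_of_nonneg_left
          (gevrey_add_three_le hD.one_le_order hD.Af_nonneg hD.Cf_nonneg hY n) (by positivity)
  · rw [wordDeriv_gRem_eq_zero hD.contDiff_phase hD.phase_eq_zero hD.fderiv_phase_eq_zero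
      (not_le.1 hw)]
    simp

theorem CriticalData.norm_wordDeriv_gRem_pow_mul_le
    (hD : CriticalData s Au Cu Af Cf {x₀} x₀ f u) {μ l : ℕ} {w : List (Fin d)}
    (hw : w.length = 3 * μ + l) :
    ‖wordDeriv w (fun x => gRem f x₀ x ^ μ * u x) x₀‖ ≤
      (3 * μ + l).factorial * (Au * (2 * cubicAmp s Af Cf) ^ μ *
        ((2 * cubicScale s Cu Cf) ^ l * (l.factorial : ℝ) ^ (s - 1))) := by
  have hamp : 0 ≤ cubicAmp s Af Cf := cubicAmp_nonneg hD.Af_nonneg hD.Cf_nonneg s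
  have hscale : 0 ≤ cubicScale s Cu Cf := cubicScale_nonneg hD.Cu_nonneg hD.Cf_nonneg s
  have hgRem := hD.wordBound_gRem (mul_rpow_le_cubicScale hD.Cu_nonneg s Cf)
  have hamplitude :=
    hD.wordBound_amplitude (le_two_mul_cubicScale hD.Cu_nonneg hD.Cf_nonneg s)
  have hcoeff := (gevreyCoeff_gevreySeries hscale hamp (s - 1)).pow_mul
    (sub_nonneg.2 hD.one_le_order) hscale hamp hD.Au_nonneg
    (gevreyCoeff_gevreySeries (mul_nonneg zero_le_two hscale) hD.Au_nonneg (s - 1)) μ l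
  refine (hgRem.pow_mul (contDiff_gRem hD.contDiff_phase) hD.contDiff_amplitude
    hamplitude μ w).trans ?_
  rw [hw, mul_pow, ← pow_mul, mul_assoc (X ^ (3 * μ)), coeff_X_pow_mul', if_pos (by omega),
    Nat.add_sub_cancel_left]
  exact mul_le_mul_of_nonneg_left ((le_abs_self _).trans hcoeff) (by positivity)

theorem factorial_two_mul_le_mul_sqrt (n : ℕ) :
    ((2 * n).factorial : ℝ) ≤ 2 ^ n * n.factorial * √((2 * n).factorial) := by
  have hsqrt : √((2 * n).factorial : ℝ) ≤ 2 ^ n * n.factorial := by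
    refine Real.sqrt_le_iff.2 ⟨by positivity, ?_⟩
    calc ((2 * n).factorial : ℝ) ≤ 2 ^ (n + n) * (n.factorial * n.factorial) := by
          rw [two_mul]
          exact_mod_cast factorial_add_le n n
      _ = (2 ^ n * n.factorial) ^ 2 := by ring
  calc ((2 * n).factorial : ℝ) = √((2 * n).factorial) * √((2 * n).factorial) :=
        (Real.mul_self_sqrt (by positivity)).symm
    _ ≤ _ := by gcongr

theorem pow_le_one_add_pow {a : ℝ} (ha : 0 ≤ a) {m n : ℕ} (hmn : m ≤ n) : a ^ m ≤ (1 + a) ^ n :=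
  (pow_le_pow_left₀ ha (by linarith) m).trans (pow_le_pow_right₀ (by linarith) hmn)

/-- The constant `C` in the bound of the coefficients `L_j u`. -/
def coefficientConst (d : ℕ) (s Cu Af Cf c₀ : ℝ) : ℝ :=
  4 * ((1 + d ^ 2 * c₀) ^ 3 * (1 + 2 * cubicAmp s Af Cf) ^ 2 * (1 + 2 * cubicScale s Cu Cf) ^ 2) *
    256 * 4 ^ s

theorem coefficientConst_pos {c₀ : ℝ} (hCu : 0 ≤ Cu) (hAf : 0 ≤ Af) (hCf : 0 ≤ Cf)
    (hc₀ : 0 ≤ c₀) (d : ℕ) (s : ℝ) : 0 < coefficientConst d s Cu Af Cf c₀ := by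
  have := cubicAmp_nonneg hAf hCf s
  have := cubicScale_nonneg hCu hCf s
  unfold coefficientConst
  positivity

theorem CriticalData.norm_Lop_summand_le (hD : CriticalData s Au Cu Af Cf {x₀} x₀ f u) {c₀ : ℝ}
    (hc₀ : 0 ≤ c₀) (hhess : ∀ i j, ‖(hess f x₀)⁻¹ i j‖ ≤ c₀) {j μ : ℕ} (hμ : μ ≤ 2 * j) :
    ‖Complex.I ^ (μ + (j + μ)) /
        ((2 : ℂ) ^ (j + μ) * (μ.factorial : ℂ) * ((j + μ).factorial : ℂ)) *
      (quadOp (hess f x₀)⁻¹)^[j + μ] (fun x => gRem f x₀ x ^ μ * u x) x₀‖ ≤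
      Au * ((1 + d ^ 2 * c₀) ^ (3 * j) * (1 + 2 * cubicAmp s Af Cf) ^ (2 * j) *
        (1 + 2 * cubicScale s Cu Cf) ^ (2 * j) *
        (16 ^ (2 * j) * ((2 * j).factorial : ℝ) ^ (s - 1 / 2))) := by
  have hAu := hD.Au_nonneg
  set B : ℝ := cubicAmp s Af Cf
  set Y : ℝ := cubicScale s Cu Cf
  have hB : 0 ≤ B := cubicAmp_nonneg hD.Af_nonneg hD.Cf_nonneg s
  have hY : 0 ≤ Y := cubicScale_nonneg hD.Cu_nonneg hD.Cf_nonneg s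
  obtain ⟨l, hl⟩ := Nat.exists_eq_add_of_le hμ
  have hν : 2 * (j + μ) = 3 * μ + l := by omega
  have hquadOp := norm_quadOp_iterate_le hc₀ (by positivity) hhess (j + μ)
    (((contDiff_gRem hD.contDiff_phase).pow μ).mul hD.contDiff_amplitude)
    fun w hw => hD.norm_wordDeriv_gRem_pow_mul_le (hw.trans hν)
  have hfactorial := factorial_two_mul_le_mul_sqrt (j + μ)
  rw [hν] at hfactorial
  rw [norm_mul, norm_div, norm_pow, Complex.norm_I, one_pow, norm_mul, norm_mul, norm_pow,
    Complex.norm_natCast, Complex.norm_natCast, Complex.norm_ofNat]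
  calc _ ≤ 1 / (2 ^ (j + μ) * μ.factorial * (j + μ).factorial) * ((d ^ 2 * c₀) ^ (j + μ) *
        ((2 ^ (j + μ) * (j + μ).factorial * √((3 * μ + l).factorial)) *
          (Au * (2 * B) ^ μ * ((2 * Y) ^ l * (l.factorial : ℝ) ^ (s - 1))))) := by
        gcongr
        exact hquadOp.trans (by gcongr)
    _ = Au * ((d ^ 2 * c₀) ^ (j + μ) * (2 * B) ^ μ * (2 * Y) ^ l *
        ((l.factorial : ℝ) ^ (s - 1) * √((3 * μ + l).factorial) / μ.factorial)) := by
        field_simp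
    _ ≤ Au * ((1 + d ^ 2 * c₀) ^ (3 * j) * (1 + 2 * B) ^ (2 * j) * (1 + 2 * Y) ^ (2 * j) *
        (16 ^ (μ + l) * ((μ + l).factorial : ℝ) ^ (s - 1 / 2))) := by
        gcongr Au * (?_ * ?_ * ?_ * ?_)
        · exact pow_le_one_add_pow (by positivity) (by omega)
        · exact pow_le_one_add_pow (by positivity) (by omega)
        · exact pow_le_one_add_pow (by positivity) (by omega)
        · exact factorial_rpow_mul_sqrt_factorial_div_le hD.one_le_order μ l
    _ = _ := by rw [← hl]

theorem CriticalData.norm_Lop_le (hD : CriticalData s Au Cu Af Cf {x₀} x₀ f u) {c₀ : ℝ}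
    (hc₀ : 0 ≤ c₀) (hhess : ∀ i j, ‖(hess f x₀)⁻¹ i j‖ ≤ c₀) (j : ℕ) :
    ‖Lop f x₀ j u‖ ≤
      Au * coefficientConst d s Cu Af Cf c₀ ^ j * (j.factorial : ℝ) ^ (2 * s - 1) := by
  have hAu := hD.Au_nonneg
  have hB : 0 ≤ cubicAmp s Af Cf := cubicAmp_nonneg hD.Af_nonneg hD.Cf_nonneg s
  have hY : 0 ≤ cubicScale s Cu Cf := cubicScale_nonneg hD.Cu_nonneg hD.Cf_nonneg s
  set Γ : ℝ := (1 + d ^ 2 * c₀) ^ (3 * j) * (1 + 2 * cubicAmp s Af Cf) ^ (2 * j) *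
    (1 + 2 * cubicScale s Cu Cf) ^ (2 * j)
  have hcount : ((2 * j + 1 : ℕ) : ℝ) ≤ 4 ^ j := by
    have hbernoulli := one_add_mul_le_pow (show (-2 : ℝ) ≤ 3 by norm_num) j
    norm_num at hbernoulli
    push_cast
    linarith [Nat.cast_nonneg (α := ℝ) j]
  calc ‖Lop f x₀ j u‖
      ≤ ∑ _μ ∈ Finset.range (2 * j + 1),
          Au * (Γ * (16 ^ (2 * j) * ((2 * j).factorial : ℝ) ^ (s - 1 / 2))) :=
        norm_sum_le_of_le _ fun μ hμ => hD.norm_Lop_summand_le hc₀ hhess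
          (Nat.lt_succ_iff.1 (Finset.mem_range.1 hμ))
    _ = ((2 * j + 1 : ℕ) : ℝ) *
          (Au * (Γ * (16 ^ (2 * j) * ((2 * j).factorial : ℝ) ^ (s - 1 / 2)))) := by
        rw [Finset.sum_const, Finset.card_range, nsmul_eq_mul]
    _ ≤ 4 ^ j *
          (Au * (Γ * (16 ^ (2 * j) * ((4 ^ s) ^ j * (j.factorial : ℝ) ^ (2 * s - 1))))) := by
        gcongr
        exact factorial_two_mul_rpow_le hD.one_le_order j
    _ = _ := by
        rw [coefficientConst, show (256 : ℝ) = 16 ^ 2 by norm_num]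
        simp only [Γ, mul_pow, ← pow_mul]
        ring

end Coefficients

section Pointwise

open PowerSeries

variable {s : ℝ} {f u : EuclideanSpace ℝ (Fin d) → ℂ} {x₀ : EuclideanSpace ℝ (Fin d)}
  {V : Set (EuclideanSpace ℝ (Fin d))}

theorem gevreyBound_mul_pow_div_factorial (s A C T : ℝ) (n : ℕ) :
    A * C ^ n * (n.factorial : ℝ) ^ s * T ^ n / n.factorial =
      A * (C * T) ^ n * (n.factorial : ℝ) ^ (s - 1) := by
  rw [factorial_rpow_eq_mul_rpow_sub_one, mul_pow]
  field_simp

theorem norm_taylorTerm_le_of_gevrey {A C : ℝ} (hA : 0 ≤ A) (hC : 0 ≤ C) (n : ℕ)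
    (hu : ∀ w : List (Fin d), w.length = n →
      ‖wordDeriv w u x₀‖ ≤ A * C ^ n * (n.factorial : ℝ) ^ s) (x : 𝔼) :
    ‖taylorTerm x₀ n u x‖ ≤ A * (C * (d * ‖x‖)) ^ n * (n.factorial : ℝ) ^ (s - 1) := by
  rw [← gevreyBound_mul_pow_div_factorial]
  exact norm_taylorTerm_le x₀ n u (by positivity) hu x

theorem norm_sub_sum_taylorTerm_le_of_gevrey {A C : ℝ} (hA : 0 ≤ A) (hC : 0 ≤ C) (N : ℕ)
    (hu : ContDiff ℝ ∞ u) (x : 𝔼)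
    (hu_bound : ∀ w : List (Fin d), w.length = N → ∀ t ∈ Set.Icc (0 : ℝ) 1,
      ‖wordDeriv w u (x₀ + t • x)‖ ≤ A * C ^ N * (N.factorial : ℝ) ^ s) :
    ‖u (x₀ + x) - ∑ n ∈ Finset.range N, taylorTerm x₀ n u x‖ ≤
      A * (C * (d * ‖x‖)) ^ N * (N.factorial : ℝ) ^ (s - 1) := by
  rw [← gevreyBound_mul_pow_div_factorial]
  simpa using norm_sub_sum_taylorTerm_le x₀ N hu (by positivity) x hu_bound (t := 1) (by simp)

/-- The Taylor series of the cubic remainder of `f` along a ray, divided by `X ^ 3`. -/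
def remSeries (f : 𝔼 → ℂ) (x₀ x : 𝔼) : ℂ⟦X⟧ :=
  PowerSeries.mk fun n => taylorTerm x₀ (n + 3) (gRem f x₀) x

theorem taylorSeries_gRem (hf : ContDiff ℝ ∞ f) (hf₀ : f x₀ = 0) (hf'₀ : fderiv ℝ f x₀ = 0)
    (x : 𝔼) : taylorSeries x₀ (gRem f x₀) x = X ^ 3 * remSeries f x₀ x := by
  ext n
  rw [coeff_taylorSeries, coeff_X_pow_mul']
  split_ifs with hn
  · rw [remSeries, coeff_mk, Nat.sub_add_cancel hn]
  · exact taylorTerm_gRem_eq_zero hf hf₀ hf'₀ (not_le.1 hn) x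

theorem taylorSeries_gRem_pow_mul (hf : ContDiff ℝ ∞ f) (hu : ContDiff ℝ ∞ u) (hf₀ : f x₀ = 0)
    (hf'₀ : fderiv ℝ f x₀ = 0) (μ : ℕ) (x : 𝔼) :
    taylorSeries x₀ (fun y => gRem f x₀ y ^ μ * u y) x =
      X ^ (3 * μ) * (remSeries f x₀ x ^ μ * taylorSeries x₀ u x) := by
  rw [taylorSeries_pow_mul x₀ (contDiff_gRem hf) hu, taylorSeries_gRem hf hf₀ hf'₀, mul_pow,
    pow_mul, mul_assoc]

theorem gevreyCoeff_taylorSeries {A C Y : ℝ} (hs : 1 ≤ s) (hA : 0 ≤ A) (hC : 0 ≤ C)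
    (hu : ContDiff ℝ ∞ u) (hu_bound : GevreyBoundOn s A C {x₀} u) (x : 𝔼)
    (hY : C * (d * ‖x‖) ≤ Y) : GevreyCoeff (s - 1) Y A (taylorSeries x₀ u x) := by
  intro N
  rw [coeff_taylorSeries]
  refine (norm_taylorTerm_le_of_gevrey (s := s) hA hC N (fun w hw => ?_) x).trans ?_
  · simpa [hw] using hu_bound.norm_wordDeriv_le (by linarith) hA hC hu w rfl
  · rw [mul_assoc]
    gcongr

theorem gevreyCoeff_remSeries {A C Y : ℝ} (hs : 1 ≤ s) (hA : 0 ≤ A) (hC : 0 ≤ C)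
    (hf : ContDiff ℝ ∞ f) (hf_bound : GevreyBoundOn s A C {x₀} f) (x : 𝔼)
    (hY : C * (d * ‖x‖) * 2 ^ (s - 1) ≤ Y) :
    GevreyCoeff (s - 1) Y (cubicAmp s A (C * (d * ‖x‖))) (remSeries f x₀ x) := by
  intro N
  rw [remSeries, coeff_mk]
  refine (norm_taylorTerm_le_of_gevrey (s := s) hA hC (N + 3) (fun w hw => ?_) x).trans
    (gevrey_add_three_le hs hA (by positivity) hY N)
  rw [wordDeriv_gRem hf (by omega)]
  simpa [hw] using hf_bound.norm_wordDeriv_le (by linarith) hA hC hf w rfl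

theorem hasGevreyExpansion_taylorSeries {A C Y : ℝ} (hs : 1 ≤ s) (hA : 0 ≤ A) (hC : 0 ≤ C)
    (hu : ContDiff ℝ ∞ u) (hu_bound : GevreyBoundOn s A C V u) (x : 𝔼)
    (hV : ∀ t ∈ Set.Icc (0 : ℝ) 1, x₀ + t • x ∈ V) (hY : C * (d * ‖x‖) ≤ Y) :
    HasGevreyExpansion (s - 1) Y A (u (x₀ + x)) (taylorSeries x₀ u x) := by
  have hx₀ : x₀ ∈ V := by simpa using hV 0 (by simp)
  refine ⟨gevreyCoeff_taylorSeries hs hA hC hu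
    (fun α y hy => hu_bound α y (Set.mem_singleton_iff.1 hy ▸ hx₀)) x hY, fun N => ?_⟩
  simp only [coeff_taylorSeries]
  refine (norm_sub_sum_taylorTerm_le_of_gevrey (s := s) hA hC N hu x fun w hw t ht => ?_).trans ?_
  · simpa [hw] using hu_bound.norm_wordDeriv_le (by linarith) hA hC hu w (hV t ht)
  · rw [mul_assoc]
    gcongr

theorem sum_range_coeff_remSeries (hf : ContDiff ℝ ∞ f) (hf₀ : f x₀ = 0)
    (hf'₀ : fderiv ℝ f x₀ = 0) (N : ℕ) (x : 𝔼) :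
    ∑ n ∈ Finset.range N, coeff n (remSeries f x₀ x) =
      ∑ n ∈ Finset.range (N + 3), taylorTerm x₀ n (gRem f x₀) x := by
  rw [add_comm N 3, Finset.sum_range_add, Finset.sum_eq_zero fun n hn =>
    taylorTerm_gRem_eq_zero hf hf₀ hf'₀ (Finset.mem_range.1 hn) x, zero_add]
  simp only [remSeries, coeff_mk, add_comm]

theorem hasGevreyExpansion_remSeries {A C Y : ℝ} (hs : 1 ≤ s) (hA : 0 ≤ A) (hC : 0 ≤ C)
    (hf : ContDiff ℝ ∞ f) (hf₀ : f x₀ = 0) (hf'₀ : fderiv ℝ f x₀ = 0)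
    (hf_bound : GevreyBoundOn s A C V f) (x : 𝔼)
    (hV : ∀ t ∈ Set.Icc (0 : ℝ) 1, x₀ + t • x ∈ V) (hY : C * (d * ‖x‖) * 2 ^ (s - 1) ≤ Y) :
    HasGevreyExpansion (s - 1) Y (cubicAmp s A (C * (d * ‖x‖))) (gRem f x₀ (x₀ + x))
      (remSeries f x₀ x) := by
  have hx₀ : x₀ ∈ V := by simpa using hV 0 (by simp)
  refine ⟨gevreyCoeff_remSeries hs hA hC hf
    (fun α y hy => hf_bound α y (Set.mem_singleton_iff.1 hy ▸ hx₀)) x hY, fun N => ?_⟩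
  rw [sum_range_coeff_remSeries hf hf₀ hf'₀]
  refine (norm_sub_sum_taylorTerm_le_of_gevrey (s := s) hA hC (N + 3) (contDiff_gRem hf) x
    fun w hw t ht => ?_).trans (gevrey_add_three_le hs hA (by positivity) hY N)
  rw [wordDeriv_gRem hf (by omega)]
  simpa [hw] using hf_bound.norm_wordDeriv_le (by linarith) hA hC hf w (hV t ht)

/-- The Gevrey size, at distance `T` from `x₀`, of the term of order `3μ + l` in the expansion of
`g^μ u`, where `A`, `b` and `y` are the constants of `u`, of the cubic remainder and of their common
scale. -/
def termSize (s A b y : ℝ) (μ l : ℕ) (T : ℝ) : ℝ :=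
  A * (2 * b) ^ μ * ((2 * y) ^ l * (l.factorial : ℝ) ^ (s - 1)) * T ^ (3 * μ + l)

variable {Au Cu Af Cf : ℝ}

theorem termSize_cubicAmp_cubicScale (s Au Cu Af Cf r T : ℝ) (μ l : ℕ) :
    termSize s Au (cubicAmp s Af (Cf * r)) (cubicScale s (Cu * r) (Cf * r)) μ l T =
      Au * (2 * cubicAmp s Af (Cf * (r * T))) ^ μ *
        ((2 * cubicScale s (Cu * (r * T)) (Cf * (r * T))) ^ l * (l.factorial : ℝ) ^ (s - 1)) := by
  have hscale : cubicScale s (Cu * (r * T)) (Cf * (r * T)) =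
      cubicScale s (Cu * r) (Cf * r) * T := by
    unfold cubicScale
    ring
  have hamp : cubicAmp s Af (Cf * (r * T)) = cubicAmp s Af (Cf * r) * T ^ 3 := by
    unfold cubicAmp
    ring
  rw [hscale, hamp, termSize, pow_add, pow_mul]
  simp only [mul_pow]
  ring

theorem CriticalData.gevreyCoeff_remSeries_pow_mul
    (hD : CriticalData s Au Cu Af Cf {x₀} x₀ f u) (μ : ℕ) (x : 𝔼) :
    GevreyCoeff (s - 1) (2 * cubicScale s (Cu * (d * ‖x‖)) (Cf * (d * ‖x‖)))
      (Au * (2 * cubicAmp s Af (Cf * (d * ‖x‖))) ^ μ)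
      (remSeries f x₀ x ^ μ * taylorSeries x₀ u x) := by
  have hT : 0 ≤ d * ‖x‖ := by positivity
  have hCu := mul_nonneg hD.Cu_nonneg hT
  have hCf := mul_nonneg hD.Cf_nonneg hT
  exact (gevreyCoeff_remSeries hD.one_le_order hD.Af_nonneg hD.Cf_nonneg hD.contDiff_phase
      hD.phase_bound x (mul_rpow_le_cubicScale hCu s _)).pow_mul (sub_nonneg.2 hD.one_le_order)
    (cubicScale_nonneg hCu hCf s) (cubicAmp_nonneg hD.Af_nonneg hCf s) hD.Au_nonneg
    (gevreyCoeff_taylorSeries hD.one_le_order hD.Au_nonneg hD.Cu_nonneg hD.contDiff_amplitude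
      hD.amplitude_bound x (le_two_mul_cubicScale hCu hCf s)) μ

theorem CriticalData.hasGevreyExpansion_remSeries_pow_mul
    (hD : CriticalData s Au Cu Af Cf V x₀ f u) (μ : ℕ) {x : 𝔼}
    (hV : ∀ t ∈ Set.Icc (0 : ℝ) 1, x₀ + t • x ∈ V) :
    HasGevreyExpansion (s - 1) (2 * cubicScale s (Cu * (d * ‖x‖)) (Cf * (d * ‖x‖)))
      (Au * (2 * cubicAmp s Af (Cf * (d * ‖x‖))) ^ μ)
      (gRem f x₀ (x₀ + x) ^ μ * u (x₀ + x)) (remSeries f x₀ x ^ μ * taylorSeries x₀ u x) := by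
  have hT : 0 ≤ d * ‖x‖ := by positivity
  have hCu := mul_nonneg hD.Cu_nonneg hT
  have hCf := mul_nonneg hD.Cf_nonneg hT
  exact (hasGevreyExpansion_remSeries hD.one_le_order hD.Af_nonneg hD.Cf_nonneg hD.contDiff_phase
      hD.phase_eq_zero hD.fderiv_phase_eq_zero hD.phase_bound x hV
      (mul_rpow_le_cubicScale hCu s _)).pow_mul (sub_nonneg.2 hD.one_le_order)
    (cubicScale_nonneg hCu hCf s) (cubicAmp_nonneg hD.Af_nonneg hCf s) hD.Au_nonneg
    (hasGevreyExpansion_taylorSeries hD.one_le_order hD.Au_nonneg hD.Cu_nonneg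
      hD.contDiff_amplitude hD.amplitude_bound x hV (le_two_mul_cubicScale hCu hCf s)) μ

theorem CriticalData.norm_taylorTerm_gRem_pow_mul_le
    (hD : CriticalData s Au Cu Af Cf {x₀} x₀ f u) (μ l : ℕ) (x : 𝔼) :
    ‖taylorTerm x₀ (3 * μ + l) (fun y => gRem f x₀ y ^ μ * u y) x‖ ≤
      termSize s Au (cubicAmp s Af (Cf * d)) (cubicScale s (Cu * d) (Cf * d)) μ l ‖x‖ := by
  rw [← coeff_taylorSeries, taylorSeries_gRem_pow_mul hD.contDiff_phase hD.contDiff_amplitude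
    hD.phase_eq_zero hD.fderiv_phase_eq_zero, coeff_X_pow_mul', if_pos (by omega),
    Nat.add_sub_cancel_left, termSize_cubicAmp_cubicScale]
  exact hD.gevreyCoeff_remSeries_pow_mul μ x l

theorem sum_range_taylorTerm_gRem_pow_mul (hf : ContDiff ℝ ∞ f) (hu : ContDiff ℝ ∞ u)
    (hf₀ : f x₀ = 0) (hf'₀ : fderiv ℝ f x₀ = 0) (μ l : ℕ) (x : 𝔼) :
    ∑ n ∈ Finset.range (3 * μ + l), taylorTerm x₀ n (fun y => gRem f x₀ y ^ μ * u y) x =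
      ∑ n ∈ Finset.range l, coeff n (remSeries f x₀ x ^ μ * taylorSeries x₀ u x) := by
  simp only [← coeff_taylorSeries, taylorSeries_gRem_pow_mul hf hu hf₀ hf'₀, coeff_X_pow_mul']
  rw [Finset.sum_range_add, Finset.sum_eq_zero fun n hn =>
    if_neg (not_le.2 (Finset.mem_range.1 hn)), zero_add]
  exact Finset.sum_congr rfl fun n _ => by rw [if_pos (by omega), Nat.add_sub_cancel_left]

theorem CriticalData.norm_sub_sum_taylorTerm_gRem_pow_mul_le
    (hD : CriticalData s Au Cu Af Cf V x₀ f u) (μ l : ℕ) {x : 𝔼}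
    (hV : ∀ t ∈ Set.Icc (0 : ℝ) 1, x₀ + t • x ∈ V) :
    ‖gRem f x₀ (x₀ + x) ^ μ * u (x₀ + x) -
        ∑ n ∈ Finset.range (3 * μ + l), taylorTerm x₀ n (fun y => gRem f x₀ y ^ μ * u y) x‖ ≤
      termSize s Au (cubicAmp s Af (Cf * d)) (cubicScale s (Cu * d) (Cf * d)) μ l ‖x‖ := by
  rw [sum_range_taylorTerm_gRem_pow_mul hD.contDiff_phase hD.contDiff_amplitude hD.phase_eq_zero
    hD.fderiv_phase_eq_zero, termSize_cubicAmp_cubicScale]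
  exact (hD.hasGevreyExpansion_remSeries_pow_mul μ hV).2 l

/-- The constant that governs the growth of the terms of the expansion after rescaling by `√h`. -/
def growth (b y c : ℝ) : ℝ := (1 + 2 * b) * (1 + 2 * y) * (1 + √(8 / c)) ^ 3 * 16

theorem one_le_growth {b y : ℝ} (hb : 0 ≤ b) (hy : 0 ≤ y) (c : ℝ) : 1 ≤ growth b y c := by
  have hb1 : 1 ≤ 1 + 2 * b := by linarith
  have hy1 : 1 ≤ 1 + 2 * y := by linarith
  have hc1 : 1 ≤ (1 + √(8 / c)) ^ 3 := one_le_pow₀ (by linarith [Real.sqrt_nonneg (8 / c)])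
  exact one_le_mul_of_one_le_of_one_le (one_le_mul_of_one_le_of_one_le
    (one_le_mul_of_one_le_of_one_le hb1 hy1) hc1) (by norm_num)

theorem growth_terms_le (hs : 1 ≤ s) {b y : ℝ} (hb : 0 ≤ b) (hy : 0 ≤ y) (c : ℝ) (μ l : ℕ) :
    (2 * b) ^ μ * (2 * y) ^ l * √(8 / c) ^ (3 * μ + l) *
        ((l.factorial : ℝ) ^ (s - 1) * √((3 * μ + l).factorial) / μ.factorial) ≤
      growth b y c ^ (μ + l) * ((μ + l).factorial : ℝ) ^ (s - 1 / 2) := by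
  calc _ ≤ (1 + 2 * b) ^ (μ + l) * (1 + 2 * y) ^ (μ + l) * (1 + √(8 / c)) ^ (3 * (μ + l)) *
        (16 ^ (μ + l) * ((μ + l).factorial : ℝ) ^ (s - 1 / 2)) := by
        gcongr ?_ * ?_ * ?_ * ?_
        · exact pow_le_one_add_pow (by positivity) (by omega)
        · exact pow_le_one_add_pow (by positivity) (by omega)
        · exact pow_le_one_add_pow (by positivity) (by omega)
        · exact factorial_rpow_mul_sqrt_factorial_div_le hs μ l
    _ = _ := by
        simp only [growth, mul_pow, ← pow_mul]
        ring

theorem pow_mul_exp_neg_le {c h : ℝ} (hc : 0 < c) (hh : 0 < h) (T : ℝ) (n : ℕ) :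
    T ^ n * Real.exp (-(c / (4 * h)) * T ^ 2) ≤
      √n.factorial * (√(8 / c) * √h) ^ n * Real.exp (-(c / (8 * h)) * T ^ 2) := by
  have hsqrt : (√(c / (8 * h)))⁻¹ = √(8 / c) * √h := by
    rw [← Real.sqrt_inv, inv_div, ← Real.sqrt_mul (by positivity)]
    congr 1
    ring
  have hexp : Real.exp (-(c / (8 * h)) * T ^ 2) =
      Real.exp (c / (8 * h) * T ^ 2) * Real.exp (-(c / (4 * h)) * T ^ 2) := by
    rw [← Real.exp_add]
    congr 1
    field_simp
    ring
  rw [hexp, ← mul_assoc, ← hsqrt]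
  gcongr
  exact pow_le_sqrt_factorial_mul_exp (by positivity) T n

theorem one_div_pow_mul_sqrt_pow {h : ℝ} (hh : 0 < h) (μ l : ℕ) :
    (1 / h) ^ μ * √h ^ (3 * μ + l) = √h ^ (μ + l) := by
  rw [show 3 * μ + l = 2 * μ + (μ + l) by ring, pow_add _ (2 * μ), pow_mul, Real.sq_sqrt hh.le,
    ← mul_assoc, ← mul_pow, one_div_mul_cancel hh.ne', one_pow, one_mul]

theorem termSize_mul_exp_le {A b y c h T : ℝ} (hs : 1 ≤ s) (hA : 0 ≤ A) (hb : 0 ≤ b) (hy : 0 ≤ y)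
    (hc : 0 < c) (hh : 0 < h) (μ l : ℕ) :
    (1 / h) ^ μ / μ.factorial * termSize s A b y μ l T * Real.exp (-(c / (4 * h)) * T ^ 2) ≤
      A * (growth b y c ^ (μ + l) * ((μ + l).factorial : ℝ) ^ (s - 1 / 2) * √h ^ (μ + l)) *
        Real.exp (-(c / (8 * h)) * T ^ 2) := by
  calc _ = (1 / h) ^ μ / μ.factorial *
        (A * (2 * b) ^ μ * ((2 * y) ^ l * (l.factorial : ℝ) ^ (s - 1))) *
          (T ^ (3 * μ + l) * Real.exp (-(c / (4 * h)) * T ^ 2)) := by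
        unfold termSize
        ring
    _ ≤ (1 / h) ^ μ / μ.factorial *
        (A * (2 * b) ^ μ * ((2 * y) ^ l * (l.factorial : ℝ) ^ (s - 1))) *
          (√((3 * μ + l).factorial) * (√(8 / c) * √h) ^ (3 * μ + l) *
            Real.exp (-(c / (8 * h)) * T ^ 2)) := by
        exact mul_le_mul_of_nonneg_left (pow_mul_exp_neg_le hc hh T _) (by positivity)
    _ = A * ((2 * b) ^ μ * (2 * y) ^ l * √(8 / c) ^ (3 * μ + l) *
        ((l.factorial : ℝ) ^ (s - 1) * √((3 * μ + l).factorial) / μ.factorial) *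
          √h ^ (μ + l)) * Real.exp (-(c / (8 * h)) * T ^ 2) := by
        rw [← one_div_pow_mul_sqrt_pow hh, mul_pow (√(8 / c))]
        ring
    _ ≤ _ := by
        gcongr A * (?_ * _) * _
        exact growth_terms_le hs hb hy c μ l

end Pointwise

section Integrand

open PowerSeries

variable {f u : EuclideanSpace ℝ (Fin d) → ℂ} {x₀ : EuclideanSpace ℝ (Fin d)}
  {V : Set (EuclideanSpace ℝ (Fin d))} {s Au Cu Af Cf c h : ℝ}

theorem taylorTerm_gRem_pow_mul_eq_zero (hf : ContDiff ℝ ∞ f) (hu : ContDiff ℝ ∞ u)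
    (hf₀ : f x₀ = 0) (hf'₀ : fderiv ℝ f x₀ = 0) {μ n : ℕ} (hn : n < 3 * μ) (x : 𝔼) :
    taylorTerm x₀ n (fun y => gRem f x₀ y ^ μ * u y) x = 0 := by
  rw [← coeff_taylorSeries, taylorSeries_gRem_pow_mul hf hu hf₀ hf'₀, coeff_X_pow_mul',
    if_neg (not_le.2 hn)]

/-- The polynomial that replaces `exp(ig/h) u` in the expansion to order `k`, where `g` is the cubic
remainder of `f`. Since `g^μ` vanishes to order `3μ`, only `μ < 2k` contributes. -/
def approxPoly (f u : 𝔼 → ℂ) (x₀ : 𝔼) (h : ℝ) (k : ℕ) (x : 𝔼) : ℂ :=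
  ∑ μ ∈ Finset.range (2 * k), (Complex.I / h) ^ μ / μ.factorial *
    ∑ n ∈ Finset.range (2 * (k + μ)), taylorTerm x₀ n (fun y => gRem f x₀ y ^ μ * u y) x

theorem mul_exp_mul_sub_approxPoly (f u : 𝔼 → ℂ) (x₀ : 𝔼) (h : ℝ) (k : ℕ) (x : 𝔼) (G : ℂ) :
    G * (Complex.exp (Complex.I / h * gRem f x₀ (x₀ + x)) * u (x₀ + x) -
        approxPoly f u x₀ h k x) =
      G * ((Complex.exp (Complex.I / h * gRem f x₀ (x₀ + x)) -
        ∑ μ ∈ Finset.range (2 * k), (Complex.I / h * gRem f x₀ (x₀ + x)) ^ μ / μ.factorial) *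
          u (x₀ + x)) +
      ∑ μ ∈ Finset.range (2 * k), G * ((Complex.I / h) ^ μ / μ.factorial *
        (gRem f x₀ (x₀ + x) ^ μ * u (x₀ + x) - ∑ n ∈ Finset.range (2 * (k + μ)),
          taylorTerm x₀ n (fun y => gRem f x₀ y ^ μ * u y) x)) := by
  have hsum : ∑ μ ∈ Finset.range (2 * k),
        (Complex.I / h * gRem f x₀ (x₀ + x)) ^ μ / (μ.factorial : ℂ) * u (x₀ + x) =
      ∑ μ ∈ Finset.range (2 * k), (Complex.I / h) ^ μ / (μ.factorial : ℂ) *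
        (gRem f x₀ (x₀ + x) ^ μ * u (x₀ + x)) :=
    Finset.sum_congr rfl fun μ _ => by rw [mul_pow]; ring
  rw [← Finset.mul_sum, ← mul_add]
  congr 1
  simp only [mul_sub, Finset.sum_sub_distrib]
  rw [sub_mul, Finset.sum_mul, approxPoly, hsum]
  ring

/-- The size of the remainder of order `k` in the expansion of `exp(ig/h) u`. -/
def remSize (d : ℕ) (s Au Cu Af Cf c h : ℝ) (k : ℕ) : ℝ :=
  Au * (growth (cubicAmp s Af (Cf * d)) (cubicScale s (Cu * d) (Cf * d)) c ^ (2 * k) *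
    ((2 * k).factorial : ℝ) ^ (s - 1 / 2) * √h ^ (2 * k))

theorem CriticalData.cubicAmp_mul_nonneg (hD : CriticalData s Au Cu Af Cf V x₀ f u) :
    0 ≤ cubicAmp s Af (Cf * d) :=
  cubicAmp_nonneg hD.Af_nonneg (mul_nonneg hD.Cf_nonneg d.cast_nonneg) s

theorem CriticalData.cubicScale_mul_nonneg (hD : CriticalData s Au Cu Af Cf V x₀ f u) :
    0 ≤ cubicScale s (Cu * d) (Cf * d) :=
  cubicScale_nonneg (mul_nonneg hD.Cu_nonneg d.cast_nonneg)
    (mul_nonneg hD.Cf_nonneg d.cast_nonneg) s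

theorem CriticalData.one_le_growth (hD : CriticalData s Au Cu Af Cf V x₀ f u) (c : ℝ) :
    1 ≤ growth (cubicAmp s Af (Cf * d)) (cubicScale s (Cu * d) (Cf * d)) c :=
  GevreyPhase.one_le_growth hD.cubicAmp_mul_nonneg hD.cubicScale_mul_nonneg c

theorem CriticalData.remSize_nonneg (hD : CriticalData s Au Cu Af Cf V x₀ f u) (c h : ℝ) (k : ℕ) :
    0 ≤ remSize d s Au Cu Af Cf c h k := by
  have := hD.Au_nonneg
  have := zero_le_one.trans (hD.one_le_growth c)
  unfold remSize
  positivity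

theorem CriticalData.termSize_nonneg (hD : CriticalData s Au Cu Af Cf V x₀ f u) (μ l : ℕ) {T : ℝ}
    (hT : 0 ≤ T) :
    0 ≤ termSize s Au (cubicAmp s Af (Cf * d)) (cubicScale s (Cu * d) (Cf * d)) μ l T := by
  have := hD.Au_nonneg
  have := hD.cubicAmp_mul_nonneg
  have := hD.cubicScale_mul_nonneg
  unfold termSize
  positivity

theorem CriticalData.termSize_mul_exp_le_remSize (hD : CriticalData s Au Cu Af Cf V x₀ f u)
    (hc : 0 < c) (hh : 0 < h) {μ l k : ℕ} (hμl : μ + l = 2 * k) (T : ℝ) :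
    (1 / h) ^ μ / μ.factorial *
        termSize s Au (cubicAmp s Af (Cf * d)) (cubicScale s (Cu * d) (Cf * d)) μ l T *
        Real.exp (-(c / (4 * h)) * T ^ 2) ≤
      remSize d s Au Cu Af Cf c h k * Real.exp (-(c / (8 * h)) * T ^ 2) := by
  rw [remSize, ← hμl]
  exact termSize_mul_exp_le hD.one_le_order hD.Au_nonneg hD.cubicAmp_mul_nonneg
    hD.cubicScale_mul_nonneg hc hh μ l

theorem norm_I_div_pow_div (hh : 0 ≤ h) (μ : ℕ) :
    ‖(Complex.I / h) ^ μ / (μ.factorial : ℂ)‖ = (1 / h) ^ μ / μ.factorial := by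
  rw [norm_div, norm_pow, norm_div, Complex.norm_I, Complex.norm_real, Complex.norm_natCast,
    Real.norm_of_nonneg hh]

theorem CriticalData.norm_gRem_pow_mul_le (hD : CriticalData s Au Cu Af Cf V x₀ f u) (μ : ℕ)
    {x : 𝔼} (hV : ∀ t ∈ Set.Icc (0 : ℝ) 1, x₀ + t • x ∈ V) :
    ‖gRem f x₀ (x₀ + x)‖ ^ μ * ‖u (x₀ + x)‖ ≤
      termSize s Au (cubicAmp s Af (Cf * d)) (cubicScale s (Cu * d) (Cf * d)) μ 0 ‖x‖ := by
  have hremainder := hD.norm_sub_sum_taylorTerm_gRem_pow_mul_le μ 0 hV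
  rwa [add_zero, Finset.sum_eq_zero fun n hn => taylorTerm_gRem_pow_mul_eq_zero hD.contDiff_phase
    hD.contDiff_amplitude hD.phase_eq_zero hD.fderiv_phase_eq_zero (Finset.mem_range.1 hn) x,
    sub_zero, norm_mul, norm_pow] at hremainder

theorem CriticalData.norm_mul_exp_remainder_le (hD : CriticalData s Au Cu Af Cf V x₀ f u)
    (hc : 0 < c) (hh : 0 < h) (k : ℕ) {x : 𝔼} (hV : ∀ t ∈ Set.Icc (0 : ℝ) 1, x₀ + t • x ∈ V)
    {G : ℂ}
    (hG : ‖G‖ * Real.exp (‖gRem f x₀ (x₀ + x)‖ / h) ≤ Real.exp (-(c / (4 * h)) * ‖x‖ ^ 2)) :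
    ‖G * ((Complex.exp (Complex.I / h * gRem f x₀ (x₀ + x)) - ∑ μ ∈ Finset.range (2 * k),
        (Complex.I / h * gRem f x₀ (x₀ + x)) ^ μ / μ.factorial) * u (x₀ + x))‖ ≤
      remSize d s Au Cu Af Cf c h k * Real.exp (-(c / (8 * h)) * ‖x‖ ^ 2) := by
  set g := gRem f x₀ (x₀ + x)
  have hexp := norm_exp_sub_sum_le_pow_div_factorial (Complex.I / h * g) (2 * k)
  rw [show ‖Complex.I / h * g‖ = ‖g‖ / h by
    rw [norm_mul, norm_div, Complex.norm_I, Complex.norm_real, Real.norm_of_nonneg hh.le]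
    ring] at hexp
  have hterm := hD.termSize_nonneg (2 * k) 0 (norm_nonneg x)
  rw [norm_mul, norm_mul]
  calc _ ≤ ‖G‖ * (((‖g‖ / h) ^ (2 * k) / (2 * k).factorial * Real.exp (‖g‖ / h)) *
          ‖u (x₀ + x)‖) := by gcongr
    _ = (1 / h) ^ (2 * k) / (2 * k).factorial * (‖g‖ ^ (2 * k) * ‖u (x₀ + x)‖) *
          (‖G‖ * Real.exp (‖g‖ / h)) := by
        rw [div_eq_mul_one_div ‖g‖ h, mul_pow]
        ring
    _ ≤ (1 / h) ^ (2 * k) / (2 * k).factorial *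
          termSize s Au (cubicAmp s Af (Cf * d)) (cubicScale s (Cu * d) (Cf * d)) (2 * k) 0 ‖x‖ *
          Real.exp (-(c / (4 * h)) * ‖x‖ ^ 2) := by
        gcongr
        exact hD.norm_gRem_pow_mul_le (2 * k) hV
    _ ≤ _ := hD.termSize_mul_exp_le_remSize hc hh rfl ‖x‖

theorem CriticalData.norm_mul_taylor_remainder_le (hD : CriticalData s Au Cu Af Cf V x₀ f u)
    (hc : 0 < c) (hh : 0 < h) {μ k : ℕ} (hμ : μ ≤ 2 * k) {x : 𝔼}
    (hV : ∀ t ∈ Set.Icc (0 : ℝ) 1, x₀ + t • x ∈ V) {G : ℂ}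
    (hG : ‖G‖ ≤ Real.exp (-(c / (4 * h)) * ‖x‖ ^ 2)) :
    ‖G * ((Complex.I / h) ^ μ / μ.factorial * (gRem f x₀ (x₀ + x) ^ μ * u (x₀ + x) -
        ∑ n ∈ Finset.range (2 * (k + μ)),
          taylorTerm x₀ n (fun y => gRem f x₀ y ^ μ * u y) x))‖ ≤
      remSize d s Au Cu Af Cf c h k * Real.exp (-(c / (8 * h)) * ‖x‖ ^ 2) := by
  obtain ⟨l, hl⟩ := Nat.exists_eq_add_of_le hμ
  have hremainder := hD.norm_sub_sum_taylorTerm_gRem_pow_mul_le μ l hV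
  rw [show 3 * μ + l = 2 * (k + μ) by omega] at hremainder
  have hterm := hD.termSize_nonneg μ l (norm_nonneg x)
  refine le_trans ?_ (hD.termSize_mul_exp_le_remSize hc hh hl.symm ‖x‖)
  rw [norm_mul, norm_mul, norm_I_div_pow_div hh.le, mul_comm]
  gcongr

theorem CriticalData.norm_mul_exp_mul_sub_approxPoly_le
    (hD : CriticalData s Au Cu Af Cf V x₀ f u) (hc : 0 < c) (hh : 0 < h) (k : ℕ) {x : 𝔼}
    (hV : ∀ t ∈ Set.Icc (0 : ℝ) 1, x₀ + t • x ∈ V) {G : ℂ}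
    (hG : ‖G‖ * Real.exp (‖gRem f x₀ (x₀ + x)‖ / h) ≤ Real.exp (-(c / (4 * h)) * ‖x‖ ^ 2)) :
    ‖G * (Complex.exp (Complex.I / h * gRem f x₀ (x₀ + x)) * u (x₀ + x) -
        approxPoly f u x₀ h k x)‖ ≤
      (2 * k + 1) * (remSize d s Au Cu Af Cf c h k * Real.exp (-(c / (8 * h)) * ‖x‖ ^ 2)) := by
  have hG_norm : ‖G‖ ≤ Real.exp (-(c / (4 * h)) * ‖x‖ ^ 2) :=
    (le_mul_of_one_le_right (norm_nonneg _) (Real.one_le_exp (by positivity))).trans hG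
  rw [mul_exp_mul_sub_approxPoly]
  refine (norm_add_le _ _).trans ((add_le_add (hD.norm_mul_exp_remainder_le hc hh k hV hG)
    (norm_sum_le_of_le _ fun μ hμ => hD.norm_mul_taylor_remainder_le hc hh
      (Finset.mem_range.1 hμ).le hV hG_norm)).trans_eq ?_)
  rw [Finset.sum_const, Finset.card_range, nsmul_eq_mul]
  push_cast
  ring

/- The factor `exp(-δ/h)` gained away from `x₀` supplies the missing powers of `√h`. -/
theorem CriticalData.norm_mul_taylorTerm_le {δ : ℝ}
    (hD : CriticalData s Au Cu Af Cf {x₀} x₀ f u) (hc : 0 < c) (hh : 0 < h)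
    (hδ : ∀ p : ℕ, Real.exp (-δ / h) ≤ (p.factorial : ℝ) ^ (s - 1 / 2) * √h ^ p) {μ n k : ℕ}
    (hn : n < 2 * (k + μ)) {x : 𝔼} {G : ℂ}
    (hG : ‖G‖ ≤ Real.exp (-δ / h) * Real.exp (-(c / (4 * h)) * ‖x‖ ^ 2)) :
    ‖G * ((Complex.I / h) ^ μ / μ.factorial *
        taylorTerm x₀ n (fun y => gRem f x₀ y ^ μ * u y) x)‖ ≤
      remSize d s Au Cu Af Cf c h k * Real.exp (-(c / (8 * h)) * ‖x‖ ^ 2) := by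
  rcases lt_or_ge n (3 * μ) with hlt | hge
  · rw [taylorTerm_gRem_pow_mul_eq_zero hD.contDiff_phase hD.contDiff_amplitude hD.phase_eq_zero
      hD.fderiv_phase_eq_zero hlt, mul_zero, mul_zero, norm_zero]
    exact mul_nonneg (hD.remSize_nonneg c h k) (Real.exp_pos _).le
  obtain ⟨l, rfl⟩ := Nat.exists_eq_add_of_le hge
  obtain ⟨p, hp⟩ : ∃ p, 2 * k = (μ + l) + p := Nat.exists_eq_add_of_le (by omega)
  have hAu := hD.Au_nonneg
  have hgrowth := hD.one_le_growth c
  unfold remSize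
  set b := cubicAmp s Af (Cf * d)
  set y := cubicScale s (Cu * d) (Cf * d)
  have hterm : 0 ≤ termSize s Au b y μ l ‖x‖ := hD.termSize_nonneg μ l (norm_nonneg x)
  have htaylor := hD.norm_taylorTerm_gRem_pow_mul_le μ l x
  have hdecay := termSize_mul_exp_le (T := ‖x‖) hD.one_le_order hAu hD.cubicAmp_mul_nonneg
    hD.cubicScale_mul_nonneg hc hh μ l
  rw [norm_mul, norm_mul, norm_I_div_pow_div hh.le]
  calc _ ≤ (Real.exp (-δ / h) * Real.exp (-(c / (4 * h)) * ‖x‖ ^ 2)) *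
        ((1 / h) ^ μ / μ.factorial * termSize s Au b y μ l ‖x‖) := by gcongr
    _ = Real.exp (-δ / h) * ((1 / h) ^ μ / μ.factorial * termSize s Au b y μ l ‖x‖ *
        Real.exp (-(c / (4 * h)) * ‖x‖ ^ 2)) := by ring
    _ ≤ ((p.factorial : ℝ) ^ (s - 1 / 2) * √h ^ p) *
        (Au * (growth b y c ^ (μ + l) * ((μ + l).factorial : ℝ) ^ (s - 1 / 2) *
          √h ^ (μ + l)) * Real.exp (-(c / (8 * h)) * ‖x‖ ^ 2)) :=
        mul_le_mul (hδ p) hdecay (by positivity) (by positivity)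
    _ = Au * (growth b y c ^ (μ + l) * (((μ + l).factorial : ℝ) ^ (s - 1 / 2) *
        (p.factorial : ℝ) ^ (s - 1 / 2)) * √h ^ (μ + l + p)) *
        Real.exp (-(c / (8 * h)) * ‖x‖ ^ 2) := by
        rw [pow_add √h (μ + l) p]
        ring
    _ ≤ _ := by
        have hσ : 0 ≤ s - 1 / 2 := by linarith [hD.one_le_order]
        have hfactorial := factorial_rpow_mul_factorial_rpow_le hσ (μ + l) p
        have hpow : growth b y c ^ (μ + l) ≤ growth b y c ^ (μ + l + p) :=
          pow_le_pow_right₀ hgrowth (Nat.le_add_right _ _)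
        rw [hp]
        gcongr

theorem CriticalData.norm_mul_approxPoly_le {δ : ℝ}
    (hD : CriticalData s Au Cu Af Cf {x₀} x₀ f u) (hc : 0 < c) (hh : 0 < h)
    (hδ : ∀ p : ℕ, Real.exp (-δ / h) ≤ (p.factorial : ℝ) ^ (s - 1 / 2) * √h ^ p) (k : ℕ) {x : 𝔼}
    {G : ℂ} (hG : ‖G‖ ≤ Real.exp (-δ / h) * Real.exp (-(c / (4 * h)) * ‖x‖ ^ 2)) :
    ‖G * approxPoly f u x₀ h k x‖ ≤
      (12 * k ^ 2) * (remSize d s Au Cu Af Cf c h k * Real.exp (-(c / (8 * h)) * ‖x‖ ^ 2)) := by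
  set R := remSize d s Au Cu Af Cf c h k * Real.exp (-(c / (8 * h)) * ‖x‖ ^ 2)
  have hR : 0 ≤ R := mul_nonneg (hD.remSize_nonneg c h k) (Real.exp_pos _).le
  have hsummand : ∀ μ ∈ Finset.range (2 * k), ‖∑ n ∈ Finset.range (2 * (k + μ)),
      G * ((Complex.I / h) ^ μ / μ.factorial *
        taylorTerm x₀ n (fun y => gRem f x₀ y ^ μ * u y) x)‖ ≤ 6 * k * R := fun μ hμ => by
    refine (norm_sum_le_of_le _ fun n hn =>
      hD.norm_mul_taylorTerm_le hc hh hδ (Finset.mem_range.1 hn) hG).trans ?_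
    rw [Finset.sum_const, Finset.card_range, nsmul_eq_mul]
    gcongr
    have := Finset.mem_range.1 hμ
    exact_mod_cast (by omega : 2 * (k + μ) ≤ 6 * k)
  simp only [approxPoly, Finset.mul_sum]
  refine (norm_sum_le_of_le _ hsummand).trans_eq ?_
  rw [Finset.sum_const, Finset.card_range, nsmul_eq_mul]
  push_cast
  ring

end Integrand

section MainSum

open PowerSeries

variable {f u : EuclideanSpace ℝ (Fin d) → ℂ} {x₀ : EuclideanSpace ℝ (Fin d)}
  {s Au Cu Af Cf h : ℝ}

theorem quadOp_smul_iterate {F : 𝔼 → ℂ} (hF : ContDiff ℝ ∞ F) (a : ℂ)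
    (B : Matrix (Fin d) (Fin d) ℂ) (ν : ℕ) :
    (quadOp (a • B))^[ν] F = fun x => a ^ ν * (quadOp B)^[ν] F x := by
  induction ν with
  | zero => simp
  | succ ν ih =>
    rw [Function.iterate_succ_apply', ih, Function.iterate_succ_apply']
    have hiterate : ContDiff ℝ ∞ ((quadOp B)^[ν] F) := contDiff_quadOp_iterate hF B ν
    have hpderiv (j : Fin d) : Differentiable ℝ (pderiv j ((quadOp B)^[ν] F)) :=
      (contDiff_pderiv hiterate j).differentiable (by simp)
    funext x
    simp only [quadOp, pderiv_const_mul (hiterate.differentiable (by simp)),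
      fun j => pderiv_const_mul (hpderiv j), Finset.mul_sum]
    refine Finset.sum_congr rfl fun i _ => Finset.sum_congr rfl fun j _ => ?_
    rw [Matrix.smul_apply, smul_eq_mul]
    ring

theorem CriticalData.wordDeriv_gRem_pow_mul_eq_zero
    (hD : CriticalData s Au Cu Af Cf {x₀} x₀ f u) {μ : ℕ} {w : List (Fin d)}
    (hw : w.length < 3 * μ) : wordDeriv w (fun y => gRem f x₀ y ^ μ * u y) x₀ = 0 := by
  have hbound := (hD.wordBound_gRem le_rfl).pow_mul (contDiff_gRem hD.contDiff_phase)
    hD.contDiff_amplitude (hD.wordBound_amplitude le_rfl) μ w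
  rw [mul_pow, ← pow_mul, mul_assoc (X ^ (3 * μ)), coeff_X_pow_mul', if_neg (not_le.2 hw),
    mul_zero] at hbound
  exact norm_le_zero_iff.1 hbound

theorem CriticalData.quadOp_iterate_gRem_pow_mul_eq_zero
    (hD : CriticalData s Au Cu Af Cf {x₀} x₀ f u) (B : Matrix (Fin d) (Fin d) ℂ) {μ ν : ℕ}
    (hμν : 2 * ν < 3 * μ) : (quadOp B)^[ν] (fun y => gRem f x₀ y ^ μ * u y) x₀ = 0 := by
  have hentry (i j : Fin d) : ‖B i j‖ ≤ ∑ i, ∑ j, ‖B i j‖ :=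
    (Finset.single_le_sum (f := fun j => ‖B i j‖) (fun _ _ => norm_nonneg _)
      (Finset.mem_univ j)).trans (Finset.single_le_sum (f := fun i => ∑ j, ‖B i j‖)
      (fun _ _ => by positivity) (Finset.mem_univ i))
  have hbound := norm_quadOp_iterate_le (M := 0) (by positivity) le_rfl hentry ν
    (((contDiff_gRem hD.contDiff_phase).pow μ).mul hD.contDiff_amplitude) fun w hw => by
      rw [hD.wordDeriv_gRem_pow_mul_eq_zero (hw ▸ hμν), norm_zero]
  simpa using hbound

theorem sum_range_two_mul_of_odd_eq_zero {M : Type*} [AddCommMonoid M] {g : ℕ → M}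
    (hg : ∀ ν, g (2 * ν + 1) = 0) (N : ℕ) :
    ∑ n ∈ Finset.range (2 * N), g n = ∑ ν ∈ Finset.range N, g (2 * ν) := by
  induction N with
  | zero => simp
  | succ N ih =>
    rw [mul_add_one, Finset.sum_range_succ, Finset.sum_range_succ, ih, hg, add_zero,
      Finset.sum_range_succ]

/- The substitution `ν = j + μ`: the terms with `ν < μ` or `μ > 2j` have `2ν < 3μ`. -/
theorem sum_range_sum_range_add_eq {M : Type*} [AddCommMonoid M] {a : ℕ → ℕ → M}
    (ha : ∀ μ ν, 2 * ν < 3 * μ → a μ ν = 0) (k : ℕ) :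
    ∑ μ ∈ Finset.range (2 * k), ∑ ν ∈ Finset.range (k + μ), a μ ν =
      ∑ j ∈ Finset.range k, ∑ μ ∈ Finset.range (2 * j + 1), a μ (j + μ) := by
  have hshift (μ : ℕ) :
      ∑ ν ∈ Finset.range (k + μ), a μ ν = ∑ j ∈ Finset.range k, a μ (j + μ) := by
    rw [add_comm k μ, Finset.sum_range_add, Finset.sum_eq_zero fun ν hν => ha μ ν (by
      have := Finset.mem_range.1 hν; omega), zero_add]
    simp only [add_comm]
  simp only [hshift]
  rw [Finset.sum_comm]
  refine Finset.sum_congr rfl fun j hj => (Finset.sum_subset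
    (Finset.range_subset_range.2 ?_) fun μ _ hμ => ha μ (j + μ) ?_).symm
  · have := Finset.mem_range.1 hj
    omega
  · have := Finset.mem_range.not.1 hμ
    omega

theorem gaussian_mul_approxPoly (A : Matrix (Fin d) (Fin d) ℂ) (f u : 𝔼 → ℂ) (x₀ : 𝔼) (h : ℝ)
    (k : ℕ) (x : 𝔼) :
    gaussian A x * approxPoly f u x₀ h k x =
      ∑ μ ∈ Finset.range (2 * k), ∑ n ∈ Finset.range (2 * (k + μ)),
        (Complex.I / h) ^ μ / μ.factorial *
          (gaussian A x * taylorTerm x₀ n (fun y => gRem f x₀ y ^ μ * u y) x) := by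
  simp only [approxPoly, Finset.mul_sum]
  exact Finset.sum_congr rfl fun μ _ => Finset.sum_congr rfl fun n _ => by ring

variable {A : Matrix (Fin d) (Fin d) ℂ} {a : ℝ}

theorem integrable_gaussian_mul_approxPoly (ha : 0 < a) (hA : ReCoercive a A) (f u : 𝔼 → ℂ)
    (x₀ : 𝔼) (h : ℝ) (k : ℕ) :
    Integrable fun x : 𝔼 => gaussian A x * approxPoly f u x₀ h k x := by
  simp only [gaussian_mul_approxPoly]
  exact integrable_finsetSum _ fun μ _ => integrable_finsetSum _ fun n _ =>
    (integrable_gaussian_mul_taylorTerm ha hA x₀ n _).const_mul _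

theorem integral_gaussian_mul_approxPoly_eq_sum (ha : 0 < a) (hA : ReCoercive a A)
    (f u : 𝔼 → ℂ) (x₀ : 𝔼) (h : ℝ) (k : ℕ) :
    ∫ x : 𝔼, gaussian A x * approxPoly f u x₀ h k x =
      ∑ μ ∈ Finset.range (2 * k), ∑ n ∈ Finset.range (2 * (k + μ)),
        (Complex.I / h) ^ μ / μ.factorial *
          ∫ x, gaussian A x * taylorTerm x₀ n (fun y => gRem f x₀ y ^ μ * u y) x := by
  have hint (μ n : ℕ) : Integrable fun x : 𝔼 => (Complex.I / h) ^ μ / μ.factorial *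
      (gaussian A x * taylorTerm x₀ n (fun y => gRem f x₀ y ^ μ * u y) x) :=
    (integrable_gaussian_mul_taylorTerm ha hA x₀ n _).const_mul _
  simp only [gaussian_mul_approxPoly]
  rw [integral_finsetSum _ fun μ _ => integrable_finsetSum _ fun n _ => hint μ n]
  simp only [fun μ => integral_finsetSum (Finset.range (2 * (k + μ))) fun n _ => hint μ n,
    integral_const_mul]

theorem sum_range_integral_gaussian_mul_taylorTerm (ha : 0 < a) (hA : ReCoercive a A)
    (hA_symm : A.IsSymm) {z : ℂ} {B : Matrix (Fin d) (Fin d) ℂ} (hBA : (z • B) * A = 1) (x₀ : 𝔼)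
    {F : 𝔼 → ℂ} (hF : ContDiff ℝ ∞ F) (N : ℕ) :
    ∑ n ∈ Finset.range (2 * N), ∫ x, gaussian A x * taylorTerm x₀ n F x =
      (∫ x, gaussian A x) * ∑ ν ∈ Finset.range N,
        (2 ^ ν * (ν.factorial : ℂ))⁻¹ * (z ^ ν * (quadOp B)^[ν] F x₀) := by
  rw [sum_range_two_mul_of_odd_eq_zero fun ν =>
    integral_gaussian_mul_taylorTerm_odd ha hA hA_symm hBA x₀ ν hF, Finset.mul_sum]
  refine Finset.sum_congr rfl fun ν _ => ?_
  rw [integral_gaussian_mul_taylorTerm_even ha hA hA_symm hBA x₀ ν hF, quadOp_smul_iterate hF]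

theorem I_div_pow_mul_I_mul_pow (hh : h ≠ 0) (j μ : ℕ) (q : ℂ) :
    (Complex.I / h) ^ μ / μ.factorial * ((2 ^ (j + μ) * ((j + μ).factorial : ℂ))⁻¹ *
        ((Complex.I * h) ^ (j + μ) * q)) =
      (h : ℂ) ^ j * (Complex.I ^ (μ + (j + μ)) /
        (2 ^ (j + μ) * (μ.factorial : ℂ) * ((j + μ).factorial : ℂ)) * q) := by
  have hh' : (h : ℂ) ≠ 0 := Complex.ofReal_ne_zero.2 hh
  rw [div_pow, mul_pow, pow_add (h : ℂ), pow_add Complex.I μ]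
  field_simp

theorem CriticalData.integral_gaussian_mul_approxPoly
    (hD : CriticalData s Au Cu Af Cf {x₀} x₀ f u) (ha : 0 < a) (hA : ReCoercive a A)
    (hA_symm : A.IsSymm) (hh : h ≠ 0) (hinv : ((Complex.I * h) • (hess f x₀)⁻¹) * A = 1) (k : ℕ) :
    ∫ x, gaussian A x * approxPoly f u x₀ h k x =
      (∫ x, gaussian A x) * ∑ j ∈ Finset.range k, (h : ℂ) ^ j * Lop f x₀ j u := by
  have hsmooth (μ : ℕ) : ContDiff ℝ ∞ fun y => gRem f x₀ y ^ μ * u y :=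
    ((contDiff_gRem hD.contDiff_phase).pow μ).mul hD.contDiff_amplitude
  rw [integral_gaussian_mul_approxPoly_eq_sum ha hA]
  simp only [← Finset.mul_sum, fun μ => sum_range_integral_gaussian_mul_taylorTerm ha hA hA_symm
    hinv x₀ (hsmooth μ), mul_left_comm _ (∫ x, gaussian A x)]
  congr 1
  simp only [Finset.mul_sum]
  rw [sum_range_sum_range_add_eq fun μ ν hμν => by
    rw [hD.quadOp_iterate_gRem_pow_mul_eq_zero _ hμν, mul_zero, mul_zero, mul_zero]]
  simp only [I_div_pow_mul_I_mul_pow hh, Lop, Finset.mul_sum]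

end MainSum

section MainEstimate

variable {f u : EuclideanSpace ℝ (Fin d) → ℂ} {x₀ : EuclideanSpace ℝ (Fin d)}
  {V : Set (EuclideanSpace ℝ (Fin d))} {s Au Cu Af Cf c h : ℝ}

theorem twelve_mul_sq_add_le_sixteen_pow (k : ℕ) : 12 * k ^ 2 + 2 * k + 1 ≤ 16 ^ k := by
  induction k with
  | zero => simp
  | succ n ih => rw [pow_succ 16]; nlinarith

/-- The constant `C` in the bound of the remainder of the expansion of the integral. -/
def expansionConst (d : ℕ) (s Au Cu Af Cf c : ℝ) : ℝ :=
  (1 + Au * (8 * Real.pi / c) ^ ((d : ℝ) / 2)) *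
    (16 * growth (cubicAmp s Af (Cf * d)) (cubicScale s (Cu * d) (Cf * d)) c ^ 2 * 4 ^ s)

theorem pi_div_rpow_eq_mul_rpow (hc : 0 < c) (hh : 0 < h) (p : ℝ) :
    (Real.pi / (c / (8 * h))) ^ p = (8 * Real.pi / c) ^ p * h ^ p := by
  rw [← Real.mul_rpow (by positivity) hh.le]
  congr 1
  field_simp

theorem mul_pow_le_one_add_mul_pow_succ {P Q : ℝ} (hP : 0 ≤ P) (hQ : 1 ≤ Q) (k : ℕ) :
    P * Q ^ k ≤ ((1 + P) * Q) ^ (k + 1) := by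
  rw [mul_pow]
  gcongr
  · exact (by linarith : P ≤ 1 + P).trans (le_self_pow₀ (by linarith) k.succ_ne_zero)
  · exact k.le_succ

theorem CriticalData.remSize_mul_le (hD : CriticalData s Au Cu Af Cf V x₀ f u) (hc : 0 < c)
    (hh : 0 < h) (k : ℕ) :
    (12 * k ^ 2 + 2 * k + 1) * (remSize d s Au Cu Af Cf c h k *
      (Real.pi / (c / (8 * h))) ^ ((d : ℝ) / 2)) ≤
    expansionConst d s Au Cu Af Cf c ^ (k + 1) * (k.factorial : ℝ) ^ (2 * s - 1) *
      h ^ ((k : ℝ) + (d : ℝ) / 2) := by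
  have hgrowth := hD.one_le_growth c
  unfold expansionConst remSize
  set Γ := growth (cubicAmp s Af (Cf * d)) (cubicScale s (Cu * d) (Cf * d)) c
  set P : ℝ := Au * (8 * Real.pi / c) ^ ((d : ℝ) / 2) with hP_def
  set Q : ℝ := 16 * Γ ^ 2 * 4 ^ s with hQ_def
  have hP : 0 ≤ P := mul_nonneg hD.Au_nonneg (by positivity)
  have hQ : 1 ≤ Q := by
    have hΓ_sq : 1 ≤ 16 * Γ ^ 2 := by linarith [one_le_pow₀ hgrowth (n := 2)]
    exact one_le_mul_of_one_le_of_one_le hΓ_sq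
      (Real.one_le_rpow (by norm_num) (zero_le_one.trans hD.one_le_order))
  have hAu := hD.Au_nonneg
  rw [pi_div_rpow_eq_mul_rpow hc hh, pow_mul √h, Real.sq_sqrt hh.le, Real.rpow_add hh,
    Real.rpow_natCast]
  calc _ ≤ 16 ^ k * (Au * (Γ ^ (2 * k) * ((4 ^ s) ^ k * (k.factorial : ℝ) ^ (2 * s - 1)) *
        h ^ k) * ((8 * Real.pi / c) ^ ((d : ℝ) / 2) * h ^ ((d : ℝ) / 2))) := by
        gcongr
        · exact_mod_cast twelve_mul_sq_add_le_sixteen_pow k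
        · exact factorial_two_mul_rpow_le hD.one_le_order k
    _ = P * Q ^ k * (k.factorial : ℝ) ^ (2 * s - 1) * (h ^ k * h ^ ((d : ℝ) / 2)) := by
        rw [hP_def, hQ_def]
        simp only [mul_pow, ← pow_mul]
        ring
    _ ≤ _ := by
        gcongr
        exact mul_pow_le_one_add_mul_pow_succ hP hQ k

/-- Coercivity of the imaginary part of `Hx·x` on `ℝᵈ`, with constant `c`. -/
def ImCoercive (c : ℝ) (H : Matrix (Fin d) (Fin d) ℂ) : Prop :=
  ∀ x : 𝔼, c * ‖x‖ ^ 2 ≤ (quadForm H x).im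

/-- The matrix `A` for which `exp(-½ Ax·x) = exp(i/h · ½ Hx·x)`. -/
def phaseMatrix (H : Matrix (Fin d) (Fin d) ℂ) (h : ℝ) : Matrix (Fin d) (Fin d) ℂ :=
  (-Complex.I / h) • H

section PhaseMatrix

variable {H : Matrix (Fin d) (Fin d) ℂ}

theorem re_quadForm_phaseMatrix (H : Matrix (Fin d) (Fin d) ℂ) (h : ℝ) (x : 𝔼) :
    (quadForm (phaseMatrix H h) x).re = (quadForm H x).im / h := by
  rw [phaseMatrix, quadForm_smul, div_mul_eq_mul_div, Complex.div_ofReal_re]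
  simp

theorem norm_gaussian_phaseMatrix (H : Matrix (Fin d) (Fin d) ℂ) (h : ℝ) (x : 𝔼) :
    ‖gaussian (phaseMatrix H h) x‖ = Real.exp (-((quadForm H x).im / (2 * h))) := by
  rw [norm_gaussian, re_quadForm_phaseMatrix]
  congr 1
  ring

theorem ImCoercive.reCoercive_phaseMatrix (hH : ImCoercive c H) (hh : 0 ≤ h) :
    ReCoercive (c / h) (phaseMatrix H h) := fun x => by
  rw [re_quadForm_phaseMatrix, div_mul_eq_mul_div]
  gcongr
  exact hH x

theorem phaseMatrix_eq_two_pi_smul (H : Matrix (Fin d) (Fin d) ℂ) (h : ℝ) :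
    phaseMatrix H h = (2 * Real.pi : ℂ) • (1 / (2 * Real.pi * Complex.I * h)) • H := by
  have hpi : (Real.pi : ℂ) ≠ 0 := Complex.ofReal_ne_zero.2 Real.pi_ne_zero
  rw [phaseMatrix, smul_smul, mul_one_div, mul_assoc (2 * Real.pi : ℂ),
    div_mul_cancel_left₀ (by simp [hpi]), mul_inv, Complex.inv_I, div_eq_mul_inv]

theorem ImCoercive.integral_gaussian_phaseMatrix (hH : ImCoercive c H) (hc : 0 < c) (hh : 0 < h)
    (hH_symm : H.IsSymm) :
    ∫ x, gaussian (phaseMatrix H h) x =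
      detInvSqrt ((1 / (2 * (Real.pi : ℂ) * Complex.I * (h : ℂ))) • H) := by
  set B := (1 / (2 * (Real.pi : ℂ) * Complex.I * (h : ℂ))) • H
  have hB : B = (((2 * Real.pi)⁻¹ : ℝ) : ℂ) • phaseMatrix H h := by
    rw [phaseMatrix_eq_two_pi_smul, smul_smul]
    push_cast
    rw [inv_mul_cancel₀ (by simp [Real.pi_ne_zero]), one_smul]
  have hB_coercive : ReCoercive ((2 * Real.pi)⁻¹ * (c / h)) B := by
    rw [hB]
    exact (hH.reCoercive_phaseMatrix hh.le).smul (by positivity)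
  rw [phaseMatrix_eq_two_pi_smul]
  exact integral_gaussian_eq_detInvSqrt (by positivity) hB_coercive (hH_symm.smul _)

theorem ImCoercive.smul_inv_mul_phaseMatrix (hH : ImCoercive c H) (hc : 0 < c) (hh : 0 < h)
    (hH_symm : H.IsSymm) : ((Complex.I * h) • H⁻¹) * phaseMatrix H h = 1 := by
  have hdet := (hH.reCoercive_phaseMatrix hh.le).det_ne_zero (by positivity) (hH_symm.smul _)
  rw [phaseMatrix, Matrix.det_smul] at hdet
  have hh' : (h : ℂ) ≠ 0 := Complex.ofReal_ne_zero.2 hh.ne'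
  rw [phaseMatrix, Matrix.smul_mul, Matrix.mul_smul, smul_smul,
    Matrix.nonsing_inv_mul _ (right_ne_zero_of_mul hdet).isUnit,
    mul_assoc, mul_div_cancel₀ _ hh', mul_neg, Complex.I_mul_I, neg_neg, one_smul]

end PhaseMatrix

theorem exp_phase_eq_gaussian_mul (f : 𝔼 → ℂ) (x₀ : 𝔼) (h : ℝ) (x : 𝔼) :
    Complex.exp (Complex.I / h * f (x₀ + x)) =
      gaussian (phaseMatrix (hess f x₀) h) x *
        Complex.exp (Complex.I / h * gRem f x₀ (x₀ + x)) := by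
  rw [gaussian, ← Complex.exp_add, gRem_eq, add_sub_cancel_left, phaseMatrix, quadForm_smul]
  congr 1
  ring

theorem CriticalData.norm_exp_phase_mul_sub_le {r : ℝ}
    (hD : CriticalData s Au Cu Af Cf (Metric.ball x₀ r) x₀ f u) (hc : 0 < c) (hh : 0 < h)
    (hH : ImCoercive c (hess f x₀)) (k : ℕ) {x : 𝔼} (hx : ‖x‖ < r)
    (hg : ‖gRem f x₀ (x₀ + x)‖ ≤ (quadForm (hess f x₀) x).im / 4) :
    ‖Complex.exp (Complex.I / h * f (x₀ + x)) * u (x₀ + x) -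
        gaussian (phaseMatrix (hess f x₀) h) x * approxPoly f u x₀ h k x‖ ≤
      (2 * k + 1) * (remSize d s Au Cu Af Cf c h k * Real.exp (-(c / (8 * h)) * ‖x‖ ^ 2)) := by
  have hsegment : ∀ t ∈ Set.Icc (0 : ℝ) 1, x₀ + t • x ∈ Metric.ball x₀ r := fun t ht =>
    (convex_ball x₀ r).add_smul_mem (Metric.mem_ball_self ((norm_nonneg x).trans_lt hx))
      (by simpa using hx) ht
  rw [exp_phase_eq_gaussian_mul, mul_assoc, ← mul_sub]
  refine hD.norm_mul_exp_mul_sub_approxPoly_le hc hh k hsegment ?_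
  rw [norm_gaussian_phaseMatrix, ← Real.exp_add, Real.exp_le_exp]
  calc _ ≤ -((quadForm (hess f x₀) x).im / (2 * h)) + (quadForm (hess f x₀) x).im / 4 / h := by
        gcongr
    _ = -((quadForm (hess f x₀) x).im / (4 * h)) := by
        field_simp
        ring
    _ ≤ -(c * ‖x‖ ^ 2 / (4 * h)) := by
        gcongr
        exact hH x
    _ = -(c / (4 * h)) * ‖x‖ ^ 2 := by ring

theorem CriticalData.norm_gaussian_mul_approxPoly_le {δ : ℝ}
    (hD : CriticalData s Au Cu Af Cf {x₀} x₀ f u) (hc : 0 < c) (hh : 0 < h)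
    (hH : ImCoercive c (hess f x₀))
    (hδ : ∀ p : ℕ, Real.exp (-δ / h) ≤ (p.factorial : ℝ) ^ (s - 1 / 2) * √h ^ p) (k : ℕ)
    {x : 𝔼} (hx : 4 * δ ≤ (quadForm (hess f x₀) x).im) :
    ‖gaussian (phaseMatrix (hess f x₀) h) x * approxPoly f u x₀ h k x‖ ≤
      (12 * k ^ 2) * (remSize d s Au Cu Af Cf c h k * Real.exp (-(c / (8 * h)) * ‖x‖ ^ 2)) := by
  refine hD.norm_mul_approxPoly_le hc hh hδ k ?_
  rw [norm_gaussian_phaseMatrix, ← Real.exp_add, Real.exp_le_exp]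
  calc -((quadForm (hess f x₀) x).im / (2 * h))
      = -((quadForm (hess f x₀) x).im / (4 * h)) + -((quadForm (hess f x₀) x).im / (4 * h)) := by
        field_simp
        ring
    _ ≤ -(4 * δ / (4 * h)) + -(c * ‖x‖ ^ 2 / (4 * h)) := by
        gcongr
        exact hH x
    _ = -δ / h + -(c / (4 * h)) * ‖x‖ ^ 2 := by
        field_simp

theorem integrable_indicator_exp_phase_mul (hf : Continuous f) (hu : Continuous u) (x₀ : 𝔼)
    (r h : ℝ) :
    Integrable ((Metric.ball x₀ r).indicator fun x => Complex.exp (Complex.I / h * f x) * u x) :=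
  have hcontinuous : Continuous fun x => Complex.exp (Complex.I / h * f x) * u x := by fun_prop
  ((hcontinuous.continuousOn.integrableOn_compact (isCompact_closedBall x₀ r)).mono_set
    Metric.ball_subset_closedBall).integrable_indicator measurableSet_ball

theorem CriticalData.norm_indicator_sub_gaussian_mul_le {r δ : ℝ} (hr : 0 < r)
    (hD : CriticalData s Au Cu Af Cf (Metric.ball x₀ r) x₀ f u) (hc : 0 < c) (hh : 0 < h)
    (hH : ImCoercive c (hess f x₀))
    (hg : ∀ x : 𝔼, ‖x‖ < r → ‖gRem f x₀ (x₀ + x)‖ ≤ (quadForm (hess f x₀) x).im / 4)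
    (hδr : ∀ x : 𝔼, r ≤ ‖x‖ → 4 * δ ≤ (quadForm (hess f x₀) x).im)
    (hδ : ∀ p : ℕ, Real.exp (-δ / h) ≤ (p.factorial : ℝ) ^ (s - 1 / 2) * √h ^ p) (k : ℕ) (x : 𝔼) :
    ‖(Metric.ball x₀ r).indicator (fun x => Complex.exp (Complex.I / h * f x) * u x) (x₀ + x) -
        gaussian (phaseMatrix (hess f x₀) h) x * approxPoly f u x₀ h k x‖ ≤
      (12 * k ^ 2 + 2 * k + 1) *
        (remSize d s Au Cu Af Cf c h k * Real.exp (-(c / (8 * h)) * ‖x‖ ^ 2)) := by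
  have hsize : 0 ≤ remSize d s Au Cu Af Cf c h k * Real.exp (-(c / (8 * h)) * ‖x‖ ^ 2) :=
    mul_nonneg (hD.remSize_nonneg c h k) (Real.exp_pos _).le
  rcases lt_or_ge ‖x‖ r with hx | hx
  · rw [Set.indicator_of_mem (by simpa using hx)]
    refine (hD.norm_exp_phase_mul_sub_le hc hh hH k hx (hg x hx)).trans ?_
    gcongr
    exact le_add_of_nonneg_left (by positivity)
  · rw [Set.indicator_of_notMem (by simpa using hx), zero_sub, norm_neg]
    have hcenter := hD.mono (Set.singleton_subset_iff.2 (Metric.mem_ball_self hr))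
    refine (hcenter.norm_gaussian_mul_approxPoly_le hc hh hH hδ k (hδr x hx)).trans ?_
    gcongr
    rw [add_assoc]
    exact le_add_of_nonneg_right (by positivity)

theorem CriticalData.norm_integral_sub_expansion_le {r δ : ℝ} (hr : 0 < r)
    (hD : CriticalData s Au Cu Af Cf (Metric.ball x₀ r) x₀ f u) (hc : 0 < c) (hh : 0 < h)
    (hH : ImCoercive c (hess f x₀))
    (hg : ∀ x : 𝔼, ‖x‖ < r → ‖gRem f x₀ (x₀ + x)‖ ≤ (quadForm (hess f x₀) x).im / 4)
    (hδr : ∀ x : 𝔼, r ≤ ‖x‖ → 4 * δ ≤ (quadForm (hess f x₀) x).im)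
    (hδ : ∀ p : ℕ, Real.exp (-δ / h) ≤ (p.factorial : ℝ) ^ (s - 1 / 2) * √h ^ p) (k : ℕ) :
    ‖(∫ x in Metric.ball x₀ r, Complex.exp (Complex.I / (h : ℂ) * f x) * u x) -
        detInvSqrt ((1 / (2 * (Real.pi : ℂ) * Complex.I * (h : ℂ))) • hess f x₀) *
          ∑ j ∈ Finset.range k, (h : ℂ) ^ j * Lop f x₀ j u‖ ≤
      expansionConst d s Au Cu Af Cf c ^ (k + 1) * (k.factorial : ℝ) ^ (2 * s - 1) *
        h ^ ((k : ℝ) + (d : ℝ) / 2) := by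
  have hH_symm : (hess f x₀).IsSymm := isSymm_hess (contDiff_infty.1 hD.contDiff_phase 2) x₀
  have hA := hH.reCoercive_phaseMatrix hh.le
  have hexpansion := (hD.mono (Set.singleton_subset_iff.2
    (Metric.mem_ball_self hr))).integral_gaussian_mul_approxPoly (by positivity) hA
    (hH_symm.smul _) hh.ne' (hH.smul_inv_mul_phaseMatrix hc hh hH_symm) k
  rw [hH.integral_gaussian_phaseMatrix hc hh hH_symm] at hexpansion
  have hintegrable := integrable_indicator_exp_phase_mul hD.contDiff_phase.continuous
    hD.contDiff_amplitude.continuous x₀ r h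
  have hdecay : 0 < c / (8 * h) := by positivity
  rw [← integral_indicator measurableSet_ball, ← integral_add_left_eq_self _ x₀, ← hexpansion,
    ← integral_sub (hintegrable.comp_add_left x₀)
      (integrable_gaussian_mul_approxPoly (by positivity) hA f u x₀ h k)]
  refine (norm_integral_le_of_norm_le (((integrable_exp_neg_mul_sq_norm hdecay).const_mul
    _).const_mul _) (.of_forall
      (hD.norm_indicator_sub_gaussian_mul_le hr hc hh hH hg hδr hδ k))).trans ?_
  rw [integral_const_mul, integral_const_mul, GaussianFourier.integral_rexp_neg_mul_sq_norm hdecay,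
    finrank_euclideanSpace_fin]
  exact hD.remSize_mul_le hc hh k

end MainEstimate

section Localization

variable {s Au Cu Af Cf : ℝ} {W V : Set (EuclideanSpace ℝ (Fin d))}
  {x₀ : EuclideanSpace ℝ (Fin d)} {f u : EuclideanSpace ℝ (Fin d) → ℂ} {r R : ℝ}

theorem exists_contDiff_eq_on_ball (hW : IsOpen W) (hf : ContDiffOn ℝ ∞ f W) (hr : 0 < r)
    (hrR : r < R) (hRW : Metric.closedBall x₀ R ⊆ W) :
    ∃ F : 𝔼 → ℂ, ContDiff ℝ ∞ F ∧ ∀ x ∈ Metric.ball x₀ r, f =ᶠ[nhds x] F := by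
  let χ : ContDiffBump x₀ := ⟨r, R, hr, hrR⟩
  refine ⟨fun x => χ x • f x, contDiff_iff_contDiffAt.2 fun x => ?_, fun x hx => ?_⟩
  · by_cases hx : x ∈ W
    · exact χ.contDiff.contDiffAt.smul (hf.contDiffAt (hW.mem_nhds hx))
    · have hx_support : x ∉ tsupport χ := fun h => hx (hRW (χ.tsupport_eq ▸ h))
      refine (contDiffAt_const (c := (0 : ℂ))).congr_of_eventuallyEq ?_
      filter_upwards [notMem_tsupport_iff_eventuallyEq.1 hx_support] with y hy
      rw [hy, Pi.zero_apply, zero_smul]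
  · filter_upwards [Metric.isOpen_ball.mem_nhds hx] with y hy
    rw [χ.one_of_mem_closedBall (Metric.ball_subset_closedBall hy), one_smul]

theorem exists_criticalData (hs : 1 ≤ s) (hW : IsOpen W) (hr : 0 < r) (hrR : r < R)
    (hRW : Metric.closedBall x₀ R ⊆ W) (hV : V ⊆ Metric.ball x₀ r) (hf : ContDiffOn ℝ ∞ f W)
    (hf₀ : f x₀ = 0) (hf'₀ : fderiv ℝ f x₀ = 0) (hu : ContDiffOn ℝ ∞ u W) (hAu : 0 ≤ Au)
    (hCu : 0 ≤ Cu) (hAf : 0 ≤ Af) (hCf : 0 ≤ Cf) (hu_bound : GevreyBoundOn s Au Cu V u)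
    (hf_bound : GevreyBoundOn s Af Cf V f) :
    ∃ F G : 𝔼 → ℂ, CriticalData s Au Cu Af Cf V x₀ F G ∧
      (∀ x ∈ Metric.ball x₀ r, f =ᶠ[nhds x] F) ∧ ∀ x ∈ Metric.ball x₀ r, u =ᶠ[nhds x] G := by
  obtain ⟨F, hF, hfF⟩ := exists_contDiff_eq_on_ball hW hf hr hrR hRW
  obtain ⟨G, hG, huG⟩ := exists_contDiff_eq_on_ball hW hu hr hrR hRW
  have hfF₀ := hfF x₀ (Metric.mem_ball_self hr)
  have hF'₀ : fderiv ℝ F x₀ = 0 := by rw [← hfF₀.fderiv_eq, hf'₀]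
  exact ⟨F, G, ⟨hs, hAu, hCu, hAf, hCf, hF, hG, hfF₀.eq_of_nhds ▸ hf₀, hF'₀,
    hf_bound.congr fun x hx => hfF x (hV hx), hu_bound.congr fun x hx => huG x (hV hx)⟩, hfF, huG⟩

theorem CriticalData.norm_gRem_le (hD : CriticalData s Au Cu Af Cf (Metric.ball x₀ r) x₀ f u)
    {x : 𝔼} (hx : x ∈ Metric.ball x₀ r) :
    ‖gRem f x₀ x‖ ≤ cubicAmp s Af (Cf * d) * ‖x - x₀‖ ^ 3 := by
  have hsegment (t : ℝ) (ht : t ∈ Set.Icc (0 : ℝ) 1) : x₀ + t • (x - x₀) ∈ Metric.ball x₀ r :=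
    (convex_ball x₀ r).add_smul_sub_mem (Metric.mem_ball_self (Metric.pos_of_mem_ball hx)) hx ht
  have hexpansion := (hasGevreyExpansion_remSeries hD.one_le_order hD.Af_nonneg hD.Cf_nonneg
    hD.contDiff_phase hD.phase_eq_zero hD.fderiv_phase_eq_zero hD.phase_bound (x - x₀) hsegment
    le_rfl).2 0
  simp only [Finset.range_zero, Finset.sum_empty, sub_zero, pow_zero, Nat.factorial_zero,
    Nat.cast_one, Real.one_rpow, mul_one, add_sub_cancel] at hexpansion
  refine hexpansion.trans_eq ?_
  simp only [cubicAmp]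
  ring

theorem IsGevrey.gRem_isBigO (hs : 1 ≤ s) (hW : IsOpen W) (hx₀ : x₀ ∈ W) (hf : IsGevrey s W f)
    (hf₀ : f x₀ = 0) (hf'₀ : fderiv ℝ f x₀ = 0) :
    gRem f x₀ =O[nhds x₀] fun x => ‖x - x₀‖ ^ 3 := by
  obtain ⟨R, hR, hRW⟩ := Metric.nhds_basis_closedBall.mem_iff.1 (hW.mem_nhds hx₀)
  obtain ⟨A, hA, C, hC, hf_bound⟩ := hf.2 _ (isCompact_closedBall x₀ R) hRW
  have hball : Metric.ball x₀ (R / 2) ⊆ Metric.closedBall x₀ R :=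
    (Metric.ball_subset_ball (half_le_self hR.le)).trans Metric.ball_subset_closedBall
  have hf_bound_ball : GevreyBoundOn s A C (Metric.ball x₀ (R / 2)) f :=
    fun α x hx => hf_bound α x (hball hx)
  obtain ⟨F, G, hD, hfF, -⟩ := exists_criticalData hs hW (half_pos hR) (half_lt_self hR) hRW
    subset_rfl hf.1 hf₀ hf'₀ hf.1 hA.le hC.le hA.le hC.le hf_bound_ball hf_bound_ball
  refine .of_bound (cubicAmp s A (C * d)) ?_
  filter_upwards [Metric.ball_mem_nhds x₀ (half_pos hR),
    gRem_congr (hfF x₀ (Metric.mem_ball_self (half_pos hR)))] with x hx hgRem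
  rw [hgRem, norm_pow, norm_norm]
  exact hD.norm_gRem_le hx

theorem IsGevrey.exists_radius (hs : 1 ≤ s) (hW : IsOpen W) (hx₀ : x₀ ∈ W)
    (hf : IsGevrey s W f) (hf₀ : f x₀ = 0) (hf'₀ : fderiv ℝ f x₀ = 0) {m : ℝ} (hm : 0 < m) :
    ∃ r > 0, ∃ R > r, Metric.closedBall x₀ R ⊆ W ∧
      ∀ x ∈ Metric.ball x₀ r, ‖gRem f x₀ x‖ ≤ m * ‖x - x₀‖ ^ 2 := by
  have hlittle : gRem f x₀ =o[nhds x₀] fun x => ‖x - x₀‖ ^ 2 :=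
    (hf.gRem_isBigO hs hW hx₀ hf₀ hf'₀).trans_isLittleO
      ((Asymptotics.isLittleO_pow_pow (by norm_num)).comp_tendsto
        (tendsto_norm_sub_self x₀))
  obtain ⟨R, hR, hRW⟩ := Metric.nhds_basis_closedBall.mem_iff.1 (hW.mem_nhds hx₀)
  obtain ⟨ε, hε, hbound⟩ := Metric.eventually_nhds_iff_ball.1 (hlittle.bound hm)
  refine ⟨min (R / 2) ε, by positivity, R, (min_le_left _ _).trans_lt (half_lt_self hR), hRW,
    fun x hx => ?_⟩
  simpa using hbound x (Metric.ball_subset_ball (min_le_right _ _) hx)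

theorem im_quadForm (H : Matrix (Fin d) (Fin d) ℂ) (x : 𝔼) :
    (quadForm H x).im = x.ofLp ⬝ᵥ (H.map Complex.im).mulVec x.ofLp := by
  simp only [quadForm, Complex.im_sum, dotProduct, Matrix.mulVec, Finset.mul_sum,
    Matrix.map_apply]
  refine Finset.sum_congr rfl fun i _ => Finset.sum_congr rfl fun j _ => ?_
  rw [Complex.im_mul_ofReal, Complex.im_mul_ofReal]
  ring

theorem imCoercive_of_dotProduct_le {H : Matrix (Fin d) (Fin d) ℂ} {c : ℝ}
    (hH : ∀ v : Fin d → ℝ, c * (v ⬝ᵥ v) ≤ v ⬝ᵥ (H.map Complex.im).mulVec v) :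
    ImCoercive c H := fun x => by
  rw [im_quadForm, EuclideanSpace.real_norm_sq_eq]
  simpa only [dotProduct, sq] using hH x.ofLp

theorem quadForm_real_smul (H : Matrix (Fin d) (Fin d) ℂ) (t : ℝ) (x : 𝔼) :
    quadForm H (t • x) = (t ^ 2 : ℝ) * quadForm H x := by
  simp only [quadForm, Finset.mul_sum]
  refine Finset.sum_congr rfl fun i _ => Finset.sum_congr rfl fun j _ => ?_
  simp only [PiLp.smul_apply, smul_eq_mul, Complex.ofReal_mul, Complex.ofReal_pow]
  ring

theorem imCoercive_of_sphere {H : Matrix (Fin d) (Fin d) ℂ} {m : ℝ}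
    (hm : ∀ x ∈ Metric.sphere (0 : 𝔼) 1, m ≤ (quadForm H x).im) : ImCoercive m H := fun x => by
  rcases eq_or_ne x 0 with rfl | hx
  · simp [quadForm]
  · have hunit := hm (‖x‖⁻¹ • x) (by simp [norm_smul, hx])
    rwa [quadForm_real_smul, Complex.im_ofReal_mul, inv_pow, inv_mul_eq_div,
      le_div_iff₀ (by positivity)] at hunit

theorem exists_imCoercive {H : Matrix (Fin d) (Fin d) ℂ} (hH : (H.map Complex.im).PosDef) :
    ∃ m > 0, ImCoercive m H := by
  have hcont : Continuous fun x : 𝔼 => (quadForm H x).im :=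
    Complex.continuous_im.comp (contDiff_quadForm H).continuous
  have hpos (x : 𝔼) (hx : x ≠ 0) : 0 < (quadForm H x).im := by
    rw [im_quadForm]
    simpa using hH.dotProduct_mulVec_pos (x := x.ofLp) (by simpa using hx)
  rcases (Metric.sphere (0 : 𝔼) 1).eq_empty_or_nonempty with hempty | hne
  · exact ⟨1, one_pos, imCoercive_of_sphere fun x hx => by simp [hempty] at hx⟩
  · obtain ⟨y, hy, hmin⟩ := (isCompact_sphere (0 : 𝔼) 1).exists_isMinOn hne hcont.continuousOn
    exact ⟨_, hpos y (Metric.ne_of_mem_sphere hy one_ne_zero),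
      imCoercive_of_sphere fun x hx => hmin hx⟩

theorem IsGevrey.norm_Lop_le (hs : 1 ≤ s) (hW : IsOpen W) (hx₀ : x₀ ∈ W) (hf : IsGevrey s W f)
    (hf₀ : f x₀ = 0) (hf'₀ : fderiv ℝ f x₀ = 0) (hu : IsGevrey s W u) (hAu : 0 ≤ Au)
    (hCu : 0 ≤ Cu) (hAf : 0 ≤ Af) (hCf : 0 ≤ Cf) {c₀ : ℝ} (hc₀ : 0 ≤ c₀)
    (hu_bound : GevreyBoundOn s Au Cu {x₀} u) (hf_bound : GevreyBoundOn s Af Cf {x₀} f)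
    (hhess : ∀ i j, ‖(hess f x₀)⁻¹ i j‖ ≤ c₀) (j : ℕ) :
    ‖Lop f x₀ j u‖ ≤
      Au * coefficientConst d s Cu Af Cf c₀ ^ j * (j.factorial : ℝ) ^ (2 * s - 1) := by
  obtain ⟨R, hR, hRW⟩ := Metric.nhds_basis_closedBall.mem_iff.1 (hW.mem_nhds hx₀)
  have hx₀_ball : x₀ ∈ Metric.ball x₀ (R / 2) := Metric.mem_ball_self (half_pos hR)
  obtain ⟨F, G, hD, hfF, huG⟩ := exists_criticalData hs hW (half_pos hR) (half_lt_self hR) hRW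
    (Set.singleton_subset_iff.2 hx₀_ball) hf.1 hf₀ hf'₀ hu.1 hAu hCu hAf hCf hu_bound hf_bound
  rw [hess_congr (hfF x₀ hx₀_ball)] at hhess
  rw [Lop_congr (hfF x₀ hx₀_ball) (huG x₀ hx₀_ball)]
  exact hD.norm_Lop_le hc₀ hhess j

theorem norm_integral_sub_expansion_le_of_contDiffOn {c m h : ℝ} (hs : 1 ≤ s) (hW : IsOpen W)
    (hr : 0 < r) (hrR : r < R) (hRW : Metric.closedBall x₀ R ⊆ W) (hf : ContDiffOn ℝ ∞ f W)
    (hf₀ : f x₀ = 0) (hf'₀ : fderiv ℝ f x₀ = 0) (hu : ContDiffOn ℝ ∞ u W) (hAu : 0 ≤ Au)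
    (hCu : 0 ≤ Cu) (hAf : 0 ≤ Af) (hCf : 0 ≤ Cf)
    (hu_bound : GevreyBoundOn s Au Cu (Metric.ball x₀ r) u)
    (hf_bound : GevreyBoundOn s Af Cf (Metric.ball x₀ r) f) (hc : 0 < c)
    (hHc : ImCoercive c (hess f x₀)) (hm : 0 ≤ m) (hHm : ImCoercive m (hess f x₀))
    (hg : ∀ x ∈ Metric.ball x₀ r, ‖gRem f x₀ x‖ ≤ m / 4 * ‖x - x₀‖ ^ 2) (hh : 0 < h)
    (hδ : ∀ p : ℕ, Real.exp (-(m / 4 * r ^ 2) / h) ≤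
      (p.factorial : ℝ) ^ (s - 1 / 2) * √h ^ p) (k : ℕ) :
    ‖(∫ x in Metric.ball x₀ r, Complex.exp (Complex.I / (h : ℂ) * f x) * u x) -
        detInvSqrt ((1 / (2 * (Real.pi : ℂ) * Complex.I * (h : ℂ))) • hess f x₀) *
          ∑ j ∈ Finset.range k, (h : ℂ) ^ j * Lop f x₀ j u‖ ≤
      expansionConst d s Au Cu Af Cf c ^ (k + 1) * (k.factorial : ℝ) ^ (2 * s - 1) *
        h ^ ((k : ℝ) + (d : ℝ) / 2) := by
  obtain ⟨F, G, hD, hfF, huG⟩ := exists_criticalData hs hW hr hrR hRW subset_rfl hf hf₀ hf'₀ hu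
    hAu hCu hAf hCf hu_bound hf_bound
  have hfF₀ := hfF x₀ (Metric.mem_ball_self hr)
  have hhess := hess_congr hfF₀
  have hgF (x : 𝔼) (hx : ‖x‖ < r) :
      ‖gRem F x₀ (x₀ + x)‖ ≤ (quadForm (hess F x₀) x).im / 4 := by
    have hx_ball : x₀ + x ∈ Metric.ball x₀ r := by simpa using hx
    have hg_x := hg (x₀ + x) hx_ball
    rw [add_sub_cancel_left] at hg_x
    rw [gRem, ← (hfF _ hx_ball).eq_of_nhds, ← hhess]
    exact hg_x.trans (by linarith [hHm x])
  have hδr (x : 𝔼) (hx : r ≤ ‖x‖) : 4 * (m / 4 * r ^ 2) ≤ (quadForm (hess F x₀) x).im := by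
    calc 4 * (m / 4 * r ^ 2) = m * r ^ 2 := by ring
      _ ≤ m * ‖x‖ ^ 2 := by gcongr
      _ ≤ (quadForm (hess F x₀) x).im := hhess ▸ hHm x
  have hintegrand : Set.EqOn (fun x => Complex.exp (Complex.I / (h : ℂ) * f x) * u x)
      (fun x => Complex.exp (Complex.I / (h : ℂ) * F x) * G x) (Metric.ball x₀ r) := fun x hx => by
    simp only [(hfF x hx).eq_of_nhds, (huG x hx).eq_of_nhds]
  rw [setIntegral_congr_fun measurableSet_ball hintegrand, hhess]
  simp only [Lop_congr hfF₀ (huG x₀ (Metric.mem_ball_self hr))]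
  exact hD.norm_integral_sub_expansion_le hr hc hh (hhess ▸ hHc) hgF hδr hδ k

end Localization

end GevreyPhase

end

theorem mainTheorem7 (d : ℕ) (s : ℝ) (hs : 1 < s) :
    -- `K` and `M` give the constants: they depend only on `d`, `s` and their listed arguments
    ∃ (K : ℝ → ℝ → ℝ → ℝ → ℝ → ℝ) (M : ℝ → ℝ → ℝ → ℝ → ℝ),
      ∀ (W : Set (EuclideanSpace ℝ (Fin d))) (x₀ : EuclideanSpace ℝ (Fin d))
        (f : EuclideanSpace ℝ (Fin d) → ℂ),
        IsOpen W → x₀ ∈ W → GevreyPhase.IsGevrey s W f →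
        f x₀ = 0 → fderiv ℝ f x₀ = 0 →
        ((GevreyPhase.hess f x₀).map Complex.im).PosDef →
        -- the expansion with its remainder estimate
        (∃ (U : Set (EuclideanSpace ℝ (Fin d))) (h₀ : ℝ),
          IsOpen U ∧ x₀ ∈ U ∧ IsCompact (closure U) ∧ closure U ⊆ W ∧ 0 < h₀ ∧
          ∀ u : EuclideanSpace ℝ (Fin d) → ℂ, GevreyPhase.IsGevrey s W u →
            ∀ Au Cu Af Cf c : ℝ, 0 < Au → 0 < Cu → 0 < Af → 0 < Cf → 0 < c →
              GevreyPhase.GevreyBoundOn s Au Cu U u →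
              GevreyPhase.GevreyBoundOn s Af Cf U f →
              (∀ v : Fin d → ℝ,
                c * (v ⬝ᵥ v) ≤ v ⬝ᵥ ((GevreyPhase.hess f x₀).map Complex.im).mulVec v) →
              ∀ (k : ℕ) (h : ℝ), 0 < h → h < h₀ →
                ‖(∫ x in U, Complex.exp (Complex.I / (h : ℂ) * f x) * u x) -
                    GevreyPhase.detInvSqrt
                        ((1 / (2 * (Real.pi : ℂ) * Complex.I * (h : ℂ))) •
                          GevreyPhase.hess f x₀) *
                      ∑ j ∈ Finset.range k, (h : ℂ) ^ j * GevreyPhase.Lop f x₀ j u‖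
                  ≤ K Au Cu Af Cf c ^ (k + 1) * (k.factorial : ℝ) ^ (2 * s - 1) *
                      h ^ ((k : ℝ) + (d : ℝ) / 2)) ∧
        -- the estimate of the coefficients
        (∀ u : EuclideanSpace ℝ (Fin d) → ℂ, GevreyPhase.IsGevrey s W u →
          ∀ Au Cu Af Cf c₀ : ℝ, 0 < Au → 0 < Cu → 0 < Af → 0 < Cf → 0 < c₀ →
            GevreyPhase.GevreyBoundOn s Au Cu {x₀} u →
            GevreyPhase.GevreyBoundOn s Af Cf {x₀} f →
            (∀ i j, ‖(GevreyPhase.hess f x₀)⁻¹ i j‖ ≤ c₀) →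
            ∀ j : ℕ, ‖GevreyPhase.Lop f x₀ j u‖
              ≤ 2 * Au * M Cu Af Cf c₀ ^ j * (j.factorial : ℝ) ^ (2 * s - 1)) := by
  refine ⟨GevreyPhase.expansionConst d s, GevreyPhase.coefficientConst d s,
    fun W x₀ f hW hx₀ hf hf₀ hf'₀ hH => ⟨?_, fun u hu Au Cu Af Cf c₀ hAu hCu hAf hCf hc₀ hu_bound
      hf_bound hhess j => ?_⟩⟩
  · obtain ⟨m, hm, hHm⟩ := GevreyPhase.exists_imCoercive hH
    obtain ⟨r, hr, R, hrR, hRW, hg⟩ :=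
      hf.exists_radius hs.le hW hx₀ hf₀ hf'₀ (by positivity : 0 < m / 4)
    obtain ⟨h₀, hh₀, hδ⟩ :=
      GevreyPhase.exists_exp_neg_div_le hs (by positivity : 0 < m / 4 * r ^ 2)
    refine ⟨Metric.ball x₀ r, h₀, Metric.isOpen_ball, Metric.mem_ball_self hr,
      Metric.isBounded_ball.isCompact_closure, Metric.closure_ball_subset_closedBall.trans
        ((Metric.closedBall_subset_closedBall hrR.le).trans hRW), hh₀, ?_⟩
    intro u hu Au Cu Af Cf c hAu hCu hAf hCf hc hu_bound hf_bound hHc k h hh hhh₀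
    exact GevreyPhase.norm_integral_sub_expansion_le_of_contDiffOn hs.le hW hr hrR hRW hf.1 hf₀
      hf'₀ hu.1 hAu.le hCu.le hAf.le hCf.le hu_bound hf_bound hc
      (GevreyPhase.imCoercive_of_dotProduct_le hHc) hm.le hHm hg hh (hδ h hh hhh₀) k
  · have := GevreyPhase.coefficientConst_pos hCu.le hAf.le hCf.le hc₀.le d s
    refine (hf.norm_Lop_le hs.le hW hx₀ hf₀ hf'₀ hu hAu.le hCu.le hAf.le hCf.le hc₀.le hu_bound
      hf_bound hhess j).trans ?_
    gcongr
    linarith
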